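/- Let $d\ge 1$ and write $\widehat f(\xi)=(2\pi)^{-n/2}\int_{\mathbb R^n} f(x)e^{-i\xi\cdot x}\,dx$ for the Fourier transform on $\mathbb R^n$. **Activation function.** Let $\phi:\mathbb R\to\mathbb R$ be bounded and Lipschitz with constant $L_\phi$. For $r\in\mathbb N_0$ let $\mathcal S_{r}(\mathbb R)$ be the set of (complex-valued) Schwartz functions $h$ with $h(\xi)=O(|\xi|^{r})$ as $\xi\to0$. Assume that $\phi$ has a generalised Fourier transform $\widehat\phi\in L^2_{\rm loc}(\mathbb R\setminus\{0\})$ of some order $q\in\mathbb N_0$: for all $h\in\mathcal S_{2q}(\mathbb R)$, $\widehat\phi\,h$ is integrable and $\int\widehat\phi\,h=\int\phi\,\widehat h$. Let $\psi:\mathbb R\to\mathbb R$ be a Schwartz function such that $\widehat\psi\in\mathcal S_{2q}(\mathbb R)$ for such an order $q$, $$(2\pi)^{d/2}\int_{\mathbb R}|\xi|^{-d}\,\overline{\widehat\psi(\xi)}\,\widehat\phi(\xi)\,d\xi=1,\qquad \int_{\mathbb R}|\xi|^{-d-2}\,\bigl|\overline{\widehat\psi(\xi)}\,\widehat\phi(\xi)\bigr|\,d\xi<\infty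 .$$ **Bandwidths.** Let $p_w$ and $p_b$ be probability density functions on $\mathbb R^d$ and on $\mathbb R$, each symmetric ($p(-x)=p(x)$), essentially bounded, with finite second moment, and with everywhere positive and integrable Fourier transform. Assume also that $\int\|x\|^2\,\widehat{p_w}(x)\,dx<\infty$ and that $p_b$ is differentiable with bounded derivative. For $\sigma_w,\sigma_b>0$ put $p_{w,\sigma}(w)=\sigma_w^{-d}p_w(\sigma_w^{-1}w)$, $p_{b,\sigma}(b)=\sigma_b^{-1}p_b(\sigma_b^{-1}b)$ and $$Z=(2\pi)^{1/2}\,\sigma_w^d\,\sigma_b\,\big/\,\bigl(\|\widehat{p_w}\|_{L^1}\,\|\widehat{p_b}\|_{L^1}\bigr).$$ **Discretisation.** Let $\mathcal X\subset\mathbb R^d$ be compact and contained in the interior of $[-S,S]^d$, $S>0$, and let $\chi\in C^\infty(\mathbb R^d)$ satisfy $0\le\chi\le1$, $\chi=1$ on $\mathcal X$ and $\chi=0$ off $[-S,S]^d$. For $n,N\ge1$ let $D=n^d$ and let $x_1,\dots,x_D$ be the points of the grid $\{-S+2Sl/n: l=0,\dots,n-1\}^d$. Let $(w_i,b_i)$,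 $i=1,\dots,N$, be independent samples from the density $p_{w,\sigma}\times p_{b,\sigma}$ on $\mathbb R^d\times\mathbb R$, and put $$I_{\sigma,D,N}f(x)=\sum_{i=1}^N\frac ZN\Bigl(\sum_{j=1}^D\frac{(2S)^d}{D}\,\chi(x_j)f(x_j)\,\psi(w_i\cdot x_j+b_i)\Bigr)\phi(w_i\cdot x+b_i).$$ **Gaussian process.** Let $f\sim\mathcal{GP}(m,k)$ on $\mathbb R^d$ be independent of $\{(w_i,b_i)\}_{i=1}^N$, with $m\in C^1(\mathbb R^d)$ and with $k$ symmetric, positive definite ($\sum_{i,j}a_ia_jk(z_i,z_j)>0$ for distinct points $z_i$ and $a\ne0$) and in $C^{1\times1}(\mathbb R^d\times\mathbb R^d)$, that is, the partial derivatives $\partial_x^{\alpha}\partial_y^{\beta}k$ exist and are continuous for $|\alpha|,|\beta|\le1$. Put $$M_1^*(m)=\max_{|\alpha|\le1}\sup_{x\in[-S,S]^d}|\partial^\alpha m(x)|,\qquad M_1^*(k)=\max_{|\alpha|,|\beta|\le1}\ \sup_{x,y\in[-S,S]^d}|\partial_x^\alpha\partial_y^\beta k(x,y)|.$$ **Theorem.**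 There is a constant $C>0$, independent of $m,k,\sigma_w,\sigma_b,D,N,\delta$ and of the underlying probability space, such that for all such $m$ and $k$, all $\sigma_w,\sigma_b>0$, all $n,N\ge1$ and all $\delta\in(0,1)$ the following holds. For $x\in\mathcal X$ the variable $(f(x)-I_{\sigma,D,N}f(x))^2$ is integrable, the random field $x\mapsto\mathbb E[(f(x)-I_{\sigma,D,N}f(x))^2\mid\{w_i,b_i\}_{i=1}^N]$ on $\mathcal X$ has a version with almost surely continuous paths, and for every such version, with probability at least $1-\delta$, $$\sup_{x\in\mathcal X}\sqrt{\mathbb E\bigl[(f(x)-I_{\sigma,D,N}f(x))^2\,\big|\,\{w_i,b_i\}_{i=1}^N\bigr]}\ \le\ C\Bigl(M_1^*(m)+\sqrt{M_1^*(k)}\Bigr)\left\{\frac1{\sigma_w}+\frac{\sigma_w^d(\sigma_w+1)}{\sigma_b}+\frac{\sigma_b\sigma_w^d(\sigma_w+1)}{D^{1/d}}+\frac{\sigma_b\sigma_w^d\bigl(\sigma_w+\sqrt{\log\delta^{-1}}\bigr)}{\sqrt N}\right\}.$$ -/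

import Mathlib

open MeasureTheory ProbabilityTheory Filter Topology
open scoped SchwartzMap ENNReal NNReal

namespace RidgeletPrior

noncomputable section

/-- Euclidean space `ℝ^d`. -/
abbrev Euc (d : ℕ) : Type := EuclideanSpace ℝ (Fin d)

/-- The unitary Fourier transform
`(2π)^{-n/2} ∫ f(x) exp(-i ξ · x) dx` on an `n`-dimensional Euclidean space. -/
def fourierU {V : Type*} [NormedAddCommGroup V] [InnerProductSpace ℝ V] [MeasureSpace V]
    (f : V → ℂ) (ξ : V) : ℂ :=
  (((2 * Real.pi) ^ (-(Module.finrank ℝ V : ℝ) / 2) : ℝ) : ℂ) *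
    ∫ x, f x * Complex.exp (-Complex.I * ((inner ℝ ξ x : ℝ) : ℂ))

/-- The Fourier transform of a real-valued function. -/
def fourierR {V : Type*} [NormedAddCommGroup V] [InnerProductSpace ℝ V] [MeasureSpace V]
    (f : V → ℝ) (ξ : V) : ℂ :=
  fourierU (fun x => (f x : ℂ)) ξ

/-! ### Activation function -/

/-- `that ∈ L²_loc(ℝ \ {0})` satisfies `∫ that f = ∫ t f^` for every Schwartz function `f` with
`f(x) = O(|x|^{2m})` as `x → 0`: it is a generalised Fourier transform of `t`, of order `m`. -/
structure IsGeneralizedFourier (t : ℝ → ℝ) (that : ℝ → ℂ) (m : ℕ) : Prop where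
  locL2 : ∀ K : Set ℝ, IsCompact K → K ⊆ {0}ᶜ → MemLp that 2 (volume.restrict K)
  pairing : ∀ f : 𝓢(ℝ, ℂ), (f : ℝ → ℂ) =O[𝓝 0] (fun x : ℝ => |x| ^ (2 * m)) →
    Integrable (fun w => that w * f w) ∧
      ∫ w, that w * f w = ∫ x, (t x : ℂ) * fourierU (f : ℝ → ℂ) x

/-- Regularity of the activation function `phi`, with generalised Fourier transform `phihat`, and
of the function `psi` defining the ridgelet transform in dimension `d`. -/
structure IsActivationPair (d : ℕ) (phi : ℝ → ℝ) (phihat : ℝ → ℂ) (psi : 𝓢(ℝ, ℝ)) : Prop where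
  continuous : Continuous phi
  bounded : ∃ c : ℝ, ∀ x, |phi x| ≤ c
  /-- `phihat` is a generalised Fourier transform of `phi`, of an order `m` such that the Fourier
  transform of `psi` is one of the test functions allowed for that order. -/
  fourier : ∃ m : ℕ, IsGeneralizedFourier phi phihat m ∧
    fourierR (psi : ℝ → ℝ) =O[𝓝 0] (fun ξ : ℝ => |ξ| ^ (2 * m))
  normalized : (((2 * Real.pi) ^ ((d : ℝ) / 2) : ℝ) : ℂ) *
    ∫ ξ : ℝ, (((|ξ| ^ d)⁻¹ : ℝ) : ℂ) * (starRingEnd ℂ (fourierR (psi : ℝ → ℝ) ξ) * phihat ξ) = 1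
  integrable : Integrable
    (fun ξ : ℝ => (|ξ| ^ (d + 2))⁻¹ * ‖starRingEnd ℂ (fourierR (psi : ℝ → ℝ) ξ) * phihat ξ‖)

/-! ### Bandwidth densities -/

/-- A probability density function that is symmetric and bounded, has a finite second moment, and
has a positive and integrable Fourier transform. -/
structure IsRegularDensity {V : Type*} [NormedAddCommGroup V] [InnerProductSpace ℝ V]
    [MeasureSpace V] (p : V → ℝ) : Prop where
  measurable : Measurable p
  nonneg : ∀ x, 0 ≤ p x
  integral_eq_one : ∫ x, p x = 1
  symmetric : ∀ x, p (-x) = p x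
  bounded : eLpNorm p ∞ volume < ∞
  secondMoment : Integrable (fun x => ‖x‖ ^ 2 * p x)
  fourier_pos : ∀ x, (fourierR p x).im = 0 ∧ 0 < (fourierR p x).re
  fourier_integrable : Integrable (fourierR p)

/-- The assumptions on the densities of the (unscaled) weights and biases. -/
structure IsBandwidthPair {d : ℕ} (pw : Euc d → ℝ) (pb : ℝ → ℝ) : Prop where
  regular_w : IsRegularDensity pw
  regular_b : IsRegularDensity pb
  fourier_secondMoment : Integrable (fun x => ((‖x‖ ^ 2 : ℝ) : ℂ) * fourierR pw x)
  differentiable_b : Differentiable ℝ pb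
  deriv_bounded_b : ∃ c : ℝ, ∀ b, |deriv pb b| ≤ c

/-- The density `x ↦ σ^{-n} p(σ^{-1} x)` on an `n`-dimensional space. -/
def scaledDensity {V : Type*} [NormedAddCommGroup V] [InnerProductSpace ℝ V]
    (σ : ℝ) (p : V → ℝ) (x : V) : ℝ :=
  (σ ^ Module.finrank ℝ V)⁻¹ * p (σ⁻¹ • x)

/-- The law `p_{w,σ} × p_{b,σ}` of one weight–bias pair. -/
def paramLaw {d : ℕ} (pw : Euc d → ℝ) (pb : ℝ → ℝ) (σw σb : ℝ) : Measure (Euc d × ℝ) :=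
  (volume.withDensity fun w => ENNReal.ofReal (scaledDensity σw pw w)).prod
    (volume.withDensity fun b => ENNReal.ofReal (scaledDensity σb pb b))

/-- The total mass `Z` of the finite measure of the finite-bandwidth dual transform. -/
def totalMass {d : ℕ} (pw : Euc d → ℝ) (pb : ℝ → ℝ) (σw σb : ℝ) : ℝ :=
  (2 * Real.pi) ^ ((1 : ℝ) / 2) * σw ^ d * σb /
    ((∫ x, ‖fourierR pw x‖) * ∫ x, ‖fourierR pb x‖)

/-! ### Cubature and the discretised operator -/

/-- The hyper-cube `[-S, S]^d`. -/
def cube (d : ℕ) (S : ℝ) : Set (Euc d) := {x | ∀ i, x i ∈ Set.Icc (-S) S}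

/-- A smooth cut-off function, equal to `1` on `X` and to `0` off `[-S, S]^d`. -/
structure IsMollifier {d : ℕ} (X : Set (Euc d)) (S : ℝ) (χ : Euc d → ℝ) : Prop where
  smooth : ContDiff ℝ (⊤ : ℕ∞) χ
  mem_Icc : ∀ x, χ x ∈ Set.Icc (0 : ℝ) 1
  eq_one : ∀ x ∈ X, χ x = 1
  eq_zero : ∀ x, x ∉ cube d S → χ x = 0

/-- The nodes of the `d`-fold product of the `n`-point left endpoint rule on `[-S, S]`. -/
def gridNode {d : ℕ} (S : ℝ) (n : ℕ) (j : Fin d → Fin n) : Euc d :=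
  WithLp.toLp 2 fun i => -S + 2 * S / n * ((j i : ℕ) : ℝ)

/-- The operator `I_{σ,D,N}` with `D = n^d` grid nodes, cubature weights
`u_j = (2S)^d D⁻¹ χ(x_j)`, and hidden units `(w_i, b_i)` with cubature weights `v_i = Z / N`. -/
def ridgeletOp {d : ℕ} (phi : ℝ → ℝ) (psi : ℝ → ℝ) (S : ℝ) (χ : Euc d → ℝ) (Z : ℝ) (n N : ℕ)
    (w : Fin N → Euc d) (b : Fin N → ℝ) (g : Euc d → ℝ) (x : Euc d) : ℝ :=
  ∑ i : Fin N, Z / N *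
    (∑ j : Fin d → Fin n, (2 * S) ^ d / ((n ^ d : ℕ) : ℝ) * χ (gridNode S n j) *
      g (gridNode S n j) * psi (inner ℝ (w i) (gridNode S n j) + b i)) *
    phi (inner ℝ (w i) x + b i)

/-! ### Mean and covariance functions -/

/-- The partial derivative `∂^α g`, `|α| ≤ 1`: `none` is `α = 0` and `some i` is `α = e_i`. -/
def partialD {d : ℕ} (α : Option (Fin d)) (g : Euc d → ℝ) (x : Euc d) : ℝ :=
  match α with
  | none => g x
  | some i => lineDeriv ℝ g x (EuclideanSpace.single i 1)

/-- The mixed partial derivative `∂_x^α ∂_y^β k (x, y)`, `|α|, |β| ≤ 1`. -/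
def mixedD {d : ℕ} (α β : Option (Fin d)) (k : Euc d → Euc d → ℝ) (x y : Euc d) : ℝ :=
  partialD α (fun x' => partialD β (k x') y) x

/-- `k ∈ C^{1×1}(ℝ^d × ℝ^d)`. -/
structure IsC11 {d : ℕ} (k : Euc d → Euc d → ℝ) : Prop where
  exists_y : ∀ (j : Fin d) (x y : Euc d),
    LineDifferentiableAt ℝ (k x) y (EuclideanSpace.single j 1)
  exists_x : ∀ (β : Option (Fin d)) (i : Fin d) (x y : Euc d),
    LineDifferentiableAt ℝ (fun x' => partialD β (k x') y) x (EuclideanSpace.single i 1)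
  continuous : ∀ α β : Option (Fin d), Continuous fun z : Euc d × Euc d => mixedD α β k z.1 z.2

/-- (Strict) positive definiteness of a bivariate function. -/
def IsPosDefKernel {d : ℕ} (k : Euc d → Euc d → ℝ) : Prop :=
  ∀ (n : ℕ) (x : Fin n → Euc d) (a : Fin n → ℝ), Function.Injective x → a ≠ 0 →
    0 < ∑ i, ∑ j, a i * a j * k (x i) (x j)

/-- `M_1^*(m)`: the largest absolute value on `[-S, S]^d` of `m` and its first partial
derivatives. -/
def M1star {d : ℕ} (S : ℝ) (m : Euc d → ℝ) : ℝ :=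
  ⨆ p : Option (Fin d) × cube d S, |partialD p.1 m p.2|

/-- `M_1^*(k)`: the largest absolute value on `[-S, S]^d × [-S, S]^d` of the `∂_x^α ∂_y^β k`,
`|α|, |β| ≤ 1`. -/
def M1starK {d : ℕ} (S : ℝ) (k : Euc d → Euc d → ℝ) : ℝ :=
  ⨆ p : (Option (Fin d) × Option (Fin d)) × (cube d S × cube d S),
    |mixedD p.1.1 p.1.2 k p.2.1 p.2.2|

/-- `f ∼ GP(m, k)`. -/
structure IsGP {d : ℕ} {Ω : Type*} [MeasurableSpace Ω] (P : Measure Ω)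
    (f : Euc d → Ω → ℝ) (m : Euc d → ℝ) (k : Euc d → Euc d → ℝ) : Prop where
  measurable : ∀ x, Measurable (f x)
  gaussian : IsGaussianProcess f P
  mean : ∀ x, ∫ ω, f x ω ∂P = m x
  covariance : ∀ x y, cov[f x, f y; P] = k x y

/-- The pairs `(w_i, b_i)` are independent samples from `p_{w,σ} × p_{b,σ}`. -/
structure IsParamSample {d N : ℕ} {Ω : Type*} [MeasurableSpace Ω] (P : Measure Ω)
    (w : Fin N → Ω → Euc d) (b : Fin N → Ω → ℝ) (pw : Euc d → ℝ) (pb : ℝ → ℝ)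
    (σw σb : ℝ) : Prop where
  measurable_w : ∀ i, Measurable (w i)
  measurable_b : ∀ i, Measurable (b i)
  indep : iIndepFun (fun i ω => (w i ω, b i ω)) P
  law : ∀ i, P.map (fun ω => (w i ω, b i ω)) = paramLaw pw pb σw σb

/-- All weights and biases, as one random element. -/
def params {d N : ℕ} {Ω : Type*} (w : Fin N → Ω → Euc d) (b : Fin N → Ω → ℝ) (ω : Ω) :
    Fin N → Euc d × ℝ :=
  fun i => (w i ω, b i ω)

/-- `V` is a version of the random field `x ↦ E[Y x | w, b]`, `x ∈ X`, with continuous sample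
paths. Conditional expectations are only determined up to null sets, separately for each `x`; the
continuous version is determined up to one null set for all `x ∈ X` together, so that the supremum
over `X` makes sense. -/
structure IsContinuousCondExp {d N : ℕ} {Ω : Type*} [MeasurableSpace Ω] (P : Measure Ω)
    (w : Fin N → Ω → Euc d) (b : Fin N → Ω → ℝ) (X : Set (Euc d))
    (Y V : Euc d → Ω → ℝ) : Prop where
  version : ∀ x ∈ X, V x =ᵐ[P] P[Y x | MeasurableSpace.comap (params w b) inferInstance]
  continuous : ∀ᵐ ω ∂P, ContinuousOn (fun x => V x ω) X

/-- The squared error `(f(x) - I_{σ,D,N} f(x))²` at the random weights and biases. -/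
def sqError {d N : ℕ} {Ω : Type*} (phi psi : ℝ → ℝ) (S : ℝ) (χ : Euc d → ℝ) (Z : ℝ) (n : ℕ)
    (w : Fin N → Ω → Euc d) (b : Fin N → Ω → ℝ) (f : Euc d → Ω → ℝ) (x : Euc d) (ω : Ω) : ℝ :=
  (f x ω - ridgeletOp phi psi S χ Z n N (fun i => w i ω) (fun i => b i ω) (fun y => f y ω) x) ^ 2

/-- The sum of the four error terms, with `D` grid nodes and `N` hidden units. -/
def rate (d : ℕ) (σw σb : ℝ) (D N : ℕ) (δ : ℝ) : ℝ :=
  1 / σw + σw ^ d * (σw + 1) / σb + σb * σw ^ d * (σw + 1) / (D : ℝ) ^ ((1 : ℝ) / d) +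
    σb * σw ^ d * (σw + √(Real.log δ⁻¹)) / √(N : ℝ)

end

end RidgeletPrior

open RidgeletPrior

namespace RidgeletPrior

/-! ### Sums of independent random elements of a normed space -/

section IndependentSums

variable {Θ : Type*} [MeasurableSpace Θ] {μ : Measure Θ} [IsProbabilityMeasure μ]
variable {B : Type*} [NormedAddCommGroup B]

/-! Regard the process as the map F : x ↦ f(x) into the Hilbert space H = L²(P). Its Gram kernel is
k(x,y) + m(x)m(y). Since the parameters are independent of f, the conditional mean square error at x
is ‖F(x) - I F(x)‖², where the operator acts on the H-valued function F with frozen parameters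
(`condExp_sq_sum`). Randomness then remains only in the parameters. With L = M_1^*(m) + √M_1^*(k), F
is bounded by L and Lipschitz with constant dL on the cube (`norm_feature_le`,
`norm_feature_sub_le`), because a squared increment of F is a mixed second difference of k plus a
squared increment of m. It remains to reproduce the bounded Lipschitz function G = χF uniformly on X
(`exists_uniform_error`). No constant depends on H, hence none depends on the probability space. The
error has three sources.

Bias (`exists_bias_le`). If the density of b were flat, integrating over b would leave the
cross-correlation of ψ and φ, which the definition of the generalised Fourier transform writes as a
Fourier integral of conj(ψ̂)φ̂. Averaging over w then gives a superposition of dilates of p̂_w, a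
kernel that the normalisation makes of mass one and whose absolute first moment is O(1/σ_w).
Flattening p_b to the value p_b(0) costs the term in 1/σ_b. The constant Z is the right one because
∫ p̂_b = √(2π) p_b(0).

Cubature (`exists_cubature_le`). The integrand ψ(w·x+b)G(x) has Lipschitz constant O(1 + ‖w‖). A
left endpoint rule loses 1/n, and the mean of ‖w‖ and the factor Z give the powers of the
bandwidths.

Monte Carlo (`monteCarlo_uniform`). A norm in H is a supremum over unit vectors u, so the error is
the supremum of a real empirical process indexed by pairs (x,u). Bounded differences control its
deviation from its mean. For the mean, symmetrisation and a contraction with two independent signs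
replace the summands by functions linear in u and linear in x. Their suprema are bounded by norms of
sums of centred vectors, so second moments suffice and no covering numbers appear. The second moment
of the discretised transform contributes no term of its own: it is bounded by multiples of both σ_b
σ_w^d and √σ_b σ_w^d, and is absorbed by the rate (`div_sqrt_le_of_le_min`). -/

theorem measurePreserving_cons (μ : Measure Θ) [IsProbabilityMeasure μ] (n : ℕ) :
    MeasurePreserving (fun p : Θ × (Fin n → Θ) => (Fin.cons p.1 p.2 : Fin (n + 1) → Θ))
      (μ.prod (Measure.pi fun _ => μ)) (Measure.pi fun _ => μ) := by
  have h := (measurePreserving_piFinSuccAbove (fun _ : Fin (n + 1) => μ) 0).symm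
  convert h using 1
  ext p : 1
  simp [MeasurableEquiv.piFinSuccAbove, Fin.insertNthEquiv]

theorem measurableEmbedding_cons (n : ℕ) :
    MeasurableEmbedding (fun p : Θ × (Fin n → Θ) => (Fin.cons p.1 p.2 : Fin (n + 1) → Θ)) := by
  have h := (MeasurableEquiv.piFinSuccAbove (fun _ : Fin (n + 1) => Θ) 0).symm.measurableEmbedding
  convert h using 1
  ext p : 1
  simp [MeasurableEquiv.piFinSuccAbove, Fin.insertNthEquiv]

theorem integral_pi_succ {E : Type*} [NormedAddCommGroup E] [NormedSpace ℝ E] {n : ℕ}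
    {g : (Fin (n + 1) → Θ) → E}
    (hg : Integrable g (Measure.pi fun _ => μ)) :
    ∫ θ, g θ ∂(Measure.pi fun _ => μ) =
      ∫ t, ∫ θ, g (Fin.cons t θ) ∂(Measure.pi fun _ => μ) ∂μ := by
  rw [← (measurePreserving_cons μ n).integral_comp (measurableEmbedding_cons n)]
  exact integral_prod _ ((measurePreserving_cons μ n).integrable_comp_of_integrable hg)

theorem integrable_pi_eval {Y : Θ → B} (hY : Integrable Y μ) {n : ℕ} (i : Fin n) :
    Integrable (fun θ : Fin n → Θ => Y (θ i)) (Measure.pi fun _ => μ) :=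
  (measurePreserving_eval (fun _ : Fin n => μ) i).integrable_comp_of_integrable hY

theorem integrable_sum_pi {Y : Θ → B} (hY : Integrable Y μ) (R : B) (n : ℕ) :
    Integrable (fun θ : Fin n → Θ => R + ∑ i, Y (θ i)) (Measure.pi fun _ => μ) :=
  (integrable_const R).add (integrable_finsetSum _ fun i _ => integrable_pi_eval hY i)

theorem integrable_lipschitz_comp {Ω : Type*} [MeasurableSpace Ω] {P : Measure Ω}
    [IsFiniteMeasure P] {K : ℝ≥0} {Ψ : B → ℝ} (hΨ : LipschitzWith K Ψ) {Y : Ω → B}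
    (hY : Integrable Y P) : Integrable (fun ω => Ψ (Y ω)) P := by
  have h1 : Integrable (fun ω => ‖Ψ 0‖ + K * ‖Y ω‖) P :=
    (integrable_const _).add (hY.norm.const_mul _)
  refine h1.mono' (hΨ.continuous.comp_aestronglyMeasurable hY.aestronglyMeasurable)
    (Eventually.of_forall fun ω => ?_)
  have := hΨ.norm_sub_le (Y ω) 0
  rw [sub_zero] at this
  have h2 := norm_sub_norm_le (Ψ (Y ω)) (Ψ 0)
  linarith

/-- Averaging translates preserves the Lipschitz constant. The inductions below integrate out
summands one by one and need the averaged functional to stay in the same class. -/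
theorem lipschitzWith_integral_add {K : ℝ≥0} {Ψ : B → ℝ} (hΨ : LipschitzWith K Ψ) {Y : Θ → B}
    (hY : Integrable Y μ) : LipschitzWith K fun R => ∫ t, Ψ (R + Y t) ∂μ := by
  refine LipschitzWith.of_dist_le_mul fun R R' => ?_
  have hi : ∀ R, Integrable (fun t => Ψ (R + Y t)) μ := fun R =>
    integrable_lipschitz_comp hΨ ((integrable_const R).add hY)
  rw [dist_eq_norm, ← integral_sub (hi R) (hi R')]
  refine (norm_integral_le_of_norm_le_const (Eventually.of_forall fun t =>
    (?_ : _ ≤ K * dist R R'))).trans (by simp)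
  have := hΨ.dist_le_mul (R + Y t) (R' + Y t)
  rwa [dist_add_right, dist_eq_norm] at this

theorem integral_lipschitz_sum_succ {K : ℝ≥0} {Ψ : B → ℝ} (hΨ : LipschitzWith K Ψ) {Y : Θ → B}
    (hY : Integrable Y μ) (R : B) (n : ℕ) :
    ∫ θ : Fin (n + 1) → Θ, Ψ (R + ∑ i, Y (θ i)) ∂(Measure.pi fun _ => μ) =
      ∫ t, ∫ θ : Fin n → Θ, Ψ ((R + Y t) + ∑ i, Y (θ i)) ∂(Measure.pi fun _ => μ) ∂μ := by
  rw [integral_pi_succ (integrable_lipschitz_comp hΨ (integrable_sum_pi hY R _))]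
  simp [Fin.sum_univ_succ, add_assoc]

/-- Fubini puts the distinguished summand innermost, where the others act as a constant shift and a
bound for one summand, valid for every shift, applies. -/
theorem integral_lipschitz_sum_swap {Θ' : Type*} [MeasurableSpace Θ'] {μ' : Measure Θ'}
    [IsProbabilityMeasure μ'] {K : ℝ≥0} {Ψ : B → ℝ} (hΨ : LipschitzWith K Ψ) {Y : Θ → B}
    {Y' : Θ' → B} (hY : Integrable Y μ) (hY' : Integrable Y' μ') (n : ℕ) (R : B) :
    ∫ t, ∫ θ : Fin n → Θ', Ψ ((R + Y t) + ∑ i, Y' (θ i)) ∂(Measure.pi fun _ => μ') ∂μ =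
      ∫ θ : Fin n → Θ', ∫ t, Ψ ((R + ∑ i, Y' (θ i)) + Y t) ∂μ ∂(Measure.pi fun _ => μ') := by
  rw [integral_integral_swap]
  · simp only [add_right_comm]
  · have h1 : Integrable (fun p : Θ × (Fin n → Θ') => (R + Y p.1) + ∑ i, Y' (p.2 i))
        (μ.prod (Measure.pi fun _ => μ')) :=
      ((integrable_const R).add (hY.comp_fst _)).add
        (Integrable.comp_snd (by simpa using integrable_sum_pi hY' 0 n) μ)
    exact integrable_lipschitz_comp hΨ h1

/-- Replacing all summands of an independent sum, when one of them can be replaced. -/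
theorem integral_lipschitz_sum_le {Θ' : Type*} [MeasurableSpace Θ'] {μ' : Measure Θ'}
    [IsProbabilityMeasure μ'] {K : ℝ≥0} {Ψ : B → ℝ} (hΨ : LipschitzWith K Ψ) {Y : Θ → B}
    {Y' : Θ' → B} (hY : Integrable Y μ) (hY' : Integrable Y' μ')
    (hstep : ∀ R, ∫ t, Ψ (R + Y t) ∂μ ≤ ∫ t, Ψ (R + Y' t) ∂μ') (n : ℕ) (R : B) :
    ∫ θ : Fin n → Θ, Ψ (R + ∑ i, Y (θ i)) ∂(Measure.pi fun _ => μ) ≤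
      ∫ θ : Fin n → Θ', Ψ (R + ∑ i, Y' (θ i)) ∂(Measure.pi fun _ => μ') := by
  induction n generalizing R with
  | zero => simp
  | succ n ih =>
    rw [integral_lipschitz_sum_succ hΨ hY, integral_lipschitz_sum_succ hΨ hY']
    have hL : LipschitzWith K fun R =>
        ∫ θ : Fin n → Θ', Ψ (R + ∑ i, Y' (θ i)) ∂(Measure.pi fun _ => μ') := by
      have := lipschitzWith_integral_add (μ := Measure.pi fun _ : Fin n => μ') hΨ
        (integrable_sum_pi hY' 0 n)
      simpa using this
    have hL0 : LipschitzWith K fun R =>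
        ∫ θ : Fin n → Θ, Ψ (R + ∑ i, Y (θ i)) ∂(Measure.pi fun _ => μ) := by
      have := lipschitzWith_integral_add (μ := Measure.pi fun _ : Fin n => μ) hΨ
        (integrable_sum_pi hY 0 n)
      simpa using this
    have hi1 := integrable_lipschitz_comp hL ((integrable_const R).add hY)
    have hi0 := integrable_lipschitz_comp hL0 ((integrable_const R).add hY)
    -- With the first summand fixed, the induction hypothesis at the shift R + Y t replaces all the
    -- others; the first one is replaced after the exchange of integrals.
    refine (integral_mono hi0 hi1 fun t => ih (R + Y t)).trans ?_
    simp only [Pi.add_apply]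
    rw [integral_lipschitz_sum_swap hΨ hY hY', integral_lipschitz_sum_swap hΨ hY' hY']
    refine integral_mono ?_ ?_ fun θ => hstep _
    · exact integrable_lipschitz_comp (lipschitzWith_integral_add hΨ hY) (integrable_sum_pi hY' R n)
    · exact integrable_lipschitz_comp (lipschitzWith_integral_add hΨ hY') (integrable_sum_pi hY' R n)

/-- The second moment of a sum of independent centred random elements of a Hilbert space. -/
theorem integral_norm_add_sum_sq {H : Type*} [NormedAddCommGroup H] [InnerProductSpace ℝ H]
    [CompleteSpace H] {ζ : Θ → H} (hζ : MemLp ζ 2 μ) (h0 : ∫ t, ζ t ∂μ = 0) (n : ℕ) (R : H) :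
    ∫ θ : Fin n → Θ, ‖R + ∑ i, ζ (θ i)‖ ^ 2 ∂(Measure.pi fun _ => μ) =
      ‖R‖ ^ 2 + n * ∫ t, ‖ζ t‖ ^ 2 ∂μ := by
  have hmem : ∀ (n : ℕ) (R : H), MemLp (fun θ : Fin n → Θ => R + ∑ i, ζ (θ i)) 2
      (Measure.pi fun _ => μ) := fun n R =>
    (memLp_const R).add (memLp_finsetSum _ fun i _ =>
      hζ.comp_measurePreserving (measurePreserving_eval (fun _ : Fin n => μ) i))
  have hζ1 : Integrable ζ μ := hζ.integrable (by norm_num)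
  have hsq : Integrable (fun t => ‖ζ t‖ ^ 2) μ := hζ.integrable_norm_pow (by norm_num)
  induction n generalizing R with
  | zero => simp
  | succ n ih =>
    rw [integral_pi_succ ((hmem (n + 1) R).integrable_norm_pow (by norm_num))]
    have : ∀ t, ∫ θ : Fin n → Θ, ‖R + ∑ i, ζ ((Fin.cons t θ : Fin (n + 1) → Θ) i)‖ ^ 2
        ∂(Measure.pi fun _ => μ) = ‖R + ζ t‖ ^ 2 + n * ∫ t, ‖ζ t‖ ^ 2 ∂μ := fun t => by
      rw [← ih]; simp [Fin.sum_univ_succ, add_assoc]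
    simp_rw [this, norm_add_sq_real]
    have hin : Integrable (fun t => 2 * inner ℝ R (ζ t)) μ := (hζ1.const_inner R).const_mul 2
    have hin' : Integrable (fun t => ‖R‖ ^ 2 + 2 * inner ℝ R (ζ t)) μ :=
      (integrable_const _).add hin
    have hin2 : Integrable (fun t => ‖R‖ ^ 2 + 2 * inner ℝ R (ζ t) + ‖ζ t‖ ^ 2) μ := hin'.add hsq
    rw [integral_add hin2 (integrable_const _),
      integral_add hin' hsq, integral_add (integrable_const _) hin,
      integral_const_mul, integral_inner hζ1, h0]
    simp
    ring

theorem integral_norm_sum_le {H : Type*} [NormedAddCommGroup H] [InnerProductSpace ℝ H]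
    [CompleteSpace H] {ζ : Θ → H} (hζ : MemLp ζ 2 μ) (h0 : ∫ t, ζ t ∂μ = 0) (n : ℕ) :
    ∫ θ : Fin n → Θ, ‖∑ i, ζ (θ i)‖ ∂(Measure.pi fun _ => μ) ≤
      √n * √(∫ t, ‖ζ t‖ ^ 2 ∂μ) := by
  have hm : MemLp (fun θ : Fin n → Θ => ‖∑ i, ζ (θ i)‖) 2 (Measure.pi fun _ => μ) :=
    (memLp_finsetSum _ fun i _ =>
      hζ.comp_measurePreserving (measurePreserving_eval (fun _ : Fin n => μ) i)).norm
  have h2 := integral_norm_add_sum_sq hζ h0 n 0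
  simp only [zero_add, norm_zero, ne_eq, OfNat.ofNat_ne_zero, not_false_eq_true, zero_pow] at h2
  rw [← Real.sqrt_mul (by positivity), ← h2]
  refine Real.le_sqrt_of_sq_le ?_
  -- (E‖·‖)² ≤ E‖·‖² is nonnegativity of the variance of the norm.
  have hv := variance_nonneg (fun θ : Fin n → Θ => ‖∑ i, ζ (θ i)‖) (Measure.pi fun _ => μ)
  rw [variance_eq_sub hm] at hv
  simpa using hv

/-- **Bounded differences inequality** for a Lipschitz function of an independent sum. -/
theorem integral_exp_lipschitz_sum_le {Ψ : B → ℝ} (hΨ : LipschitzWith 1 Ψ) {Y : Θ → B} {A : ℝ}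
    (hY : AEStronglyMeasurable Y μ) (hA : ∀ t, ‖Y t‖ ≤ A) (l : ℝ) (n : ℕ) :
    ∫ θ : Fin n → Θ, Real.exp (l * Ψ (∑ i, Y (θ i))) ∂(Measure.pi fun _ => μ) ≤
      Real.exp (l * (∫ θ : Fin n → Θ, Ψ (∑ i, Y (θ i)) ∂(Measure.pi fun _ => μ))
        + n * (A ^ 2 * l ^ 2 / 2)) := by
  have hYi : Integrable Y μ := Integrable.of_bound hY A (Eventually.of_forall hA)
  have hosc : ∀ {Ψ : B → ℝ}, LipschitzWith 1 Ψ → ∀ S D : B, |Ψ (S + D) - Ψ S| ≤ ‖D‖ := by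
    intro Ψ hΨ S D
    have := hΨ.norm_sub_le (S + D) S
    simpa using this
  have hexpi : ∀ {Ψ : B → ℝ}, LipschitzWith 1 Ψ → ∀ n : ℕ,
      Integrable (fun θ : Fin n → Θ => Real.exp (l * Ψ (∑ i, Y (θ i))))
        (Measure.pi fun _ => μ) := by
    intro Ψ hΨ n
    have hm := (integrable_sum_pi hYi 0 n).aestronglyMeasurable
    simp only [zero_add] at hm
    refine Integrable.of_bound ((Real.continuous_exp.comp
      (continuous_const.mul hΨ.continuous)).comp_aestronglyMeasurable hm)
      (Real.exp (|l| * (|Ψ 0| + n * A))) (Eventually.of_forall fun θ => ?_)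
    rw [Real.norm_eq_abs, Real.abs_exp, Real.exp_le_exp]
    refine (le_abs_self _).trans ?_
    rw [abs_mul]
    gcongr
    have h1 := hosc hΨ 0 (∑ i, Y (θ i))
    rw [zero_add] at h1
    have h2 : ‖∑ i, Y (θ i)‖ ≤ n * A := by
      refine (norm_sum_le_of_le _ fun i _ => hA (θ i)).trans (by simp)
    have := abs_sub_abs_le_abs_sub (Ψ (∑ i, Y (θ i))) (Ψ 0)
    linarith
  induction n generalizing Ψ with
  | zero => simp
  | succ n ih =>
    -- The induction hypothesis will be applied to Ψ averaged over one summand, which has the same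
    -- mean along the sum.
    have hΨ' : LipschitzWith 1 fun R => ∫ t, Ψ (R + Y t) ∂μ := lipschitzWith_integral_add hΨ hYi
    -- Hoeffding's lemma for one summand: given the others, Ψ stays in an interval of length 2A,
    -- whence the variance proxy A².
    have hone : ∀ S, ∫ t, Real.exp (l * Ψ (S + Y t)) ∂μ ≤
        Real.exp (l * (∫ t, Ψ (S + Y t) ∂μ)) * Real.exp (A ^ 2 * l ^ 2 / 2) := by
      intro S
      have hS : Integrable (fun t => Ψ (S + Y t)) μ :=
        integrable_lipschitz_comp hΨ ((integrable_const S).add hYi)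
      have hh := hasSubgaussianMGF_of_mem_Icc (X := fun t => Ψ (S + Y t)) (μ := μ)
        (a := Ψ S - A) (b := Ψ S + A) hS.aemeasurable (Eventually.of_forall fun t => by
          have := abs_le.1 ((hosc hΨ S (Y t)).trans (hA t))
          constructor <;> linarith [this.1, this.2])
      have h3 := hh.mgf_le l
      have hc : (((‖Ψ S + A - (Ψ S - A)‖₊ / 2) ^ 2 : ℝ≥0) : ℝ) = A ^ 2 := by
        push_cast
        rw [Real.norm_eq_abs, div_pow, sq_abs]
        ring
      rw [hc, mgf] at h3
      rw [← Real.exp_add]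
      have h4 : ∀ t, Real.exp (l * Ψ (S + Y t)) =
          Real.exp (l * (∫ t, Ψ (S + Y t) ∂μ)) *
            Real.exp (l * (Ψ (S + Y t) - ∫ t, Ψ (S + Y t) ∂μ)) := fun t => by
        rw [← Real.exp_add]; ring_nf
      simp_rw [h4]
      rw [integral_const_mul, Real.exp_add]
      gcongr
    have hsw : ∫ θ : Fin (n + 1) → Θ, Real.exp (l * Ψ (∑ i, Y (θ i))) ∂(Measure.pi fun _ => μ) =
        ∫ θ : Fin n → Θ, ∫ t, Real.exp (l * Ψ (∑ i, Y (θ i) + Y t)) ∂μ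
          ∂(Measure.pi fun _ => μ) := by
      have h5 := (measurePreserving_cons μ n).integrable_comp_of_integrable (hexpi hΨ (n + 1))
      rw [integral_pi_succ (hexpi hΨ (n + 1)), integral_integral_swap
        (f := fun t θ => Real.exp (l * Ψ (∑ i, Y ((Fin.cons t θ : Fin (n + 1) → Θ) i)))) h5]
      simp [Fin.sum_univ_succ, add_comm]
    have hsw' : ∫ θ : Fin (n + 1) → Θ, Ψ (∑ i, Y (θ i)) ∂(Measure.pi fun _ => μ) =
        ∫ θ : Fin n → Θ, ∫ t, Ψ (∑ i, Y (θ i) + Y t) ∂μ ∂(Measure.pi fun _ => μ) := by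
      have h6 : Integrable (fun θ : Fin (n + 1) → Θ => Ψ (∑ i, Y (θ i)))
          (Measure.pi fun _ => μ) := by
        simpa using integrable_lipschitz_comp hΨ (integrable_sum_pi hYi 0 (n + 1))
      have h5 := (measurePreserving_cons μ n).integrable_comp_of_integrable h6
      rw [integral_pi_succ h6, integral_integral_swap
        (f := fun t θ => Ψ (∑ i, Y ((Fin.cons t θ : Fin (n + 1) → Θ) i))) h5]
      simp [Fin.sum_univ_succ, add_comm]
    have hint : Integrable (fun θ : Fin n → Θ => ∫ t, Real.exp (l * Ψ (∑ i, Y (θ i) + Y t)) ∂μ)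
        (Measure.pi fun _ => μ) := by
      have h5 := (measurePreserving_cons μ n).integrable_comp_of_integrable (hexpi hΨ (n + 1))
      have := h5.integral_prod_right
      simpa [Fin.sum_univ_succ, add_comm] using this
    rw [hsw, hsw']
    refine (integral_mono hint ((hexpi hΨ' n).mul_const _) fun θ => hone _).trans ?_
    rw [integral_mul_const]
    refine (mul_le_mul_of_nonneg_right (ih hΨ') (Real.exp_nonneg _)).trans (le_of_eq ?_)
    rw [← Real.exp_add]
    push_cast
    ring_nf

/-- The exponential Markov inequality applied to the bounded differences estimate. -/
theorem measure_lipschitz_sum_le {Ψ : B → ℝ} (hΨ : LipschitzWith 1 Ψ) {Y : Θ → B} {A : ℝ}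
    (hY : AEStronglyMeasurable Y μ) (hA0 : 0 < A) (hA : ∀ t, ‖Y t‖ ≤ A) {n : ℕ} (hn : 0 < n)
    {δ : ℝ} (hδ : 0 < δ) (hδ1 : δ < 1) :
    ENNReal.ofReal (1 - δ) ≤ (Measure.pi fun _ : Fin n => μ) {θ | Ψ (∑ i, Y (θ i)) ≤
      (∫ θ : Fin n → Θ, Ψ (∑ i, Y (θ i)) ∂(Measure.pi fun _ => μ)) +
        A * √(2 * n * Real.log δ⁻¹)} := by
  set ν := Measure.pi fun _ : Fin n => μ
  set e := ∫ θ : Fin n → Θ, Ψ (∑ i, Y (θ i)) ∂ν with he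
  set s := A * √(2 * n * Real.log δ⁻¹) with hs
  have hYi : Integrable Y μ := Integrable.of_bound hY A (Eventually.of_forall hA)
  have hlog : 0 < Real.log δ⁻¹ := Real.log_pos ((one_lt_inv₀ hδ).2 hδ1)
  have hn' : (0 : ℝ) < n := Nat.cast_pos.2 hn
  have hs0 : 0 < s := by positivity
  have hΨi : Integrable (fun θ : Fin n → Θ => Ψ (∑ i, Y (θ i))) ν := by
    simpa using integrable_lipschitz_comp hΨ (integrable_sum_pi hYi 0 n)
  -- This value minimises -l s + n A² l² / 2, and the minimum -s² / (2 n A²) equals log δ by the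
  -- choice of s.
  set l := s / (n * A ^ 2) with hl
  have hl0 : 0 < l := by positivity
  have hbd : ∀ θ : Fin n → Θ, |Ψ (∑ i, Y (θ i))| ≤ |Ψ 0| + n * A := fun θ => by
    have h1 := hΨ.norm_sub_le (∑ i, Y (θ i)) 0
    simp only [NNReal.coe_one, sub_zero, one_mul, Real.norm_eq_abs] at h1
    have h2 : ‖∑ i, Y (θ i)‖ ≤ n * A :=
      (norm_sum_le_of_le _ fun i _ => hA (θ i)).trans (by simp)
    have := abs_sub_abs_le_abs_sub (Ψ (∑ i, Y (θ i))) (Ψ 0)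
    linarith
  have hexpi : Integrable (fun θ : Fin n → Θ => Real.exp (l * Ψ (∑ i, Y (θ i)))) ν := by
    refine Integrable.of_bound ((Real.continuous_exp.comp (continuous_const.mul
      continuous_id)).comp_aestronglyMeasurable hΨi.aestronglyMeasurable)
      (Real.exp (l * (|Ψ 0| + n * A))) (Eventually.of_forall fun θ => ?_)
    simp only [Real.norm_eq_abs, Real.abs_exp, Real.exp_le_exp]
    gcongr
    exact (le_abs_self _).trans (hbd θ)
  have hch := measure_ge_le_exp_mul_mgf (μ := ν) (X := fun θ : Fin n → Θ => Ψ (∑ i, Y (θ i)))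
    (e + s) hl0.le hexpi
  have hmgf := integral_exp_lipschitz_sum_le hΨ hY hA l n
  have hfin : ν.real {θ | e + s ≤ Ψ (∑ i, Y (θ i))} ≤ δ := by
    refine hch.trans ?_
    rw [mgf]
    refine (mul_le_mul_of_nonneg_left hmgf (Real.exp_nonneg _)).trans ?_
    rw [← Real.exp_add, ← he]
    have hss : s ^ 2 = A ^ 2 * (2 * n * Real.log δ⁻¹) := by
      rw [hs, mul_pow, Real.sq_sqrt (by positivity)]
    have : -l * (e + s) + (l * e + n * (A ^ 2 * l ^ 2 / 2)) = -(s ^ 2 / (2 * n * A ^ 2)) := by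
      rw [hl]; field_simp; ring
    rw [this, hss]
    have : A ^ 2 * (2 * n * Real.log δ⁻¹) / (2 * n * A ^ 2) = Real.log δ⁻¹ := by
      field_simp
    rw [this, Real.log_inv, neg_neg, Real.exp_log hδ]
  have hnull : NullMeasurableSet {θ : Fin n → Θ | e + s ≤ Ψ (∑ i, Y (θ i))} ν :=
    nullMeasurableSet_le aemeasurable_const hΨi.aemeasurable
  have hcompl : ν.real {θ | e + s ≤ Ψ (∑ i, Y (θ i))}ᶜ =
      1 - ν.real {θ | e + s ≤ Ψ (∑ i, Y (θ i))} := by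
    rw [measureReal_compl₀ hnull]; simp
  refine le_trans ?_ (measure_mono (μ := ν)
    (s := {θ : Fin n → Θ | e + s ≤ Ψ (∑ i, Y (θ i))}ᶜ) fun θ hθ => ?_)
  · rw [← ofReal_measureReal, hcompl]
    exact ENNReal.ofReal_le_ofReal (by linarith)
  · simp only [Set.mem_compl_iff, Set.mem_ofPred_eq, not_le] at hθ
    exact hθ.le

end IndependentSums

/-! ### Suprema of empirical processes -/

section Supremum

open scoped BoundedContinuousFunction

variable {Z : Type*} [TopologicalSpace Z]

/-- The supremum of a bounded continuous function. -/
noncomputable def supBCF (g : Z →ᵇ ℝ) : ℝ := ⨆ z, g z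

theorem bddAbove_range_bcf (g : Z →ᵇ ℝ) : BddAbove (Set.range g) :=
  ⟨‖g‖, by rintro _ ⟨z, rfl⟩; exact (le_abs_self _).trans (g.norm_coe_le_norm z)⟩

theorem le_supBCF (g : Z →ᵇ ℝ) (z : Z) : g z ≤ supBCF g := le_ciSup (bddAbove_range_bcf g) z

theorem supBCF_le [Nonempty Z] {g : Z →ᵇ ℝ} {c : ℝ} (h : ∀ z, g z ≤ c) : supBCF g ≤ c :=
  ciSup_le h

/-- This makes the supremum of an empirical process an admissible functional Ψ of a sum of
independent elements of the Banach space of bounded continuous functions. -/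
theorem lipschitzWith_supBCF [Nonempty Z] : LipschitzWith 1 (supBCF : (Z →ᵇ ℝ) → ℝ) := by
  refine LipschitzWith.of_le_add fun g g' => supBCF_le fun z => ?_
  have h1 := le_supBCF g' z
  have h2 := (abs_le.1 (BoundedContinuousFunction.dist_coe_le_dist (f := g) (g := g') z)).2
  linarith

/-- Contraction: one random sign in front of a function whose increments are controlled by those
of two others is replaced by two random signs. -/
theorem supBCF_add_sub_le [Nonempty Z] (R h α β : Z →ᵇ ℝ)
    (hh : ∀ z z', |h z - h z'| ≤ |α z - α z'| + |β z - β z'|) :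
    supBCF (R + h) + supBCF (R - h) ≤
      (supBCF (R + (2 : ℝ) • α + (2 : ℝ) • β) + supBCF (R + (2 : ℝ) • α - (2 : ℝ) • β) +
        supBCF (R - (2 : ℝ) • α + (2 : ℝ) • β) + supBCF (R - (2 : ℝ) • α - (2 : ℝ) • β)) / 2 := by
  set c := (supBCF (R + (2 : ℝ) • α + (2 : ℝ) • β) + supBCF (R + (2 : ℝ) • α - (2 : ℝ) • β) +
        supBCF (R - (2 : ℝ) • α + (2 : ℝ) • β) + supBCF (R - (2 : ℝ) • α - (2 : ℝ) • β)) / 2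
  -- The two suprema on the left may be approached at different points, so the bound is proved for
  -- an arbitrary pair.
  suffices H : ∀ z z', (R + h) z + (R - h) z' ≤ c by
    have h1 : ∀ z', supBCF (R + h) ≤ c - (R - h) z' := fun z' =>
      supBCF_le fun z => by linarith [H z z']
    have h2 : supBCF (R - h) ≤ c - supBCF (R + h) := supBCF_le fun z' => by linarith [h1 z']
    linarith
  intro z z'
  have e1 := le_supBCF (R + (2 : ℝ) • α + (2 : ℝ) • β)
  have e2 := le_supBCF (R + (2 : ℝ) • α - (2 : ℝ) • β)
  have e3 := le_supBCF (R - (2 : ℝ) • α + (2 : ℝ) • β)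
  have e4 := le_supBCF (R - (2 : ℝ) • α - (2 : ℝ) • β)
  have hz := (le_abs_self _).trans (hh z z')
  have a1 := e1 z; have a1' := e1 z'
  have a2 := e2 z; have a2' := e2 z'
  have a3 := e3 z; have a3' := e3 z'
  have a4 := e4 z; have a4' := e4 z'
  simp only [BoundedContinuousFunction.coe_add, BoundedContinuousFunction.coe_sub, Pi.add_apply,
    Pi.sub_apply, BoundedContinuousFunction.coe_smul, smul_eq_mul] at *
  -- The signs of the two increments decide which of the four functions is evaluated at z and which
  -- at z'. Averaged over both points, the contributions of α and β cancel in the two remaining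
  -- functions; the factor 2 compensates for this loss.
  rcases abs_cases (α z - α z') with ⟨ha, _⟩ | ⟨ha, _⟩ <;>
  rcases abs_cases (β z - β z') with ⟨hb, _⟩ | ⟨hb, _⟩ <;>
  rw [ha, hb] at hz <;> simp only [c] <;> linarith

/-- The law of two independent random signs. -/
noncomputable def signLaw : Measure (Bool × Bool) := (4⁻¹ : ℝ≥0∞) • Measure.count

/-- The sign encoded by a boolean. -/
def sgn (s : Bool) : ℝ := if s then 1 else -1

instance : IsProbabilityMeasure signLaw := by
  constructor
  have h : (4 : ℝ≥0∞)⁻¹ * 4 = 1 := ENNReal.inv_mul_cancel (by norm_num) (by norm_num)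
  simpa [signLaw, Measure.count_apply_finite _ Set.finite_univ] using h

theorem integral_signLaw {E : Type*} [NormedAddCommGroup E] [NormedSpace ℝ E] [CompleteSpace E]
    (g : Bool × Bool → E) :
    ∫ s, g s ∂signLaw = (4⁻¹ : ℝ) • (g (true, true) + g (true, false) + g (false, true) +
      g (false, false)) := by
  rw [signLaw, integral_smul_measure, integral_countable]
  · simp [Fintype.sum_prod_type, Measure.real, add_assoc]
  · exact Integrable.of_finite

variable {Θ : Type*} [MeasurableSpace Θ] {μ : Measure Θ} [IsProbabilityMeasure μ]

/-- Symmetrisation and contraction for one summand. -/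
theorem integral_supBCF_le [Nonempty Z] {Y α β : Θ → Z →ᵇ ℝ} (hY : Integrable Y μ)
    (hα : Integrable α μ) (hβ : Integrable β μ)
    (h : ∀ t z z', |Y t z - Y t z'| ≤ |α t z - α t z'| + |β t z - β t z'|) (R : Z →ᵇ ℝ) :
    ∫ t, supBCF (R + (Y t - ∫ t, Y t ∂μ)) ∂μ ≤
      ∫ p : Θ × (Bool × Bool), supBCF (R + ((4 * sgn p.2.1) • α p.1 + (4 * sgn p.2.2) • β p.1))
        ∂(μ.prod signLaw) := by
  have hL := lipschitzWith_supBCF (Z := Z)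
  have hint : ∀ (R : Z →ᵇ ℝ) (c c' : ℝ),
      Integrable (fun t => supBCF (R + (c • α t + c' • β t))) μ := fun R c c' =>
    integrable_lipschitz_comp hL ((integrable_const R).add ((hα.smul c).add (hβ.smul c')))
  have hplus : Integrable (fun t => supBCF (R + (2 : ℝ) • Y t)) μ :=
    integrable_lipschitz_comp hL ((integrable_const R).add (hY.smul (2 : ℝ)))
  have hminus : Integrable (fun t => supBCF (R - (2 : ℝ) • Y t)) μ :=
    integrable_lipschitz_comp hL ((integrable_const R).sub (hY.smul (2 : ℝ)))
  have hpoint : ∀ z : Z, (∫ t, Y t ∂μ) z = ∫ t, Y t z ∂μ := fun z =>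
    ((BoundedContinuousFunction.evalCLM ℝ z).integral_comp_comm hY).symm
  have hYz : ∀ z, Integrable (fun t => Y t z) μ := fun z =>
    (BoundedContinuousFunction.evalCLM ℝ z).integrable_comp hY
  -- R + Y - EY is half of R + 2Y plus half of the mean of R - 2Y' for an independent copy Y';
  -- bounding each half by its supremum also removes the dependence between Y and Y'.
  have hsym : ∀ t, supBCF (R + (Y t - ∫ t, Y t ∂μ)) ≤
      (1 / 2 : ℝ) * supBCF (R + (2 : ℝ) • Y t) +
        (1 / 2 : ℝ) * ∫ t, supBCF (R - (2 : ℝ) • Y t) ∂μ := by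
    intro t
    refine supBCF_le fun z => ?_
    have h1 := le_supBCF (R + (2 : ℝ) • Y t) z
    have h2 : R z - 2 * ∫ t, Y t z ∂μ ≤ ∫ t, supBCF (R - (2 : ℝ) • Y t) ∂μ := by
      have h3 : ∫ t, (R z - 2 * Y t z) ∂μ = R z - 2 * ∫ t, Y t z ∂μ := by
        rw [integral_sub (integrable_const _) ((hYz z).const_mul 2), integral_const_mul]
        simp
      rw [← h3]
      refine integral_mono ((integrable_const _).sub ((hYz z).const_mul 2)) hminus fun t => ?_
      exact le_supBCF (R - (2 : ℝ) • Y t) z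
    simp only [BoundedContinuousFunction.coe_add, BoundedContinuousFunction.coe_sub, Pi.add_apply,
      Pi.sub_apply, BoundedContinuousFunction.coe_smul, smul_eq_mul, hpoint] at *
    linarith
  have hprod : Integrable (fun p : Θ × (Bool × Bool) =>
      supBCF (R + ((4 * sgn p.2.1) • α p.1 + (4 * sgn p.2.2) • β p.1))) (μ.prod signLaw) := by
    refine integrable_lipschitz_comp hL ((integrable_const R).add (Integrable.add ?_ ?_))
    · have := Integrable.smul_prod (μ := signLaw) (ν := μ) (f := fun s => 4 * sgn s.1)
        Integrable.of_finite hα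
      exact this.swap
    · have := Integrable.smul_prod (μ := signLaw) (ν := μ) (f := fun s => 4 * sgn s.2)
        Integrable.of_finite hβ
      exact this.swap
  have hsym' : Integrable (fun t => supBCF (R + (Y t - ∫ t, Y t ∂μ))) μ :=
    integrable_lipschitz_comp hL ((integrable_const R).add (hY.sub (integrable_const _)))
  calc ∫ t, supBCF (R + (Y t - ∫ t, Y t ∂μ)) ∂μ
      ≤ ∫ t, ((1 / 2 : ℝ) * supBCF (R + (2 : ℝ) • Y t) +
        (1 / 2 : ℝ) * ∫ t, supBCF (R - (2 : ℝ) • Y t) ∂μ) ∂μ :=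
        integral_mono hsym' ((hplus.const_mul _).add (integrable_const _)) hsym
    _ = ∫ t, (1 / 2 : ℝ) * (supBCF (R + (2 : ℝ) • Y t) + supBCF (R - (2 : ℝ) • Y t)) ∂μ := by
        rw [integral_add (hplus.const_mul _) (integrable_const _), integral_const_mul,
          integral_const_mul, integral_const_mul, integral_add hplus hminus]
        simp; ring
    _ ≤ ∫ t, (4⁻¹ : ℝ) * (supBCF (R + ((4 : ℝ) • α t + (4 : ℝ) • β t)) +
          supBCF (R + ((4 : ℝ) • α t + (-4 : ℝ) • β t)) +
          supBCF (R + ((-4 : ℝ) • α t + (4 : ℝ) • β t)) +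
          supBCF (R + ((-4 : ℝ) • α t + (-4 : ℝ) • β t))) ∂μ := by
        refine integral_mono ((hplus.add hminus).const_mul _)
          (((((hint R 4 4).add (hint R 4 (-4))).add (hint R (-4) 4)).add
            (hint R (-4) (-4))).const_mul _) fun t => ?_
        -- Symmetrisation contributes one factor 2 and contraction another, hence the coefficients
        -- ±4.
        have h5 := supBCF_add_sub_le R ((2 : ℝ) • Y t) ((2 : ℝ) • α t) ((2 : ℝ) • β t)
          fun z z' => by
            simp only [BoundedContinuousFunction.coe_smul, smul_eq_mul, ← mul_sub, abs_mul, abs_two]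
            linarith [h t z z']
        have e1 : R + (2 : ℝ) • (2 : ℝ) • α t + (2 : ℝ) • (2 : ℝ) • β t =
          R + ((4 : ℝ) • α t + (4 : ℝ) • β t) := by module
        have e2 : R + (2 : ℝ) • (2 : ℝ) • α t - (2 : ℝ) • (2 : ℝ) • β t =
          R + ((4 : ℝ) • α t + (-4 : ℝ) • β t) := by module
        have e3 : R - (2 : ℝ) • (2 : ℝ) • α t + (2 : ℝ) • (2 : ℝ) • β t =
          R + ((-4 : ℝ) • α t + (4 : ℝ) • β t) := by module
        have e4 : R - (2 : ℝ) • (2 : ℝ) • α t - (2 : ℝ) • (2 : ℝ) • β t =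
          R + ((-4 : ℝ) • α t + (-4 : ℝ) • β t) := by module
        rw [e1, e2, e3, e4] at h5
        dsimp only
        linarith
    _ = _ := by
        rw [integral_prod _ hprod]
        simp_rw [integral_signLaw]
        simp [sgn]

/-- The norm of a sum of independent random vectors with random signs. -/
theorem integral_norm_sum_sgn_le {E : Type*} [NormedAddCommGroup E] [InnerProductSpace ℝ E]
    [CompleteSpace E] (N : ℕ) {g : Θ → E} (hg : MemLp g 2 μ) (e : Bool × Bool → Bool)
    (he : ∫ s, sgn (e s) ∂signLaw = 0) :
    Integrable (fun θ : Fin N → Θ × (Bool × Bool) => ‖∑ i, sgn (e (θ i).2) • g (θ i).1‖)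
      (Measure.pi fun _ => μ.prod signLaw) ∧
    ∫ θ : Fin N → Θ × (Bool × Bool), ‖∑ i, sgn (e (θ i).2) • g (θ i).1‖
      ∂(Measure.pi fun _ => μ.prod signLaw) ≤ √N * √(∫ t, ‖g t‖ ^ 2 ∂μ) := by
  have hgi : Integrable g μ := hg.integrable (by norm_num)
  have hsi : Integrable (fun p : Θ × (Bool × Bool) => sgn (e p.2) • g p.1) (μ.prod signLaw) :=
    (Integrable.smul_prod (μ := signLaw) (ν := μ) (f := fun s => sgn (e s))
      Integrable.of_finite hgi).swap
  have hsm : ∀ b : Bool, |sgn b| = 1 := fun b => by cases b <;> simp [sgn]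
  have hnorm : ∀ p : Θ × (Bool × Bool), ‖sgn (e p.2) • g p.1‖ = ‖g p.1‖ := fun p => by
    rw [norm_smul, Real.norm_eq_abs, hsm, one_mul]
  have hmem : MemLp (fun p : Θ × (Bool × Bool) => sgn (e p.2) • g p.1) 2 (μ.prod signLaw) :=
    MemLp.of_le (hg.comp_fst signLaw) hsi.aestronglyMeasurable
      (Eventually.of_forall fun p => (hnorm p).le)
  have h0 : ∫ p : Θ × (Bool × Bool), sgn (e p.2) • g p.1 ∂(μ.prod signLaw) = 0 := by
    rw [integral_prod _ hsi]
    simp [integral_smul_const, he]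
  refine ⟨?_, ?_⟩
  · have := (integrable_sum_pi hsi 0 N).norm
    simpa using this
  · refine (integral_norm_sum_le hmem h0 N).trans (le_of_eq ?_)
    congr 2
    simp_rw [hnorm]
    rw [integral_fun_fst (μ := μ) (ν := signLaw) (fun t => ‖g t‖ ^ 2)]
    simp

end Supremum

/-! ### Uniform Monte Carlo bounds in a Hilbert space -/

section MonteCarlo

open scoped BoundedContinuousFunction

variable {V : Type*} [NormedAddCommGroup V]
variable {H : Type*} [NormedAddCommGroup H]

/-- Pairs of a point of `X` and a vector of the unit ball of `H`. -/
abbrev TestPair (X : Set V) (H : Type*) [NormedAddCommGroup H] : Type _ :=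
  X × Metric.closedBall (0 : H) 1

/-- The functions `(x, u) ↦ ⟪v, u⟫`. -/
noncomputable def testRight [InnerProductSpace ℝ H] (X : Set V) : H →L[ℝ] (TestPair X H →ᵇ ℝ) :=
  LinearMap.mkContinuous
    { toFun := fun v => BoundedContinuousFunction.ofNormedAddCommGroup
        (fun z : TestPair X H => inner ℝ v (z.2 : H)) (by fun_prop) ‖v‖ fun z =>
          (norm_inner_le_norm _ _).trans (mul_le_of_le_one_right (norm_nonneg _)
            (mem_closedBall_zero_iff.1 z.2.2))
      map_add' := fun v v' => by ext z; simp [inner_add_left]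
      map_smul' := fun c v => by ext z; simp [inner_smul_left] } 1 fun v => by
    rw [one_mul]
    refine (BoundedContinuousFunction.norm_le (norm_nonneg _)).2 fun z => ?_
    exact (norm_inner_le_norm _ _).trans (mul_le_of_le_one_right (norm_nonneg _)
      (mem_closedBall_zero_iff.1 z.2.2))

theorem testRight_apply [InnerProductSpace ℝ H] (X : Set V) (v : H) (z : TestPair X H) :
    testRight X v z = inner ℝ v (z.2 : H) := rfl

/-- The functions `(x, u) ↦ ⟪w, x⟫`. -/
noncomputable def testLeft [InnerProductSpace ℝ V] (X : Set V) (H : Type*) [NormedAddCommGroup H] (ρ : ℝ)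
    (hρ : ∀ x ∈ X, ‖x‖ ≤ ρ) : V →L[ℝ] (TestPair X H →ᵇ ℝ) :=
  LinearMap.mkContinuous
    { toFun := fun w => BoundedContinuousFunction.ofNormedAddCommGroup
        (fun z : TestPair X H => inner ℝ w (z.1 : V)) (by fun_prop) (‖w‖ * ρ) fun z =>
          (norm_inner_le_norm _ _).trans (mul_le_mul_of_nonneg_left (hρ _ z.1.2) (norm_nonneg _))
      map_add' := fun v v' => by ext z; simp [inner_add_left]
      map_smul' := fun c v => by ext z; simp [inner_smul_left] } |ρ| fun w => by
    rw [mul_comm]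
    refine (BoundedContinuousFunction.norm_le (by positivity)).2 fun z => ?_
    exact (norm_inner_le_norm _ _).trans (mul_le_mul_of_nonneg_left ((hρ _ z.1.2).trans
      (le_abs_self _)) (norm_nonneg _))

theorem testLeft_apply [InnerProductSpace ℝ V] (X : Set V) (ρ : ℝ)
    (hρ : ∀ x ∈ X, ‖x‖ ≤ ρ) (w : V) (z : TestPair X H) :
    testLeft X H ρ hρ w z = inner ℝ w (z.1 : V) := rfl

variable [InnerProductSpace ℝ V] [InnerProductSpace ℝ H] [CompleteSpace H] [CompleteSpace V] [MeasurableSpace V] [BorelSpace V]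
  [SecondCountableTopology V]

/-- Uniform Monte Carlo error of a random feature expansion with values in a Hilbert space. -/
theorem monteCarlo_uniform {μ : Measure (V × ℝ)} [IsProbabilityMeasure μ] {a : V × ℝ → H}
    (ha : Continuous a) {A : ℝ} (hA0 : 0 < A) (hA : ∀ t, ‖a t‖ ≤ A) {phi : ℝ → ℝ} {Lphi : ℝ≥0}
    (hLip : LipschitzWith Lphi phi) {Bphi : ℝ} (hB0 : 0 < Bphi) (hB : ∀ s, |phi s| ≤ Bphi)
    (hw : MemLp (fun t : V × ℝ => t.1) 2 μ) {X : Set V} {ρ : ℝ} (hρ0 : 0 ≤ ρ)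
    (hρ : ∀ x ∈ X, ‖x‖ ≤ ρ) {N : ℕ} (hN : 0 < N) {δ : ℝ} (hδ : 0 < δ) (hδ1 : δ < 1) :
    ENNReal.ofReal (1 - δ) ≤ (Measure.pi fun _ : Fin N => μ) {θ | ∀ x ∈ X,
      ‖(N : ℝ)⁻¹ • ∑ i, phi (inner ℝ (θ i).1 x + (θ i).2) • a (θ i) -
        ∫ t, phi (inner ℝ t.1 x + t.2) • a t ∂μ‖ ≤
      (4 * Bphi * √(∫ t, ‖a t‖ ^ 2 ∂μ) + 4 * A * Lphi * ρ * √(∫ t, ‖t.1‖ ^ 2 ∂μ) +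
        4 * A * Bphi * √(Real.log δ⁻¹)) / √N} := by
  rcases X.eq_empty_or_nonempty with rfl | hXne
  · simp only [Set.mem_empty_iff_false, false_imp_iff, implies_true]
    have : {θ : Fin N → V × ℝ | True} = Set.univ := by ext; simp
    rw [this, measure_univ]
    exact ENNReal.ofReal_le_one.2 (by linarith)
  have : Nonempty (TestPair X H) := ⟨⟨⟨_, hXne.some_mem⟩, ⟨0, by simp⟩⟩⟩
  -- One sample as a bounded continuous function of (x, u), namely ⟪a, u⟫ φ(⟪w, x⟫ + b); the
  -- supremum over the unit vectors u recovers the norm.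
  set Y : V × ℝ → (TestPair X H →ᵇ ℝ) := fun t =>
    testRight X (a t) * BoundedContinuousFunction.comp phi hLip
      (testLeft X H ρ hρ t.1 + BoundedContinuousFunction.const _ t.2) with hYdef
  have hYapp : ∀ t (z : TestPair X H), Y t z =
      inner ℝ (a t) (z.2 : H) * phi (inner ℝ t.1 (z.1 : V) + t.2) := fun t z => rfl
  have hYc : Continuous Y := by
    have h1 : Continuous fun t : V × ℝ => testRight X (a t) := (testRight X).continuous.comp ha
    have h2 : Continuous fun t : V × ℝ => (testLeft X H ρ hρ t.1 +
        BoundedContinuousFunction.const _ t.2 : TestPair X H →ᵇ ℝ) := by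
      refine ((testLeft X H ρ hρ).continuous.comp continuous_fst).add ?_
      have hc : LipschitzWith 1 fun c : ℝ => BoundedContinuousFunction.const (TestPair X H) c :=
        LipschitzWith.of_dist_le_mul fun c c' =>
          (BoundedContinuousFunction.dist_le (by positivity)).2 fun z => by simp
      exact hc.continuous.comp continuous_snd
    exact h1.mul ((BoundedContinuousFunction.lipschitz_comp hLip).continuous.comp h2)
  have hYb : ∀ t, ‖Y t‖ ≤ A * Bphi := fun t => by
    refine (BoundedContinuousFunction.norm_le (by positivity)).2 fun z => ?_
    rw [hYapp, norm_mul]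
    gcongr
    · exact (norm_inner_le_norm _ _).trans ((mul_le_of_le_one_right (norm_nonneg _)
        (mem_closedBall_zero_iff.1 z.2.2)).trans (hA t))
    · exact hB _
  have hYi : Integrable Y μ :=
    Integrable.of_bound hYc.aestronglyMeasurable _ (Eventually.of_forall hYb)
  set m := ∫ t, Y t ∂μ with hm
  have hmb : ‖m‖ ≤ A * Bphi := by
    refine (norm_integral_le_of_norm_le_const (Eventually.of_forall hYb)).trans ?_
    simp
  have hai : Integrable a μ :=
    Integrable.of_bound ha.aestronglyMeasurable _ (Eventually.of_forall hA)
  have ha2 : MemLp a 2 μ := MemLp.of_bound ha.aestronglyMeasurable _ (Eventually.of_forall hA)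
  have hwi : Integrable (fun t : V × ℝ => t.1) μ := hw.integrable (by norm_num)
  have hLsup := lipschitzWith_supBCF (Z := TestPair X H)
  -- the deviation from the mean
  have hdev := measure_lipschitz_sum_le hLsup (μ := μ) (Y := fun t => Y t - m) (A := 2 * (A * Bphi))
    (hYc.aestronglyMeasurable.sub aestronglyMeasurable_const) (by positivity)
    (fun t => (norm_sub_le _ _).trans (by linarith [hYb t])) hN hδ hδ1
  -- the mean
  set αf : V × ℝ → (TestPair X H →ᵇ ℝ) := fun t => Bphi • testRight X (a t)
  set βf : V × ℝ → (TestPair X H →ᵇ ℝ) := fun t => (A * Lphi) • testLeft X H ρ hρ t.1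
  have hαi : Integrable αf μ := ((testRight X).integrable_comp hai).smul Bphi
  have hβi : Integrable βf μ := ((testLeft X H ρ hρ).integrable_comp hwi).smul (A * (Lphi : ℝ))
  -- The increment of a product splits into one governed by ⟪a, u⟫ and one governed by ⟪w, x⟫; both
  -- dominating functions are linear in their variable.
  have hcontr : ∀ t z z', |Y t z - Y t z'| ≤ |αf t z - αf t z'| + |βf t z - βf t z'| := by
    intro t z z'
    simp only [hYapp, αf, βf, BoundedContinuousFunction.coe_smul, smul_eq_mul, testRight_apply,
      testLeft_apply, ← mul_sub, abs_mul, abs_of_pos hB0, abs_of_pos hA0, NNReal.abs_eq]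
    set p := inner ℝ (a t) (z.2 : H)
    set p' := inner ℝ (a t) (z'.2 : H)
    set q := phi (inner ℝ t.1 (z.1 : V) + t.2)
    set q' := phi (inner ℝ t.1 (z'.1 : V) + t.2)
    have h1 : p * q - p' * q' = (p - p') * q + p' * (q - q') := by ring
    have h2 : |q - q'| ≤ Lphi * |inner ℝ t.1 (z.1 : V) - inner ℝ t.1 (z'.1 : V)| := by
      have := hLip.dist_le_mul (inner ℝ t.1 (z.1 : V) + t.2) (inner ℝ t.1 (z'.1 : V) + t.2)
      rwa [dist_add_right, Real.dist_eq, Real.dist_eq] at this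
    have h3 : |p'| ≤ A := (abs_real_inner_le_norm _ _).trans ((mul_le_of_le_one_right (norm_nonneg _)
        (mem_closedBall_zero_iff.1 z'.2.2)).trans (hA t))
    rw [h1]
    refine (abs_add_le _ _).trans ?_
    rw [abs_mul, abs_mul]
    have h4 : |p - p'| * |q| ≤ Bphi * |p - p'| := by
      rw [mul_comm]; exact mul_le_mul_of_nonneg_right (hB _) (abs_nonneg _)
    have h5 : |p'| * |q - q'| ≤
        A * (Lphi * |inner ℝ t.1 (z.1 : V) - inner ℝ t.1 (z'.1 : V)|) := by gcongr
    linarith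
  have hmean : ∫ θ : Fin N → V × ℝ, supBCF (∑ i, (Y (θ i) - m)) ∂(Measure.pi fun _ => μ) ≤
      √N * (4 * Bphi * √(∫ t, ‖a t‖ ^ 2 ∂μ) + 4 * A * Lphi * ρ * √(∫ t, ‖t.1‖ ^ 2 ∂μ)) := by
    have hY'i : Integrable (fun p : (V × ℝ) × (Bool × Bool) =>
        (4 * sgn p.2.1) • αf p.1 + (4 * sgn p.2.2) • βf p.1) (μ.prod signLaw) := by
      have i1 := (Integrable.smul_prod (μ := signLaw) (ν := μ) (f := fun s => 4 * sgn s.1)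
          Integrable.of_finite hαi).swap
      have i2 := (Integrable.smul_prod (μ := signLaw) (ν := μ) (f := fun s => 4 * sgn s.2)
          Integrable.of_finite hβi).swap
      exact i1.add i2
    have h1 := integral_lipschitz_sum_le hLsup (hYi.sub (integrable_const m)) hY'i
      (fun R => integral_supBCF_le hYi hαi hβi hcontr R) N 0
    simp only [zero_add, Pi.sub_apply] at h1
    refine h1.trans ?_
    set ν := Measure.pi fun _ : Fin N => μ.prod signLaw
    have ha' := integral_norm_sum_sgn_le N ha2 Prod.fst (by rw [integral_signLaw]; simp [sgn])
    have hw' := integral_norm_sum_sgn_le N hw Prod.snd (by rw [integral_signLaw]; simp [sgn])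
    -- By linearity the suprema over u and x are at most norms of random sums in H and V, so only
    -- second moments are needed.
    have hpt : ∀ θ : Fin N → (V × ℝ) × (Bool × Bool),
        supBCF (∑ i, ((4 * sgn (θ i).2.1) • αf (θ i).1 + (4 * sgn (θ i).2.2) • βf (θ i).1)) ≤
        4 * Bphi * ‖∑ i, sgn (θ i).2.1 • a (θ i).1‖ +
          4 * A * Lphi * ρ * ‖∑ i, sgn (θ i).2.2 • (θ i).1.1‖ := by
      intro θ
      refine supBCF_le fun z => ?_
      have hz1 : inner ℝ (∑ i, sgn (θ i).2.1 • a (θ i).1) (z.2 : H) ≤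
          ‖∑ i, sgn (θ i).2.1 • a (θ i).1‖ :=
        (real_inner_le_norm _ _).trans (mul_le_of_le_one_right (norm_nonneg _)
          (mem_closedBall_zero_iff.1 z.2.2))
      have hz2 : inner ℝ (∑ i, sgn (θ i).2.2 • (θ i).1.1) (z.1 : V) ≤
          ‖∑ i, sgn (θ i).2.2 • (θ i).1.1‖ * ρ :=
        (real_inner_le_norm _ _).trans (mul_le_mul_of_nonneg_left (hρ _ z.1.2) (norm_nonneg _))
      have hz : (∑ i, ((4 * sgn (θ i).2.1) • αf (θ i).1 + (4 * sgn (θ i).2.2) • βf (θ i).1)) z =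
          4 * Bphi * inner ℝ (∑ i, sgn (θ i).2.1 • a (θ i).1) (z.2 : H) +
          4 * A * Lphi * inner ℝ (∑ i, sgn (θ i).2.2 • (θ i).1.1) (z.1 : V) := by
        rw [sum_inner, sum_inner, Finset.mul_sum, Finset.mul_sum, ← Finset.sum_add_distrib,
          BoundedContinuousFunction.coe_sum, Finset.sum_apply]
        refine Finset.sum_congr rfl fun i _ => ?_
        simp only [αf, βf, BoundedContinuousFunction.coe_add, Pi.add_apply,
          BoundedContinuousFunction.coe_smul, smul_eq_mul, testRight_apply, testLeft_apply,
          real_inner_smul_left]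
        ring
      rw [hz]
      have h6 : 4 * Bphi * inner ℝ (∑ i, sgn (θ i).2.1 • a (θ i).1) (z.2 : H) ≤
          4 * Bphi * ‖∑ i, sgn (θ i).2.1 • a (θ i).1‖ := by gcongr
      have h7 : 4 * A * Lphi * inner ℝ (∑ i, sgn (θ i).2.2 • (θ i).1.1) (z.1 : V) ≤
          4 * A * Lphi * (‖∑ i, sgn (θ i).2.2 • (θ i).1.1‖ * ρ) := by gcongr
      linarith
    have hsupi : Integrable (fun θ : Fin N → (V × ℝ) × (Bool × Bool) =>
        supBCF (∑ i, ((4 * sgn (θ i).2.1) • αf (θ i).1 + (4 * sgn (θ i).2.2) • βf (θ i).1))) ν := by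
      simpa using integrable_lipschitz_comp hLsup (integrable_sum_pi hY'i 0 N)
    refine (integral_mono hsupi ((ha'.1.const_mul _).add (hw'.1.const_mul _)) hpt).trans ?_
    simp only [Pi.add_apply]
    rw [integral_add (ha'.1.const_mul _) (hw'.1.const_mul _), integral_const_mul,
      integral_const_mul]
    have h8 := mul_le_mul_of_nonneg_left ha'.2 (by positivity : 0 ≤ 4 * Bphi)
    have h9 := mul_le_mul_of_nonneg_left hw'.2 (by positivity : 0 ≤ 4 * A * Lphi * ρ)
    linarith
  refine hdev.trans (measure_mono fun θ hθ x hx => ?_)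
  simp only [Set.mem_ofPred_eq] at hθ
  have hN' : (0 : ℝ) < N := Nat.cast_pos.2 hN
  have hlog : 0 < Real.log δ⁻¹ := Real.log_pos ((one_lt_inv₀ hδ).2 hδ1)
  set v := (N : ℝ)⁻¹ • ∑ i, phi (inner ℝ (θ i).1 x + (θ i).2) • a (θ i) -
        ∫ t, phi (inner ℝ t.1 x + t.2) • a t ∂μ with hv
  have hFi : Integrable (fun t : V × ℝ => phi (inner ℝ t.1 x + t.2) • a t) μ := by
    refine Integrable.of_bound ((hLip.continuous.comp (by fun_prop)).smul
      ha).aestronglyMeasurable (Bphi * A) (Eventually.of_forall fun t => ?_)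
    rw [norm_smul]
    gcongr
    · exact hB _
    · exact hA _
  have hle : ‖v‖ ≤ (N : ℝ)⁻¹ * supBCF (∑ i, (Y (θ i) - m)) := by
    -- A norming vector of v, with u = 0 in the degenerate case.
    obtain ⟨u, hu1, hu⟩ : ∃ u : H, ‖u‖ ≤ 1 ∧ inner ℝ v u = ‖v‖ := by
      by_cases h0 : v = 0
      · exact ⟨0, by simp, by simp [h0]⟩
      · refine ⟨‖v‖⁻¹ • v, ?_, ?_⟩
        · rw [norm_smul, norm_inv, norm_norm, inv_mul_cancel₀ (norm_ne_zero_iff.2 h0)]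
        · have : ‖v‖ ≠ 0 := norm_ne_zero_iff.2 h0
          rw [real_inner_smul_right, real_inner_self_eq_norm_sq]; field_simp
    set z : TestPair X H := ⟨⟨x, hx⟩, ⟨u, by simpa using hu1⟩⟩
    have h1 := le_supBCF (∑ i, (Y (θ i) - m)) z
    have hmz : m z = inner ℝ (∫ t, phi (inner ℝ t.1 x + t.2) • a t ∂μ) u := by
      have h2 : m z = ∫ t, Y t z ∂μ :=
        ((BoundedContinuousFunction.evalCLM ℝ z).integral_comp_comm hYi).symm
      rw [h2, real_inner_comm, ← integral_inner hFi]
      refine integral_congr_ae (Eventually.of_forall fun t => ?_)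
      simp only [hYapp, z, real_inner_smul_right]
      rw [real_inner_comm]; ring
    have h2 : (∑ i, (Y (θ i) - m)) z = N * inner ℝ v u := by
      rw [BoundedContinuousFunction.coe_sum, Finset.sum_apply, hv, inner_sub_left, ← hmz,
        real_inner_smul_left, sum_inner, mul_sub, ← mul_assoc, mul_inv_cancel₀ hN'.ne', one_mul]
      simp only [BoundedContinuousFunction.coe_sub, Pi.sub_apply, Finset.sum_sub_distrib,
        Finset.sum_const, Finset.card_univ, Fintype.card_fin, nsmul_eq_mul]
      congr 1
      refine Finset.sum_congr rfl fun i _ => ?_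
      simp only [hYapp, z, real_inner_smul_left]
      ring
    rw [h2, hu] at h1
    rw [inv_mul_eq_div, le_div_iff₀ hN']
    linarith
  have hsqN : (N : ℝ) = √N * √N := (Real.mul_self_sqrt hN'.le).symm
  have hsq0 : 0 < √(N : ℝ) := Real.sqrt_pos.2 hN'
  -- The factor √2 is rounded up to 2; together with the bound 2 A Bphi this gives the constant 4.
  have hs2 : √(2 * N * Real.log δ⁻¹) ≤ 2 * √N * √(Real.log δ⁻¹) := by
    have h4 : √(4 : ℝ) = 2 := by
      rw [show (4 : ℝ) = 2 ^ 2 by norm_num]; exact Real.sqrt_sq (by norm_num)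
    rw [← h4, ← Real.sqrt_mul (by norm_num), ← Real.sqrt_mul (by positivity)]
    refine Real.sqrt_le_sqrt ?_
    have : 0 < N * Real.log δ⁻¹ := by positivity
    nlinarith
  refine hle.trans ?_
  rw [le_div_iff₀ hsq0, inv_mul_eq_div, div_mul_eq_mul_div, div_le_iff₀ hN']
  have h10 : 2 * (A * Bphi) * √(2 * N * Real.log δ⁻¹) ≤
      2 * (A * Bphi) * (2 * √N * √(Real.log δ⁻¹)) := by gcongr
  have h11 : supBCF (∑ i, (Y (θ i) - m)) ≤
      √N * (4 * Bphi * √(∫ t, ‖a t‖ ^ 2 ∂μ) + 4 * A * Lphi * ρ * √(∫ t, ‖t.1‖ ^ 2 ∂μ) +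
        4 * A * Bphi * √(Real.log δ⁻¹)) := by linarith
  calc _ ≤ _ := mul_le_mul_of_nonneg_right h11 hsq0.le
    _ = _ := by linear_combination (-(4 * Bphi * √(∫ t, ‖a t‖ ^ 2 ∂μ) +
        4 * A * Lphi * ρ * √(∫ t, ‖t.1‖ ^ 2 ∂μ) + 4 * A * Bphi * √(Real.log δ⁻¹))) * hsqN

end MonteCarlo

/-! ### Regularity of the mean and of the covariance on the cube -/

section Regularity

variable {d : ℕ} {S : ℝ}

theorem isCompact_cube (d : ℕ) (S : ℝ) : IsCompact (cube d S) := by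
  have h : cube d S = (EuclideanSpace.equiv (Fin d) ℝ).toHomeomorph ⁻¹'
      (Set.univ.pi fun _ => Set.Icc (-S) S) := by
    ext x; exact ⟨fun h i _ => h i, fun h i => h i (Set.mem_univ i)⟩
  rw [h, Homeomorph.isCompact_preimage]
  exact isCompact_univ_pi fun _ => isCompact_Icc

theorem zero_mem_cube (d : ℕ) (hS : 0 ≤ S) : (0 : Euc d) ∈ cube d S := fun i => by
  simpa using hS

theorem continuous_partialD {m : Euc d → ℝ} (hm : ContDiff ℝ 1 m) (α : Option (Fin d)) :
    Continuous (partialD α m) := by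
  cases α with
  | none => exact hm.continuous
  | some i =>
    have : partialD (some i) m = fun x => fderiv ℝ m x (EuclideanSpace.single i 1) := by
      funext x
      exact ((hm.differentiable (by norm_num)) x).lineDeriv_eq_fderiv
    rw [this]
    exact (hm.continuous_fderiv (by norm_num)).clm_apply continuous_const

/-- A real supremum over an unbounded family is 0 by convention. This boundedness is what makes
`M1star` and `M1starK` genuine upper bounds. -/
theorem bddAbove_range_abs_of_continuous {ι Y : Type*} [Finite ι] [TopologicalSpace Y]
    [CompactSpace Y] {g : ι → Y → ℝ} (hg : ∀ i, Continuous (g i)) :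
    BddAbove (Set.range fun p : ι × Y => |g p.1 p.2|) := by
  have h : ∀ i, ∃ c, ∀ y, |g i y| ≤ c := fun i => by
    obtain ⟨c, hc⟩ := (isCompact_range (hg i).abs).bddAbove
    exact ⟨c, fun y => hc ⟨y, rfl⟩⟩
  choose c hc using h
  obtain ⟨C, hC⟩ := (Set.finite_range c).bddAbove
  exact ⟨C, by rintro _ ⟨p, rfl⟩; exact (hc _ _).trans (hC ⟨_, rfl⟩)⟩

theorem abs_partialD_le_M1star {m : Euc d → ℝ} (hm : ContDiff ℝ 1 m) (α : Option (Fin d))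
    {x : Euc d} (hx : x ∈ cube d S) : |partialD α m x| ≤ M1star S m := by
  have : CompactSpace (cube d S) := isCompact_iff_compactSpace.1 (isCompact_cube d S)
  have hb : BddAbove (Set.range fun p : Option (Fin d) × cube d S => |partialD p.1 m p.2|) :=
    bddAbove_range_abs_of_continuous (g := fun α (x : cube d S) => partialD α m x)
      fun α => (continuous_partialD hm α).comp continuous_subtype_val
  exact le_ciSup hb (α, ⟨x, hx⟩)

theorem abs_mixedD_le_M1starK {k : Euc d → Euc d → ℝ} (hk : IsC11 k) (α β : Option (Fin d))
    {x y : Euc d} (hx : x ∈ cube d S) (hy : y ∈ cube d S) :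
    |mixedD α β k x y| ≤ M1starK S k := by
  have : CompactSpace (cube d S) := isCompact_iff_compactSpace.1 (isCompact_cube d S)
  have hb : BddAbove (Set.range fun p : (Option (Fin d) × Option (Fin d)) ×
      (cube d S × cube d S) => |mixedD p.1.1 p.1.2 k p.2.1 p.2.2|) :=
    bddAbove_range_abs_of_continuous
      (g := fun (α : Option (Fin d) × Option (Fin d)) (z : cube d S × cube d S) =>
        mixedD α.1 α.2 k z.1 z.2) fun α =>
      (hk.continuous α.1 α.2).comp (by fun_prop : Continuous fun z : cube d S × cube d S =>
        ((z.1 : Euc d), (z.2 : Euc d)))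
  exact le_ciSup hb ((α, β), (⟨x, hx⟩, ⟨y, hy⟩))

theorem M1star_nonneg (S : ℝ) (m : Euc d → ℝ) : 0 ≤ M1star S m :=
  Real.iSup_nonneg fun _ => abs_nonneg _

theorem M1starK_nonneg (S : ℝ) (k : Euc d → Euc d → ℝ) : 0 ≤ M1starK S k :=
  Real.iSup_nonneg fun _ => abs_nonneg _

/-- The mean value inequality for line derivatives. -/
theorem abs_sub_le_of_lineDeriv_le {E : Type*} [NormedAddCommGroup E] [NormedSpace ℝ E]
    {f : E → ℝ} {x v : E} {M : ℝ} (hd : ∀ y, LineDifferentiableAt ℝ f y v)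
    (hM : ∀ t ∈ Set.Icc (0 : ℝ) 1, |lineDeriv ℝ f (x + t • v) v| ≤ M) :
    |f (x + v) - f x| ≤ M := by
  have h1 : ∀ t : ℝ, HasDerivAt (fun s : ℝ => f (x + s • v)) (lineDeriv ℝ f (x + t • v) v) t := by
    intro t
    have h2 : HasDerivAt (fun s : ℝ => f (x + t • v + s • v))
        (lineDeriv ℝ f (x + t • v) v) (t - t) := by
      rw [sub_self]; exact (hd (x + t • v)).hasLineDerivAt
    have h3 := h2.comp_sub_const t t
    refine h3.congr_of_eventuallyEq (Eventually.of_forall fun s => ?_)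
    simp only
    congr 1
    module
  have := norm_image_sub_le_of_norm_deriv_le_segment_01' (f := fun s : ℝ => f (x + s • v))
    (C := M) (fun t _ => (h1 t).hasDerivWithinAt) fun t ht => hM t ⟨ht.1, ht.2.le⟩
  simpa using this

theorem cube_add_single_mem {x : Euc d} {i : Fin d} {h : ℝ} (hx : x ∈ cube d S)
    (hxh : x + h • EuclideanSpace.single i 1 ∈ cube d S) {t : ℝ} (ht : t ∈ Set.Icc (0 : ℝ) 1) :
    x + t • h • EuclideanSpace.single i (1 : ℝ) ∈ cube d S := by
  intro j
  have h1 := hx j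
  have h2 := hxh j
  simp only [PiLp.add_apply, PiLp.smul_apply, smul_eq_mul, Set.mem_Icc] at *
  set e := (EuclideanSpace.single i (1 : ℝ) : Euc d) j
  constructor <;> nlinarith [ht.1, ht.2]

variable {H : Type*} [NormedAddCommGroup H] [InnerProductSpace ℝ H]

/-- A feature map of the uncentred covariance is bounded on the cube. -/
theorem norm_feature_le {F : Euc d → H} {m : Euc d → ℝ} {k : Euc d → Euc d → ℝ}
    (hm : ContDiff ℝ 1 m) (hk : IsC11 k) (hF : ∀ x y, inner ℝ (F x) (F y) = k x y + m x * m y)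
    {x : Euc d} (hx : x ∈ cube d S) : ‖F x‖ ≤ M1star S m + √(M1starK S k) := by
  have h1 : |m x| ≤ M1star S m := abs_partialD_le_M1star hm none hx
  have h2 : |k x x| ≤ M1starK S k := abs_mixedD_le_M1starK hk none none hx hx
  have h3 : ‖F x‖ ^ 2 = k x x + m x * m x := by rw [← hF, real_inner_self_eq_norm_sq]
  have h4 := Real.sq_sqrt (M1starK_nonneg S k)
  have h5 := Real.sqrt_nonneg (M1starK S k)
  have h6 := M1star_nonneg S m
  refine abs_le_of_sq_le_sq' ?_ (by positivity) |>.2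
  -- The squared norm is at most M_1^*(k) + M_1^*(m)², which is below the square of M_1^*(m) +
  -- √M_1^*(k).
  have h7 : m x * m x ≤ M1star S m ^ 2 := by
    rw [← sq, ← sq_abs]; gcongr
  nlinarith [le_abs_self (k x x), mul_nonneg h5 h6]

/-- The squared increment of F is the mixed second difference of k plus the squared increment of m.
The mean value inequality, used once in each argument of k, yields |h|² with a derivative of order
only one in each. Steps are parallel to an axis because line derivatives of k are available only
there. -/
theorem norm_feature_sub_single_le {F : Euc d → H} {m : Euc d → ℝ} {k : Euc d → Euc d → ℝ}
    (hm : ContDiff ℝ 1 m) (hk : IsC11 k) (hF : ∀ x y, inner ℝ (F x) (F y) = k x y + m x * m y)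
    {x : Euc d} {i : Fin d} {h : ℝ} (hx : x ∈ cube d S)
    (hxh : x + h • EuclideanSpace.single i 1 ∈ cube d S) :
    ‖F (x + h • EuclideanSpace.single i 1) - F x‖ ≤
      |h| * (M1star S m + √(M1starK S k)) := by
  set v : Euc d := h • EuclideanSpace.single i 1 with hv
  set x' := x + v with hx'
  have hseg : ∀ t ∈ Set.Icc (0 : ℝ) 1, x + t • v ∈ cube d S := fun t ht =>
    cube_add_single_mem hx hxh ht
  have h1 : |m x' - m x| ≤ |h| * M1star S m := by
    refine abs_sub_le_of_lineDeriv_le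
      (fun y => ((hm.differentiable (by norm_num)) y).lineDifferentiableAt) fun t ht => ?_
    rw [hv, lineDeriv_smul, smul_eq_mul, abs_mul]
    gcongr
    exact abs_partialD_le_M1star hm (some i) (hseg t ht)
  -- First the mean value inequality in the second argument, for the difference of two sections;
  -- then in the first argument, for the partial derivative just produced.
  have h2 : |(k x' x' - k x x') - (k x' x - k x x)| ≤ |h| * (|h| * M1starK S k) := by
    refine abs_sub_le_of_lineDeriv_le (f := fun y => k x' y - k x y) (fun y => ?_) fun t ht => ?_
    · exact ((hk.exists_y i x' y).smul h).sub ((hk.exists_y i x y).smul h)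
    · have e1 : lineDeriv ℝ (fun y => k x' y - k x y) (x + t • v) v =
          h * (partialD (some i) (k x') (x + t • v) - partialD (some i) (k x) (x + t • v)) := by
        have hl : HasLineDerivAt ℝ (fun y => k x' y - k x y)
            (lineDeriv ℝ (k x') (x + t • v) v - lineDeriv ℝ (k x) (x + t • v) v) (x + t • v) v :=
          HasDerivAt.sub ((hk.exists_y i x' (x + t • v)).smul h).hasLineDerivAt
            ((hk.exists_y i x (x + t • v)).smul h).hasLineDerivAt
        have hs : ∀ g : Euc d → ℝ, lineDeriv ℝ g (x + t • v) v =
            h * partialD (some i) g (x + t • v) := fun g => lineDeriv_smul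
        rw [hl.lineDeriv, hs, hs, mul_sub]
      rw [e1, abs_mul]
      gcongr
      refine abs_sub_le_of_lineDeriv_le (f := fun x' => partialD (some i) (k x') (x + t • v))
        (fun y => (hk.exists_x (some i) i y (x + t • v)).smul h) fun s hs => ?_
      rw [hv, lineDeriv_smul, smul_eq_mul, abs_mul]
      gcongr
      exact abs_mixedD_le_M1starK hk (some i) (some i) (hseg s hs) (hseg t ht)
  have h3 : ‖F x' - F x‖ ^ 2 =
      ((k x' x' - k x x') - (k x' x - k x x)) + (m x' - m x) ^ 2 := by
    rw [← real_inner_self_eq_norm_sq, inner_sub_left, inner_sub_right, inner_sub_right]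
    simp only [hF]
    ring
  have h4 := Real.sq_sqrt (M1starK_nonneg S k)
  have h5 := Real.sqrt_nonneg (M1starK S k)
  have h6 := M1star_nonneg S m
  refine abs_le_of_sq_le_sq' ?_ (by positivity) |>.2
  have h7 : (m x' - m x) ^ 2 ≤ (|h| * M1star S m) ^ 2 := by
    rw [← sq_abs]; gcongr
  have h8 := mul_nonneg (mul_nonneg h5 h6) (sq_nonneg |h|)
  rw [h3]
  nlinarith [le_abs_self ((k x' x' - k x x') - (k x' x - k x x))]

/-- A feature map of the uncentred covariance is Lipschitz on the cube. -/
theorem norm_feature_sub_le {F : Euc d → H} {m : Euc d → ℝ} {k : Euc d → Euc d → ℝ}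
    (hm : ContDiff ℝ 1 m) (hk : IsC11 k) (hF : ∀ x y, inner ℝ (F x) (F y) = k x y + m x * m y)
    {x y : Euc d} (hx : x ∈ cube d S) (hy : y ∈ cube d S) :
    ‖F y - F x‖ ≤ d * (M1star S m + √(M1starK S k)) * ‖y - x‖ := by
  classical
  set M := M1star S m + √(M1starK S k)
  have hM : 0 ≤ M := add_nonneg (M1star_nonneg S m) (Real.sqrt_nonneg _)
  -- A path from x to y that changes one coordinate at a time never leaves the cube.
  let z : Finset (Fin d) → Euc d := fun s => WithLp.toLp 2 fun i => if i ∈ s then y i else x i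
  have hz : ∀ s, z s ∈ cube d S := fun s i => by
    by_cases h : i ∈ s
    · simpa [z, h] using hy i
    · simpa [z, h] using hx i
  have key : ∀ s : Finset (Fin d), ‖F (z s) - F x‖ ≤ ∑ i ∈ s, |y i - x i| * M := by
    intro s
    induction s using Finset.induction_on with
    | empty =>
      have : z ∅ = x := by ext i; simp [z]
      simp [this]
    | insert i s his ih =>
      have e : z (insert i s) = z s + (y i - x i) • EuclideanSpace.single i 1 := by
        ext j
        by_cases hj : j = i
        · subst hj; simp [z, his]
        · simp [z, hj]
      rw [Finset.sum_insert his]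
      have h1 := norm_feature_sub_single_le (S := S) hm hk hF (x := z s) (i := i) (h := y i - x i)
        (hz s) (by rw [← e]; exact hz _)
      rw [← e] at h1
      calc _ = ‖(F (z (insert i s)) - F (z s)) + (F (z s) - F x)‖ := by congr 1; abel
        _ ≤ _ := (norm_add_le _ _).trans (add_le_add h1 ih)
  have h1 := key Finset.univ
  have hy' : z Finset.univ = y := by ext i; simp [z]
  rw [hy'] at h1
  refine h1.trans ?_
  calc _ ≤ ∑ _i : Fin d, ‖y - x‖ * M := Finset.sum_le_sum fun i _ =>
        mul_le_mul_of_nonneg_right (by simpa using PiLp.norm_apply_le (y - x) i) hM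
    _ = _ := by simp; ring

/-- Multiplication by a Lipschitz cut-off makes a feature map globally Lipschitz. -/
theorem lipschitzWith_cutoff_smul {F : Euc d → H} {χ : Euc d → ℝ} {M K : ℝ} {Kχ : ℝ≥0}
    (hχL : LipschitzWith Kχ χ) (hχ : ∀ x, χ x ∈ Set.Icc (0 : ℝ) 1)
    (hχ0 : ∀ x, x ∉ cube d S → χ x = 0) (hM : ∀ x ∈ cube d S, ‖F x‖ ≤ M)
    (hK : ∀ x ∈ cube d S, ∀ y ∈ cube d S, ‖F y - F x‖ ≤ K * ‖y - x‖) (hK0 : 0 ≤ K) (hM0 : 0 ≤ M)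
    (x y : Euc d) : ‖χ y • F y - χ x • F x‖ ≤ (Kχ * M + K) * ‖y - x‖ := by
  have h1 : ∀ x y : Euc d, |χ y - χ x| ≤ Kχ * ‖y - x‖ := fun x y => by
    simpa [dist_eq_norm] using hχL.dist_le_mul y x
  -- If y lies off the cube then χ y = 0, so χ x itself is at most Kχ ‖y - x‖ and no bound on F
  -- outside the cube is needed.
  have hone : ∀ x y : Euc d, x ∈ cube d S → y ∉ cube d S →
      ‖χ x • F x‖ ≤ (Kχ * M + K) * ‖y - x‖ := by
    intro x y hx hy
    have h2 := h1 y x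
    rw [hχ0 y hy, sub_zero, norm_sub_rev] at h2
    rw [norm_smul]
    calc _ ≤ Kχ * ‖y - x‖ * M := mul_le_mul h2 (hM x hx) (norm_nonneg _) (by positivity)
      _ ≤ _ := by nlinarith [mul_nonneg hK0 (norm_nonneg (y - x))]
  by_cases hx : x ∈ cube d S
  · by_cases hy : y ∈ cube d S
    · have e : χ y • F y - χ x • F x = (χ y - χ x) • F y + χ x • (F y - F x) := by module
      rw [e]
      refine (norm_add_le _ _).trans ?_
      rw [norm_smul, norm_smul, Real.norm_eq_abs, Real.norm_eq_abs, abs_of_nonneg (hχ x).1]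
      have a1 : |χ y - χ x| * ‖F y‖ ≤ Kχ * ‖y - x‖ * M :=
        mul_le_mul (h1 x y) (hM y hy) (norm_nonneg _) (by positivity)
      have a2 : χ x * ‖F y - F x‖ ≤ 1 * (K * ‖y - x‖) :=
        mul_le_mul (hχ x).2 (hK x hx y hy) (norm_nonneg _) (by norm_num)
      linarith
    · rw [hχ0 y hy, zero_smul, zero_sub, norm_neg]
      exact hone x y hx hy
  · by_cases hy : y ∈ cube d S
    · rw [hχ0 x hx, zero_smul, sub_zero, norm_sub_rev]
      exact hone y x hy hx
    · rw [hχ0 x hx, hχ0 y hy]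
      simp only [zero_smul, sub_zero, norm_zero]
      positivity

theorem exists_lipschitzWith_mollifier {X : Set (Euc d)} {χ : Euc d → ℝ}
    (hχ : IsMollifier X S χ) : ∃ K, LipschitzWith K χ := by
  have hc : HasCompactSupport χ :=
    HasCompactSupport.intro (isCompact_cube d S) hχ.eq_zero
  exact hχ.smooth.lipschitzWith_of_hasCompactSupport hc (by simp)

end Regularity

/-! ### The conditional mean square error -/

section CondExp

variable {d : ℕ} {Ω : Type*} [MeasurableSpace Ω] {P : Measure Ω} [IsProbabilityMeasure P]
variable {f : Euc d → Ω → ℝ} {m : Euc d → ℝ} {k : Euc d → Euc d → ℝ}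

/-- Gaussianity enters the estimates through this square integrability; afterwards only the first
two moments matter. -/
theorem IsGP.memLp (hf : IsGP P f m k) (x : Euc d) : MemLp (f x) 2 P :=
  (hf.gaussian.hasGaussianLaw_eval x).memLp (by norm_num)

/-- A Gaussian process, as a map to the Hilbert space `L²(P)`. -/
noncomputable def gpFeature (hf : IsGP P f m k) (x : Euc d) : Lp ℝ 2 P := (hf.memLp x).toLp (f x)

theorem inner_gpFeature_eq_integral (hf : IsGP P f m k) (x y : Euc d) :
    inner ℝ (gpFeature hf x) (gpFeature hf y) = ∫ ω, f x ω * f y ω ∂P := by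
  rw [L2.inner_def]
  refine integral_congr_ae ?_
  filter_upwards [(hf.memLp x).coeFn_toLp, (hf.memLp y).coeFn_toLp] with ω h1 h2
  simp only [gpFeature, h1, h2]
  simp [mul_comm]

/-- The inner product of L²(P) is the uncentred second moment, so the mean joins the covariance. The
regularity of the feature map rests on this identity. -/
theorem inner_gpFeature (hf : IsGP P f m k) (x y : Euc d) :
    inner ℝ (gpFeature hf x) (gpFeature hf y) = k x y + m x * m y := by
  have h := covariance_eq_sub (hf.memLp x) (hf.memLp y)
  rw [hf.covariance, hf.mean, hf.mean] at h
  rw [inner_gpFeature_eq_integral, h]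
  simp

variable {T : Type*} [MeasurableSpace T] {θ : Ω → T} {ι : Type*} [Fintype ι]

theorem norm_sq_sum_smul_gpFeature (hf : IsGP P f m k) (c : ι → ℝ) (y : ι → Euc d) :
    ‖∑ j, c j • gpFeature hf (y j)‖ ^ 2 =
      ∑ i, ∑ j, c i * c j * ∫ ω, f (y i) ω * f (y j) ω ∂P := by
  rw [← real_inner_self_eq_norm_sq, sum_inner]
  refine Finset.sum_congr rfl fun i _ => ?_
  rw [inner_sum]
  refine Finset.sum_congr rfl fun j _ => ?_
  rw [real_inner_smul_left, real_inner_smul_right, inner_gpFeature_eq_integral, mul_assoc]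

theorem integrable_coeff_mul (hf : IsGP P f m k) (hθ : Measurable θ) {c : ι → T → ℝ}
    (hc : ∀ j, Measurable (c j)) {B : ℝ} (hB : ∀ j t, |c j t| ≤ B) (y : ι → Euc d) (i j : ι) :
    Integrable ((fun ω => c i (θ ω) * c j (θ ω)) * fun ω => f (y i) ω * f (y j) ω) P := by
  refine Integrable.bdd_mul (c := B * B) ((hf.memLp (y i)).integrable_mul (hf.memLp (y j)))
    (((hc i).comp hθ).mul ((hc j).comp hθ)).aestronglyMeasurable (Eventually.of_forall fun ω => ?_)
  have h0 : 0 ≤ B := (abs_nonneg _).trans (hB i (θ ω))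
  rw [Real.norm_eq_abs, abs_mul]
  exact mul_le_mul (hB _ _) (hB _ _) (abs_nonneg _) h0

theorem sq_sum_eq (c : ι → T → ℝ) (y : ι → Euc d) :
    (fun ω => (∑ j, c j (θ ω) * f (y j) ω) ^ 2) =
      ∑ i, ∑ j, ((fun ω => c i (θ ω) * c j (θ ω)) * fun ω => f (y i) ω * f (y j) ω) := by
  funext ω
  simp only [Finset.sum_apply, Pi.mul_apply, sq, Finset.sum_mul_sum]
  exact Finset.sum_congr rfl fun i _ => Finset.sum_congr rfl fun j _ => by ring

theorem integrable_sq_sum (hf : IsGP P f m k) (hθ : Measurable θ) {c : ι → T → ℝ}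
    (hc : ∀ j, Measurable (c j)) {B : ℝ} (hB : ∀ j t, |c j t| ≤ B) (y : ι → Euc d) :
    Integrable (fun ω => (∑ j, c j (θ ω) * f (y j) ω) ^ 2) P := by
  rw [sq_sum_eq]
  exact integrable_finsetSum' _ fun i _ => integrable_finsetSum' _ fun j _ =>
    integrable_coeff_mul hf hθ hc hB y i j

/-- The conditional second moment of a linear functional of the process with independent
coefficients. -/
theorem condExp_sq_sum (hf : IsGP P f m k) (hθ : Measurable θ)
    (hind : IndepFun (fun ω x => f x ω) θ P) {c : ι → T → ℝ}
    (hc : ∀ j, Measurable (c j)) {B : ℝ} (hB : ∀ j t, |c j t| ≤ B) (y : ι → Euc d) :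
    P[fun ω => (∑ j, c j (θ ω) * f (y j) ω) ^ 2 | MeasurableSpace.comap θ inferInstance] =ᵐ[P]
      fun ω => ‖∑ j, c j (θ ω) • gpFeature hf (y j)‖ ^ 2 := by
  have hle : MeasurableSpace.comap θ inferInstance ≤ ‹MeasurableSpace Ω› := hθ.comap_le
  have hfm : Measurable fun ω x => f x ω := measurable_pi_lambda _ hf.measurable
  have hterm : ∀ i j, P[(fun ω => c i (θ ω) * c j (θ ω)) * fun ω => f (y i) ω * f (y j) ω |
      MeasurableSpace.comap θ inferInstance] =ᵐ[P]
      fun ω => c i (θ ω) * c j (θ ω) * ∫ ω, f (y i) ω * f (y j) ω ∂P := by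
    intro i j
    have hm1 : StronglyMeasurable[MeasurableSpace.comap θ inferInstance]
        fun ω => c i (θ ω) * c j (θ ω) :=
      (((hc i).mul (hc j)).comp (comap_measurable θ)).stronglyMeasurable
    have hm2 : StronglyMeasurable[MeasurableSpace.comap (fun ω x => f x ω) inferInstance]
        fun ω => f (y i) ω * f (y j) ω := by
      refine Measurable.stronglyMeasurable ?_
      exact (((measurable_pi_apply (y i)).mul (measurable_pi_apply (y j))).comp
        (comap_measurable (fun ω x => f x ω)))
    -- The coefficients are functions of the parameters and leave the conditional expectation; by
    -- independence, what remains is an ordinary expectation.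
    have h1 := condExp_mul_of_stronglyMeasurable_left (μ := P) hm1
      (integrable_coeff_mul hf hθ hc hB y i j)
      ((hf.memLp (y i)).integrable_mul (hf.memLp (y j)))
    have h2 := condExp_indep_eq (μ := P) hfm.comap_le hle hm2 hind
    filter_upwards [h1, h2] with ω e1 e2
    rw [e1, Pi.mul_apply]
    congr 1
  rw [sq_sum_eq]
  refine (condExp_finsetSum (fun i _ => integrable_finsetSum' _ fun j _ =>
    integrable_coeff_mul hf hθ hc hB y i j) _).trans ?_
  have h3 : ∀ i, P[∑ j, ((fun ω => c i (θ ω) * c j (θ ω)) * fun ω => f (y i) ω * f (y j) ω) |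
      MeasurableSpace.comap θ inferInstance] =ᵐ[P]
      ∑ j, fun ω => c i (θ ω) * c j (θ ω) * ∫ ω, f (y i) ω * f (y j) ω ∂P := fun i => by
    refine (condExp_finsetSum (fun j _ => integrable_coeff_mul hf hθ hc hB y i j) _).trans ?_
    exact eventuallyEq_sum fun j _ => hterm i j
  refine (eventuallyEq_sum fun i _ => h3 i).trans (Eventually.of_forall fun ω => ?_)
  simp only [Finset.sum_apply]
  rw [norm_sq_sum_smul_gpFeature]

end CondExp

/-! ### The operator error as a linear functional of the process -/

section RidgeletError

variable {d N : ℕ}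

/-- The weight of the value at the node `j` in the value of the ridgelet operator at `x`. -/
noncomputable def ridgeletCoeff (phi psi : ℝ → ℝ) (S : ℝ) (χ : Euc d → ℝ) (Z : ℝ) (n : ℕ)
    (x : Euc d) (j : Fin d → Fin n) (t : Fin N → Euc d × ℝ) : ℝ :=
  ∑ i : Fin N, Z / N * ((2 * S) ^ d / ((n ^ d : ℕ) : ℝ) * χ (gridNode S n j) *
    psi (inner ℝ (t i).1 (gridNode S n j) + (t i).2)) * phi (inner ℝ (t i).1 x + (t i).2)

/-- Exchanging the sums over units and nodes separates coefficients that depend only on the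
parameters from the values of the process. -/
theorem ridgeletOp_eq_sum (phi psi : ℝ → ℝ) (S : ℝ) (χ : Euc d → ℝ) (Z : ℝ) (n : ℕ)
    (w : Fin N → Euc d) (b : Fin N → ℝ) (g : Euc d → ℝ) (x : Euc d) :
    ridgeletOp phi psi S χ Z n N w b g x =
      ∑ j, ridgeletCoeff phi psi S χ Z n x j (fun i => (w i, b i)) * g (gridNode S n j) := by
  simp only [ridgeletOp, ridgeletCoeff, Finset.sum_mul, Finset.mul_sum]
  rw [Finset.sum_comm]
  exact Finset.sum_congr rfl fun j _ => Finset.sum_congr rfl fun i _ => by ring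

theorem measurable_ridgeletCoeff {phi psi : ℝ → ℝ} (hphi : Continuous phi) (hpsi : Continuous psi)
    (S : ℝ) (χ : Euc d → ℝ) (Z : ℝ) (n : ℕ) (x : Euc d) (j : Fin d → Fin n) :
    Measurable (ridgeletCoeff (N := N) phi psi S χ Z n x j) := by
  unfold ridgeletCoeff
  refine Continuous.measurable ?_
  fun_prop

/-- Only finiteness and independence of t matter here: the bound justifies integrability and never
enters the rate. -/
theorem abs_ridgeletCoeff_le {phi psi : ℝ → ℝ} {Bphi Bpsi : ℝ} (hphi : ∀ s, |phi s| ≤ Bphi)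
    (hpsi : ∀ s, |psi s| ≤ Bpsi) (S : ℝ) {χ : Euc d → ℝ} (hχ : ∀ x, χ x ∈ Set.Icc (0 : ℝ) 1) (Z : ℝ)
    (n : ℕ) (x : Euc d) (j : Fin d → Fin n) (t : Fin N → Euc d × ℝ) :
    |ridgeletCoeff phi psi S χ Z n x j t| ≤
      N * (|Z / N| * (|(2 * S) ^ d / ((n ^ d : ℕ) : ℝ)| * 1 * Bpsi) * Bphi) := by
  have h0 : 0 ≤ Bpsi := (abs_nonneg _).trans (hpsi 0)
  refine (Finset.abs_sum_le_sum_abs _ _).trans ((Finset.sum_le_sum fun i _ =>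
    (?_ : _ ≤ |Z / N| * (|(2 * S) ^ d / ((n ^ d : ℕ) : ℝ)| * 1 * Bpsi) * Bphi)).trans
    (by simp))
  rw [abs_mul, abs_mul, abs_mul, abs_mul]
  gcongr
  · rw [abs_of_nonneg (hχ _).1]; exact (hχ _).2
  · exact hpsi _
  · exact hphi _

variable {Ω : Type*} [MeasurableSpace Ω] {P : Measure Ω} [IsProbabilityMeasure P]
variable {f : Euc d → Ω → ℝ} {m : Euc d → ℝ} {k : Euc d → Euc d → ℝ}

/-- The error of the ridgelet operator, as an element of `L²(P)`, at given weights and biases. -/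
noncomputable def ridgeletError {H : Type*} [NormedAddCommGroup H] [NormedSpace ℝ H]
    (F : Euc d → H) (phi psi : ℝ → ℝ) (S : ℝ) (χ : Euc d → ℝ)
    (Z : ℝ) (n : ℕ) (x : Euc d) (t : Fin N → Euc d × ℝ) : H :=
  F x - ∑ j, ridgeletCoeff phi psi S χ Z n x j t • F (gridNode S n j)

/-- Given the parameters, the error is a finite linear combination of the process at x and at the
nodes, so the conditional second moment is a squared norm in L²(P). -/
theorem integrable_and_condExp_sqError (hf : IsGP P f m k) {phi psi : ℝ → ℝ}
    (hphi : Continuous phi) (hpsi : Continuous psi) {Bphi Bpsi : ℝ} (hBphi : ∀ s, |phi s| ≤ Bphi)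
    (hBpsi : ∀ s, |psi s| ≤ Bpsi) (S : ℝ) {χ : Euc d → ℝ} (hχ : ∀ x, χ x ∈ Set.Icc (0 : ℝ) 1)
    (Z : ℝ) (n : ℕ) {w : Fin N → Ω → Euc d} {b : Fin N → Ω → ℝ} (hw : ∀ i, Measurable (w i))
    (hb : ∀ i, Measurable (b i)) (hind : IndepFun (fun ω x => f x ω) (params w b) P) (x : Euc d) :
    Integrable (sqError phi psi S χ Z n w b f x) P ∧
    P[sqError phi psi S χ Z n w b f x | MeasurableSpace.comap (params w b) inferInstance] =ᵐ[P]
      fun ω => ‖ridgeletError (gpFeature hf) phi psi S χ Z n x (params w b ω)‖ ^ 2 := by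
  have hθ : Measurable (params w b) := measurable_pi_lambda _ fun i => (hw i).prodMk (hb i)
  -- The index `none` stands for the evaluation point x itself, with coefficient 1.
  let c : Option (Fin d → Fin n) → (Fin N → Euc d × ℝ) → ℝ := fun j t =>
    match j with
    | none => 1
    | some j => -ridgeletCoeff phi psi S χ Z n x j t
  let y : Option (Fin d → Fin n) → Euc d := fun j =>
    match j with
    | none => x
    | some j => gridNode S n j
  set B := N * (|Z / N| * (|(2 * S) ^ d / ((n ^ d : ℕ) : ℝ)| * 1 * Bpsi) * Bphi)
  have hc : ∀ j, Measurable (c j) := fun j => by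
    cases j with
    | none => exact measurable_const
    | some j => exact (measurable_ridgeletCoeff hphi hpsi S χ Z n x j).neg
  have hB : ∀ j t, |c j t| ≤ max 1 B := fun j t => by
    cases j with
    | none => simp [c]
    | some j =>
      simp only [c, abs_neg]
      exact (abs_ridgeletCoeff_le hBphi hBpsi S hχ Z n x j t).trans (le_max_right _ _)
  have e1 : sqError phi psi S χ Z n w b f x =
      fun ω => (∑ j, c j (params w b ω) * f (y j) ω) ^ 2 := by
    funext ω
    rw [sqError, ridgeletOp_eq_sum, Fintype.sum_option]
    simp only [c, y, one_mul, neg_mul, Finset.sum_neg_distrib, ← sub_eq_add_neg]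
    rfl
  have e2 : ∀ t, ridgeletError (gpFeature hf) phi psi S χ Z n x t =
      ∑ j, c j t • gpFeature hf (y j) := by
    intro t
    rw [ridgeletError, Fintype.sum_option]
    simp only [c, y, one_smul, neg_smul, Finset.sum_neg_distrib, ← sub_eq_add_neg]
  rw [e1]
  simp only [e2]
  exact ⟨integrable_sq_sum hf hθ hc hB y, condExp_sq_sum hf hθ hind hc hB y⟩

end RidgeletError

/-! ### Fourier transforms -/

section Fourier

open scoped FourierTransform ComplexConjugate

/-- Passage from the unitary convention, with angular frequency, to the convention with 2π in the
exponent. -/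
theorem fourierU_eq_fourier {V : Type*} [NormedAddCommGroup V] [InnerProductSpace ℝ V]
    [FiniteDimensional ℝ V] [MeasurableSpace V] [BorelSpace V] (f : V → ℂ) (ξ : V) :
    fourierU f ξ = (((2 * Real.pi) ^ (-(Module.finrank ℝ V : ℝ) / 2) : ℝ) : ℂ) *
      𝓕 f ((2 * Real.pi)⁻¹ • ξ) := by
  rw [fourierU, Real.fourier_eq']
  congr 2
  funext x
  rw [real_inner_smul_right, smul_eq_mul, mul_comm (f x)]
  congr 2
  have : (Real.pi : ℂ) ≠ 0 := by exact_mod_cast Real.pi_ne_zero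
  rw [real_inner_comm]
  push_cast
  field_simp

theorem continuous_fourierR {V : Type*} [NormedAddCommGroup V] [InnerProductSpace ℝ V]
    [FiniteDimensional ℝ V] [MeasurableSpace V] [BorelSpace V] {p : V → ℝ} (hp : Integrable p) :
    Continuous (fourierR p) := by
  unfold fourierR fourierU
  refine continuous_const.mul (continuous_of_dominated (bound := fun x => ‖p x‖)
    (fun ξ => ?_) (fun ξ => Eventually.of_forall fun x => ?_) hp.norm
    (Eventually.of_forall fun x => by fun_prop))
  · exact hp.ofReal.aestronglyMeasurable.mul
      (Continuous.aestronglyMeasurable (by fun_prop))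
  · rw [norm_mul, Complex.norm_exp]
    simp

/-- A Schwartz function whose Fourier transform is a translate of `psi`. -/
theorem exists_schwartz_fourierU_eq_translate (psi : 𝓢(ℝ, ℝ)) (t : ℝ) :
    ∃ h : 𝓢(ℝ, ℂ), (∀ ξ : ℝ, h ξ = conj (fourierR (psi : ℝ → ℝ) ξ) *
        Complex.exp (Complex.I * (ξ * t : ℝ))) ∧
      ∀ b, fourierU (h : ℝ → ℂ) b = psi (b - t) := by
  have hpi : (0 : ℝ) < 2 * Real.pi := by positivity
  let g : 𝓢(ℝ, ℂ) := (psi.postcompCLM Complex.ofRealCLM).compSubConstCLM ℂ t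
  have hg : ∀ x, g x = (psi (x - t) : ℂ) := fun x => rfl
  let e : ℝ ≃L[ℝ] ℝ := ContinuousLinearEquiv.unitsEquivAut ℝ
    (Units.mk0 (2 * Real.pi)⁻¹ (inv_ne_zero hpi.ne'))
  have he : ∀ x, e x = (2 * Real.pi)⁻¹ * x := fun x => by
    simp [e, mul_comm]
  let c : ℝ := (2 * Real.pi) ^ (-(1 : ℝ) / 2)
  have hc : c * c = (2 * Real.pi)⁻¹ := by
    simp only [c]
    rw [← Real.rpow_add hpi, ← Real.rpow_neg_one]
    norm_num
  -- The inverse unitary transform of the translated function: dilation by (2π)⁻¹ and the factor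
  -- (2π)^(-1/2) convert between the two conventions.
  let h : 𝓢(ℝ, ℂ) := (c : ℂ) • SchwartzMap.compCLMOfContinuousLinearEquiv ℂ e (𝓕⁻ g)
  have hh : ∀ ξ, h ξ = c * 𝓕⁻ (g : ℝ → ℂ) ((2 * Real.pi)⁻¹ * ξ) := fun ξ => by
    rw [← he, ← SchwartzMap.fourierInv_coe]; rfl
  refine ⟨h, fun ξ => ?_, fun b => ?_⟩
  · rw [hh, fourierR, fourierU, Real.fourierInv_eq', map_mul, Complex.conj_ofReal,
      ← integral_conj, mul_assoc]
    have hcc : (((2 * Real.pi) ^ (-(Module.finrank ℝ ℝ : ℝ) / 2) : ℝ) : ℂ) = c := by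
      simp [c]
    rw [hcc]
    congr 1
    rw [← integral_mul_const]
    refine Eq.trans ?_ (integral_sub_right_eq_self _ t)
    refine integral_congr_ae (Eventually.of_forall fun x => ?_)
    simp only [hg, map_mul, Complex.conj_ofReal, ← Complex.exp_conj, smul_eq_mul]
    rw [mul_assoc (psi (x - t) : ℂ), ← Complex.exp_add, mul_comm]
    congr 2
    have : (Real.pi : ℂ) ≠ 0 := by exact_mod_cast Real.pi_ne_zero
    simp
    field_simp
    ring
  · rw [fourierU_eq_fourier]
    have hcc : (((2 * Real.pi) ^ (-(Module.finrank ℝ ℝ : ℝ) / 2) : ℝ) : ℂ) = c := by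
      simp [c]
    rw [hcc]
    have h1 : 𝓕 (𝓕⁻ (g : ℝ → ℂ)) b = g b :=
      congrFun (g.continuous.fourier_fourierInv_eq g.integrable (𝓕 g).integrable) b
    rw [← hg, ← h1, Real.fourier_real_eq_integral_exp_smul,
      Real.fourier_real_eq_integral_exp_smul]
    have h2 := Measure.integral_comp_mul_left
      (fun v : ℝ => Complex.exp (↑(-2 * Real.pi * v * b) * Complex.I) • 𝓕⁻ (g : ℝ → ℂ) v)
      (2 * Real.pi)⁻¹
    rw [inv_inv, abs_of_pos hpi] at h2
    have h3 : ∀ x : ℝ, Complex.exp (↑(-2 * Real.pi * x * ((2 * Real.pi)⁻¹ • b)) * Complex.I) • h x =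
        c * (Complex.exp (↑(-2 * Real.pi * ((2 * Real.pi)⁻¹ * x) * b) * Complex.I) •
          𝓕⁻ (g : ℝ → ℂ) ((2 * Real.pi)⁻¹ * x)) := by
      intro x
      rw [hh]
      have : -2 * Real.pi * x * ((2 * Real.pi)⁻¹ • b) =
          -2 * Real.pi * ((2 * Real.pi)⁻¹ * x) * b := by rw [smul_eq_mul]; ring
      rw [this]
      simp only [smul_eq_mul]
      ring
    simp_rw [h3]
    rw [integral_const_mul, h2, ← mul_assoc, ← Complex.ofReal_mul, hc, Complex.real_smul,
      ← mul_assoc, ← Complex.ofReal_mul, inv_mul_cancel₀ hpi.ne', Complex.ofReal_one, one_mul]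

/-- The product of the Fourier transforms of the activation function and of `psi`. -/
noncomputable def spectral (phihat : ℝ → ℂ) (psi : 𝓢(ℝ, ℝ)) (ξ : ℝ) : ℂ :=
  conj (fourierR (psi : ℝ → ℝ) ξ) * phihat ξ

variable {d : ℕ} {phi : ℝ → ℝ} {phihat : ℝ → ℂ} {psi : 𝓢(ℝ, ℝ)}

/-- The defining pairing of φ̂, tested against a Schwartz function whose transform is a translate of
ψ. The modulation factor has modulus one, so the vanishing order of ψ̂ at 0 makes it an admissible
test function. This is the bridge from φ to φ̂. -/
theorem integral_mul_translate_eq (hact : IsActivationPair d phi phihat psi) (t : ℝ) :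
    Integrable (fun ξ : ℝ => spectral phihat psi ξ * Complex.exp (Complex.I * (ξ * t : ℝ))) ∧
    ((∫ s, psi s * phi (s + t) : ℝ) : ℂ) =
      ∫ ξ : ℝ, spectral phihat psi ξ * Complex.exp (Complex.I * (ξ * t : ℝ)) := by
  obtain ⟨m, hm, hO⟩ := hact.fourier
  obtain ⟨h, h1, h2⟩ := exists_schwartz_fourierU_eq_translate psi t
  have hhO : (h : ℝ → ℂ) =O[𝓝 0] (fun x : ℝ => |x| ^ (2 * m)) := by
    refine Asymptotics.IsBigO.trans (Asymptotics.IsBigO.of_bound 1 (Eventually.of_forall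
      fun ξ => ?_)) hO
    rw [h1, norm_mul, Complex.norm_exp, RCLike.norm_conj]
    simp
  obtain ⟨hi, he⟩ := hm.pairing h hhO
  have h3 : (fun w => phihat w * h w) =
      fun ξ : ℝ => spectral phihat psi ξ * Complex.exp (Complex.I * (ξ * t : ℝ)) := by
    funext ξ; rw [h1, spectral]; ring
  rw [h3] at hi he
  refine ⟨hi, ?_⟩
  rw [he, ← integral_complex_ofReal, ← integral_sub_right_eq_self _ t]
  refine integral_congr_ae (Eventually.of_forall fun x => ?_)
  simp only [h2, sub_add_cancel]
  push_cast
  ring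

theorem integrable_spectral (hact : IsActivationPair d phi phihat psi) :
    Integrable (spectral phihat psi) := by
  simpa using (integral_mul_translate_eq hact 0).1

/-- All intermediate weights are dominated by the two extremes, since |ξ|^(-j) ≤ 1 + |ξ|^(-(d+2)).
-/
theorem integrable_spectral_div (hact : IsActivationPair d phi phihat psi) {j : ℕ}
    (hj : j ≤ d + 2) : Integrable fun ξ => (|ξ| ^ j)⁻¹ * ‖spectral phihat psi ξ‖ := by
  have h0 := integrable_spectral hact
  refine (h0.norm.add hact.integrable).mono' ?_ (Eventually.of_forall fun ξ => ?_)
  · exact (Measurable.aestronglyMeasurable (by fun_prop)).mul h0.aestronglyMeasurable.norm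
  · rw [Real.norm_eq_abs, abs_of_nonneg (by positivity)]
    change _ ≤ ‖spectral phihat psi ξ‖ + (|ξ| ^ (d + 2))⁻¹ * ‖spectral phihat psi ξ‖
    rw [← one_add_mul]
    gcongr
    rcases le_total 1 |ξ| with h | h
    · have : (|ξ| ^ j)⁻¹ ≤ 1 := inv_le_one_of_one_le₀ (one_le_pow₀ h)
      have : 0 ≤ (|ξ| ^ (d + 2))⁻¹ := by positivity
      linarith
    · rcases (abs_nonneg ξ).eq_or_lt with h' | h'
      · rw [← h']
        rcases Nat.eq_zero_or_pos j with rfl | hj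
        -- At ξ = 0 the inverse is 0 by convention, so the inequality survives.
        · simp
        · rw [zero_pow hj.ne']; simp
      · have := inv_anti₀ (by positivity) (pow_le_pow_of_le_one h'.le h hj)
        linarith

/-- Since p̂_w is real, only the real part of the spectral function meets the kernel, and the
complex normalisation may be replaced by its real part. -/
theorem integral_spectral_re (hact : IsActivationPair d phi phihat psi) :
    (2 * Real.pi) ^ ((d : ℝ) / 2) * ∫ ξ, (|ξ| ^ d)⁻¹ * (spectral phihat psi ξ).re = 1 := by
  have h := congrArg Complex.re hact.normalized
  rw [Complex.re_ofReal_mul, Complex.one_re] at h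
  rw [← h]
  congr 1
  have hi : Integrable fun ξ : ℝ => (((|ξ| ^ d)⁻¹ : ℝ) : ℂ) * spectral phihat psi ξ := by
    refine (integrable_spectral_div hact (j := d) (by omega)).congr' ?_
      (Eventually.of_forall fun ξ => ?_)
    · exact (Measurable.aestronglyMeasurable (by fun_prop)).mul
        (integrable_spectral hact).aestronglyMeasurable
    · rw [norm_mul, norm_mul, norm_norm, Complex.norm_real]
  have := integral_re hi
  simp only [RCLike.re_eq_complex_re] at this
  change _ = (∫ ξ : ℝ, (((|ξ| ^ d)⁻¹ : ℝ) : ℂ) * spectral phihat psi ξ).re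
  rw [← this]
  simp only [Complex.re_ofReal_mul]

end Fourier

/-! ### Densities with positive Fourier transform -/

section Densities

open scoped FourierTransform

variable {V : Type*} [NormedAddCommGroup V] [InnerProductSpace ℝ V] [FiniteDimensional ℝ V]
  [MeasurableSpace V] [BorelSpace V] {p : V → ℝ}

/-- A non-integrable function would have integral 0 by convention, not 1. -/
theorem IsRegularDensity.integrable (hp : IsRegularDensity p) : Integrable p := by
  by_contra h
  have := hp.integral_eq_one
  rw [integral_undef h] at this
  norm_num at this

theorem IsRegularDensity.norm_fourierR (hp : IsRegularDensity p) (x : V) :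
    ‖fourierR p x‖ = (fourierR p x).re := by
  have h := hp.fourier_pos x
  have : fourierR p x = ((fourierR p x).re : ℂ) := Complex.ext rfl (by simp [h.1])
  rw [this, Complex.norm_real, Complex.ofReal_re, Real.norm_eq_abs, abs_of_pos h.2]

theorem IsRegularDensity.integral_norm_fourierR_pos (hp : IsRegularDensity p) :
    0 < ∫ x, ‖fourierR p x‖ := by
  rw [integral_pos_iff_support_of_nonneg (fun x => norm_nonneg _) hp.fourier_integrable.norm]
  have : (Function.support fun x => ‖fourierR p x‖) = Set.univ := by
    ext x
    simp only [Function.mem_support, Set.mem_univ, iff_true, hp.norm_fourierR]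
    exact (hp.fourier_pos x).2.ne'
  rw [this]
  exact Measure.measure_univ_pos.2 (NeZero.ne _)

/-- Fourier inversion at 0, with positivity making the modulus harmless. It identifies the factor in
Z with p_b(0), the value to which the rescaled density p_b(b/σ_b) flattens. -/
theorem integral_norm_fourierR_real {p : ℝ → ℝ} (hp : IsRegularDensity p) (hcont : Continuous p) :
    ∫ x, ‖fourierR p x‖ = (2 * Real.pi) ^ ((1 : ℝ) / 2) * p 0 := by
  have hpi : (0 : ℝ) < 2 * Real.pi := by positivity
  set c : ℝ := (2 * Real.pi) ^ ((1 : ℝ) / 2) with hc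
  have hc0 : 0 < c := by positivity
  have hcc : c * c = 2 * Real.pi := by
    rw [hc, ← Real.rpow_add hpi]; norm_num
  have h1 : ∀ v, 𝓕 (fun x => (p x : ℂ)) v = c * fourierR p (2 * Real.pi * v) := fun v => by
    rw [fourierR, fourierU_eq_fourier, smul_eq_mul, inv_mul_cancel_left₀ hpi.ne', ← mul_assoc,
      ← Complex.ofReal_mul]
    have : c * (2 * Real.pi) ^ (-(Module.finrank ℝ ℝ : ℝ) / 2) = 1 := by
      rw [hc, ← Real.rpow_add hpi]; norm_num
    rw [this, Complex.ofReal_one, one_mul]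
  have hi : Integrable (𝓕 fun x => (p x : ℂ)) := by
    rw [funext h1]
    exact ((integrable_comp_mul_left_iff _ hpi.ne').2 hp.fourier_integrable).const_mul _
  have h2 := hp.integrable.ofReal (𝕜 := ℂ) |>.fourierInv_fourier_eq hi (v := 0)
    (Complex.continuous_ofReal.comp hcont).continuousAt
  rw [Real.fourierInv_eq'] at h2
  simp only [inner_zero_right, mul_zero, Complex.ofReal_zero, zero_mul, Complex.exp_zero,
    one_smul] at h2
  change ∫ v, 𝓕 (fun x => (p x : ℂ)) v = (p 0 : ℂ) at h2
  rw [integral_congr_ae (Eventually.of_forall h1), integral_const_mul, Measure.integral_comp_mul_left, abs_of_pos (by positivity),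
    Complex.real_smul, ← mul_assoc, ← Complex.ofReal_mul] at h2
  have h3 : c * (2 * Real.pi)⁻¹ = c⁻¹ := by rw [← hcc]; field_simp
  rw [h3] at h2
  have h4 := congrArg Complex.re h2
  rw [Complex.re_ofReal_mul] at h4
  have h5 := integral_re hp.fourier_integrable
  simp only [RCLike.re_eq_complex_re] at h5
  rw [← h5] at h4
  simp_rw [hp.norm_fourierR]
  change c⁻¹ * _ = p 0 at h4
  rw [← h4, mul_inv_cancel_left₀ hc0.ne']

end Densities

/-! ### The kernel of the dual ridgelet transform is an approximate identity -/

section ApproxIdentity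

open scoped ComplexConjugate

variable {d : ℕ} {phi : ℝ → ℝ} {phihat : ℝ → ℂ} {psi : 𝓢(ℝ, ℝ)} {pw : Euc d → ℝ}

/-- Fubini: averaging exp(iξ v·u) over the density gives its Fourier transform at -ξu, which is
real. The kernel is thus a superposition of dilates of p̂_w. -/
theorem integral_density_mul_translate (hact : IsActivationPair d phi phihat psi)
    (hp : IsRegularDensity pw) (u : Euc d) :
    ∫ v, pw v * ∫ s, psi s * phi (s + inner ℝ v u) =
      (2 * Real.pi) ^ ((d : ℝ) / 2) *
        ∫ ξ : ℝ, (spectral phihat psi ξ).re * (fourierR pw (ξ • -u)).re := by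
  have hpi : (0 : ℝ) < 2 * Real.pi := by positivity
  set c : ℝ := (2 * Real.pi) ^ ((d : ℝ) / 2) with hc
  have hsp := integrable_spectral hact
  have hF : ∀ ξ : ℝ, ∫ v, (pw v : ℂ) * Complex.exp (Complex.I * (ξ * inner ℝ v u : ℝ)) =
      c * fourierR pw (ξ • -u) := fun ξ => by
    rw [fourierR, fourierU, ← mul_assoc, ← Complex.ofReal_mul]
    have : c * (2 * Real.pi) ^ (-(Module.finrank ℝ (Euc d) : ℝ) / 2) = 1 := by
      rw [hc, ← Real.rpow_add hpi, finrank_euclideanSpace_fin]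
      rw [neg_div, add_neg_cancel, Real.rpow_zero]
    rw [this, Complex.ofReal_one, one_mul]
    refine integral_congr_ae (Eventually.of_forall fun v => ?_)
    simp only
    congr 2
    rw [real_inner_smul_left, inner_neg_left, real_inner_comm]
    push_cast
    ring
  have hprod : Integrable (fun z : Euc d × ℝ => (pw z.1 : ℂ) * (spectral phihat psi z.2 *
      Complex.exp (Complex.I * (z.2 * inner ℝ z.1 u : ℝ)))) (volume.prod volume) := by
    have h1 := (hp.integrable.ofReal (𝕜 := ℂ)).mul_prod hsp
    refine h1.congr' ?_ (Eventually.of_forall fun z => ?_)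
    · have h2 : AEStronglyMeasurable (fun z : Euc d × ℝ =>
          Complex.exp (Complex.I * (z.2 * inner ℝ z.1 u : ℝ))) (volume.prod volume) :=
        Continuous.aestronglyMeasurable (by fun_prop)
      refine (h1.aestronglyMeasurable.mul h2).congr (Eventually.of_forall fun z => ?_)
      simp only [Pi.mul_apply]
      exact mul_assoc _ _ _
    · rw [norm_mul, norm_mul, norm_mul, Complex.norm_exp]
      simp
  have hcomplex : ((∫ v, pw v * ∫ s, psi s * phi (s + inner ℝ v u) : ℝ) : ℂ) =
      ∫ ξ : ℝ, spectral phihat psi ξ * (c * fourierR pw (ξ • -u)) := by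
    rw [← integral_complex_ofReal]
    simp_rw [Complex.ofReal_mul, (integral_mul_translate_eq hact _).2, ← integral_const_mul]
    rw [integral_integral_swap hprod]
    refine integral_congr_ae (Eventually.of_forall fun ξ => ?_)
    simp only [← hF, ← integral_const_mul]
    refine integral_congr_ae (Eventually.of_forall fun v => ?_)
    simp only
    ring
  have hint : Integrable fun ξ : ℝ => spectral phihat psi ξ * (c * fourierR pw (ξ • -u)) := by
    refine hprod.integral_prod_right.congr (Eventually.of_forall fun ξ => ?_)
    simp only [← hF, ← integral_const_mul]
    refine integral_congr_ae (Eventually.of_forall fun v => ?_)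
    simp only
    ring
  have h3 := integral_re hint
  simp only [RCLike.re_eq_complex_re] at h3
  have h4 := congrArg Complex.re hcomplex
  rw [Complex.ofReal_re, ← h3] at h4
  rw [h4, ← integral_const_mul]
  refine integral_congr_ae (Eventually.of_forall fun ξ => ?_)
  simp only
  have : fourierR pw (ξ • -u) = ((fourierR pw (ξ • -u)).re : ℂ) :=
    Complex.ext rfl ((hp.fourier_pos (ξ • -u)).1.trans (Complex.ofReal_im _).symm)
  rw [this, ← Complex.ofReal_mul, Complex.re_mul_ofReal, Complex.ofReal_re]
  ring

/-- Integrals over dilations, weighted by a function of the scale. -/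
theorem integral_dilation {r : ℝ → ℝ} (hr : AEStronglyMeasurable r)
    (hri : Integrable fun ξ => (|ξ| ^ d)⁻¹ * |r ξ|) {g : Euc d → ℝ} (hg : Continuous g)
    (hgi : Integrable g) {σ : ℝ} (hσ : 0 < σ) :
    Integrable (fun z : Euc d × ℝ => r z.2 * g ((z.2 * σ) • z.1)) (volume.prod volume) ∧
    ∫ z : Euc d × ℝ, r z.2 * g ((z.2 * σ) • z.1) ∂(volume.prod volume) =
      (σ ^ d)⁻¹ * (∫ ξ, (|ξ| ^ d)⁻¹ * r ξ) * ∫ y, g y := by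
  have hmeas : AEStronglyMeasurable (fun z : Euc d × ℝ => r z.2 * g ((z.2 * σ) • z.1))
      (volume.prod volume) :=
    hr.comp_snd.mul (Continuous.aestronglyMeasurable (by fun_prop))
  have hsc : ∀ (g : Euc d → ℝ) (ξ : ℝ), ∫ y, g ((ξ * σ) • y) =
      (σ ^ d)⁻¹ * ((|ξ| ^ d)⁻¹ * ∫ y, g y) := fun g ξ => by
    rw [Measure.integral_comp_smul, finrank_euclideanSpace_fin, abs_inv, abs_pow, abs_mul,
      abs_of_pos hσ, mul_pow, mul_inv, smul_eq_mul]
    ring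
  -- Dilation by ξσ is invertible only off the null set {0}.
  have h0 : ∀ᵐ ξ : ℝ, ξ ≠ 0 := by
    simp [ae_iff]
  have hint : Integrable (fun z : Euc d × ℝ => r z.2 * g ((z.2 * σ) • z.1))
      (volume.prod volume) := by
    rw [integrable_prod_iff' hmeas]
    refine ⟨?_, ?_⟩
    · filter_upwards [h0] with ξ hξ
      exact ((integrable_comp_smul_iff volume g (mul_ne_zero hξ hσ.ne')).2 hgi).const_mul _
    · refine (hri.const_mul ((σ ^ d)⁻¹ * ∫ y, ‖g y‖)).congr (Eventually.of_forall fun ξ => ?_)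
      simp only [norm_mul, integral_const_mul]
      rw [hsc fun y => ‖g y‖, Real.norm_eq_abs]
      ring
  refine ⟨hint, ?_⟩
  rw [integral_prod_symm _ hint, mul_assoc, ← integral_mul_const, ← integral_const_mul]
  refine integral_congr_ae (Eventually.of_forall fun ξ => ?_)
  simp only
  rw [integral_const_mul, hsc g]
  ring

/-- The kernel of the composition of the ridgelet transform and its dual, without the bandwidth
of the biases, up to a normalising constant. -/
noncomputable def dualKernel (phihat : ℝ → ℂ) (psi : 𝓢(ℝ, ℝ)) (pw : Euc d → ℝ) (σ : ℝ)
    (y : Euc d) : ℝ :=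
  ∫ ξ : ℝ, (spectral phihat psi ξ).re * (fourierR pw ((ξ * σ) • y)).re

/-- The dual ridgelet transform reproduces Lipschitz functions up to an error of order `1 / σ`. -/
theorem exists_norm_sub_dualKernel_le (hact : IsActivationPair d phi phihat psi)
    (hp : IsRegularDensity pw)
    (hp2 : Integrable (fun x => ((‖x‖ ^ 2 : ℝ) : ℂ) * fourierR pw x)) :
    ∃ C : ℝ, 0 ≤ C ∧ ∀ {H : Type*} [NormedAddCommGroup H] [InnerProductSpace ℝ H]
      [CompleteSpace H] (G : Euc d → H) (M K σ : ℝ), Continuous G → (∀ x, ‖G x‖ ≤ M) →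
      (∀ x y, ‖G y - G x‖ ≤ K * ‖y - x‖) → 0 < σ → ∀ x,
      ‖G x - (σ ^ d * (2 * Real.pi) ^ ((d : ℝ) / 2) / ∫ x, ‖fourierR pw x‖) •
        ∫ y, dualKernel phihat psi pw σ y • G (x + y)‖ ≤ C * K / σ := by
  set I := ∫ x, ‖fourierR pw x‖ with hI
  have hI0 : 0 < I := hp.integral_norm_fourierR_pos
  set c : ℝ := (2 * Real.pi) ^ ((d : ℝ) / 2) with hc
  have hc0 : 0 < c := by positivity
  set J := ∫ x, ‖x‖ * (fourierR pw x).re with hJ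
  set ρ : ℝ → ℝ := fun ξ => (spectral phihat psi ξ).re with hρ
  set g : Euc d → ℝ := fun y => (fourierR pw y).re with hg
  have hg0 : ∀ y, 0 < g y := fun y => (hp.fourier_pos y).2
  have hgc : Continuous g := Complex.continuous_re.comp (continuous_fourierR hp.integrable)
  have hgi : Integrable g := hp.fourier_integrable.re
  have hgI : ∫ y, g y = I := by simp only [hI, hp.norm_fourierR, hg]
  have hg2i : Integrable fun y => ‖y‖ * g y := by
    refine (hgi.add hp2.norm).mono' (continuous_norm.mul hgc).aestronglyMeasurable
      (Eventually.of_forall fun y => ?_)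
    rw [norm_mul, norm_norm, Real.norm_eq_abs, abs_of_pos (hg0 y), Pi.add_apply, norm_mul,
      Complex.norm_real, hp.norm_fourierR, Real.norm_eq_abs, abs_of_nonneg (by positivity)]
    change _ ≤ g y + ‖y‖ ^ 2 * g y
    nlinarith [sq_nonneg (‖y‖ - 1), hg0 y, norm_nonneg y]
  have hρm : AEStronglyMeasurable ρ := (integrable_spectral hact).re.aestronglyMeasurable
  have habs : ∀ ξ, |ρ ξ| ≤ ‖spectral phihat psi ξ‖ := fun ξ => Complex.abs_re_le_norm _
  have hpow : ∀ j, Measurable fun ξ : ℝ => (|ξ| ^ j)⁻¹ := fun j => by fun_prop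
  have hρd : ∀ j, j ≤ d + 2 → Integrable fun ξ => (|ξ| ^ j)⁻¹ * |ρ ξ| := fun j hj => by
    refine (integrable_spectral_div hact hj).mono'
      ((hpow j).aestronglyMeasurable.mul hρm.norm) (Eventually.of_forall fun ξ => ?_)
    rw [Real.norm_eq_abs, abs_of_nonneg (by positivity)]
    gcongr
    exact habs ξ
  have hJ0 : 0 ≤ J := integral_nonneg fun y => mul_nonneg (norm_nonneg _) (hg0 y).le
  set E := ∫ ξ, (|ξ| ^ (d + 1))⁻¹ * |ρ ξ| with hE
  have hE0 : 0 ≤ E := integral_nonneg fun ξ => by positivity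
  refine ⟨c / I * E * J, by positivity, ?_⟩
  intro H _ _ _ G M K σ hG hM hK hσ x
  obtain ⟨hQi, hQ⟩ := integral_dilation hρm (hρd d (by omega)) hgc hgi hσ
  -- The rescaled kernel has total mass one, by the normalisation of the pair.
  have hnorm : σ ^ d * c / I * ∫ z : Euc d × ℝ, ρ z.2 * g ((z.2 * σ) • z.1)
      ∂(volume.prod volume) = 1 := by
    have h1 := integral_spectral_re hact
    rw [hQ, hgI]
    calc _ = c * ∫ ξ, (|ξ| ^ d)⁻¹ * ρ ξ := by field_simp
      _ = 1 := h1
  have hQG : Integrable (fun z : Euc d × ℝ => (ρ z.2 * g ((z.2 * σ) • z.1)) • G (x + z.1))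
      (volume.prod volume) := by
    refine (hQi.norm.mul_const M).mono' (hQi.aestronglyMeasurable.smul
      (Continuous.aestronglyMeasurable (by fun_prop))) (Eventually.of_forall fun z => ?_)
    rw [norm_smul]
    exact mul_le_mul_of_nonneg_left (hM _) (norm_nonneg _)
  have hker : ∫ y, dualKernel phihat psi pw σ y • G (x + y) =
      ∫ z : Euc d × ℝ, (ρ z.2 * g ((z.2 * σ) • z.1)) • G (x + z.1) ∂(volume.prod volume) := by
    rw [integral_prod _ hQG]
    refine integral_congr_ae (Eventually.of_forall fun y => ?_)
    simp only [integral_smul_const]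
    rfl
  have hdiff : G x - (σ ^ d * c / I) • ∫ y, dualKernel phihat psi pw σ y • G (x + y) =
      (σ ^ d * c / I) • ∫ z : Euc d × ℝ, (ρ z.2 * g ((z.2 * σ) • z.1)) • (G x - G (x + z.1))
        ∂(volume.prod volume) := by
    simp_rw [smul_sub]
    rw [integral_sub (hQi.smul_const _) hQG, integral_smul_const, smul_sub, smul_smul, hnorm,
      one_smul, hker]
  rw [hdiff, norm_smul, Real.norm_eq_abs, abs_of_pos (by positivity)]
  -- the first moment
  have hr1m : AEStronglyMeasurable (fun ξ => (|ξ| ^ 1)⁻¹ * |ρ ξ|) :=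
    (hpow 1).aestronglyMeasurable.mul hρm.norm
  have hpowd : ∀ ξ : ℝ, (|ξ| ^ d)⁻¹ * ((|ξ| ^ 1)⁻¹ * |ρ ξ|) = (|ξ| ^ (d + 1))⁻¹ * |ρ ξ| :=
    fun ξ => by rw [pow_add, mul_inv, mul_assoc]
  obtain ⟨hWi, hW⟩ := integral_dilation (d := d) (g := fun y => ‖y‖ * g y) hr1m
    (by
      refine (hρd (d + 1) (by omega)).congr (Eventually.of_forall fun ξ => ?_)
      simp only
      rw [← hpowd, abs_of_nonneg (by positivity : 0 ≤ (|ξ| ^ 1)⁻¹ * |ρ ξ|)])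
    (continuous_norm.mul hgc) hg2i hσ
  simp only [hpowd] at hW
  have h0 : ∀ᵐ z : Euc d × ℝ ∂(volume.prod volume), z.2 ≠ 0 := by
    have : ∀ᵐ ξ : ℝ, ξ ≠ 0 := by simp [ae_iff]
    exact Measure.quasiMeasurePreserving_snd.ae this
  -- On each dilate ‖y‖ = ‖ξσy‖ / (|ξ|σ). The gain 1/σ costs one more negative power of |ξ| and a
  -- first moment of p̂_w, both available.
  have hbound : ‖∫ z : Euc d × ℝ, (ρ z.2 * g ((z.2 * σ) • z.1)) • (G x - G (x + z.1))
        ∂(volume.prod volume)‖ ≤ K / σ * ∫ z : Euc d × ℝ, (|z.2| ^ 1)⁻¹ * |ρ z.2| *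
          (‖(z.2 * σ) • z.1‖ * g ((z.2 * σ) • z.1)) ∂(volume.prod volume) := by
    rw [← integral_const_mul]
    refine norm_integral_le_of_norm_le (hWi.const_mul _) ?_
    filter_upwards [h0] with z hz
    rw [norm_smul, norm_mul, Real.norm_eq_abs, Real.norm_eq_abs, abs_of_pos (hg0 _), norm_smul,
      norm_mul, Real.norm_eq_abs, Real.norm_eq_abs, abs_of_pos hσ, pow_one]
    have h1 : ‖G x - G (x + z.1)‖ ≤ K * ‖z.1‖ := by
      have := hK (x + z.1) x
      rwa [sub_add_cancel_left, norm_neg] at this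
    have hz' : |z.2| ≠ 0 := abs_ne_zero.2 hz
    calc _ ≤ |ρ z.2| * g ((z.2 * σ) • z.1) * (K * ‖z.1‖) := by
          gcongr
          exact mul_nonneg (abs_nonneg _) (hg0 _).le
      _ = _ := by field_simp
  rw [hW] at hbound
  calc _ ≤ σ ^ d * c / I * (K / σ * ((σ ^ d)⁻¹ * E * J)) := by gcongr
    _ = _ := by field_simp

end ApproxIdentity

/-! ### The law of the weights and biases -/

section ScaledLaw

variable {V : Type*} [NormedAddCommGroup V] [InnerProductSpace ℝ V] [FiniteDimensional ℝ V]
  [MeasurableSpace V] [BorelSpace V] {p : V → ℝ} {σ : ℝ}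

/-- The law with density `scaledDensity σ p`. -/
noncomputable def scaledLaw (σ : ℝ) (p : V → ℝ) : Measure V :=
  volume.withDensity fun x => ENNReal.ofReal (scaledDensity σ p x)

theorem IsRegularDensity.measurable_scaledDensity (hp : IsRegularDensity p) (σ : ℝ) :
    Measurable (scaledDensity σ p) :=
  (hp.measurable.comp (measurable_const_smul σ⁻¹)).const_mul _

theorem IsRegularDensity.scaledDensity_nonneg (hp : IsRegularDensity p) (hσ : 0 < σ) (x : V) :
    0 ≤ scaledDensity σ p x :=
  mul_nonneg (by positivity) (hp.nonneg _)

theorem scaledDensity_integral_smul {E : Type*} [NormedAddCommGroup E] [NormedSpace ℝ E]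
    (hσ : 0 < σ) (p : V → ℝ) (g : V → E) :
    ∫ x, scaledDensity σ p x • g x = ∫ v, p v • g (σ • v) := by
  have h := Measure.integral_comp_smul (volume : Measure V) (fun x => p (σ⁻¹ • x) • g x) σ
  simp only [inv_smul_smul₀ hσ.ne'] at h
  rw [h, ← integral_smul, abs_of_pos (by positivity)]
  simp only [scaledDensity, mul_smul]

theorem integrable_scaledDensity_smul {E : Type*} [NormedAddCommGroup E] [NormedSpace ℝ E]
    (hσ : 0 < σ) {p : V → ℝ} {g : V → E} (h : Integrable fun v => p v • g (σ • v)) :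
    Integrable fun x => scaledDensity σ p x • g x := by
  have h1 := (integrable_comp_smul_iff (volume : Measure V) (fun x => p (σ⁻¹ • x) • g x)
    hσ.ne').1 (by simpa only [inv_smul_smul₀ hσ.ne'] using h)
  simp only [scaledDensity, mul_smul]
  exact h1.smul ((σ ^ Module.finrank ℝ V)⁻¹ : ℝ)

theorem IsRegularDensity.integral_scaledLaw {E : Type*} [NormedAddCommGroup E] [NormedSpace ℝ E]
    (hp : IsRegularDensity p) (hσ : 0 < σ) (g : V → E) :
    ∫ x, g x ∂(scaledLaw σ p) = ∫ v, p v • g (σ • v) := by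
  rw [scaledLaw, integral_withDensity_eq_integral_toReal_smul
    (hp.measurable_scaledDensity σ).ennreal_ofReal (Eventually.of_forall fun _ =>
      ENNReal.ofReal_lt_top), ← scaledDensity_integral_smul hσ]
  simp only [ENNReal.toReal_ofReal (hp.scaledDensity_nonneg hσ _)]

theorem IsRegularDensity.integrable_scaledLaw {E : Type*} [NormedAddCommGroup E]
    [NormedSpace ℝ E] (hp : IsRegularDensity p) (hσ : 0 < σ) {g : V → E}
    (h : Integrable fun v => p v • g (σ • v)) : Integrable g (scaledLaw σ p) := by
  rw [scaledLaw, integrable_withDensity_iff_integrable_smul'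
    (hp.measurable_scaledDensity σ).ennreal_ofReal (Eventually.of_forall fun _ =>
      ENNReal.ofReal_lt_top)]
  simp only [ENNReal.toReal_ofReal (hp.scaledDensity_nonneg hσ _)]
  exact integrable_scaledDensity_smul hσ h

theorem IsRegularDensity.isProbabilityMeasure_scaledLaw (hp : IsRegularDensity p) (hσ : 0 < σ) :
    IsProbabilityMeasure (scaledLaw σ p) := by
  constructor
  have hi : Integrable (scaledDensity σ p) := by
    have := integrable_scaledDensity_smul (g := fun _ : V => (1 : ℝ)) hσ
      (by simpa using hp.integrable)
    simpa using this
  have h1 : ∫ x, scaledDensity σ p x = 1 := by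
    have := scaledDensity_integral_smul hσ p (fun _ : V => (1 : ℝ))
    simpa [hp.integral_eq_one] using this
  rw [scaledLaw, withDensity_apply _ MeasurableSet.univ, Measure.restrict_univ,
    ← ofReal_integral_eq_lintegral_ofReal hi (Eventually.of_forall (hp.scaledDensity_nonneg hσ)),
    h1, ENNReal.ofReal_one]

theorem IsRegularDensity.integrable_norm_mul (hp : IsRegularDensity p) :
    Integrable fun x => ‖x‖ * p x := by
  refine (hp.integrable.add hp.secondMoment).mono'
    (continuous_norm.measurable.mul hp.measurable).aestronglyMeasurable
    (Eventually.of_forall fun x => ?_)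
  rw [norm_mul, norm_norm, Real.norm_eq_abs, abs_of_nonneg (hp.nonneg x), Pi.add_apply]
  nlinarith [sq_nonneg (‖x‖ - 1), hp.nonneg x, norm_nonneg x]

/-- For continuous p the set where the essential bound fails is open and null, hence empty. -/
theorem IsRegularDensity.exists_bound (hp : IsRegularDensity p) (hc : Continuous p) :
    ∃ B, 0 ≤ B ∧ ∀ x, p x ≤ B := by
  have hae : ∀ᵐ x, ‖p x‖ₑ ≤ eLpNorm p ∞ volume := by
    rw [eLpNorm_exponent_top]; exact ae_le_eLpNormEssSup
  set B := (eLpNorm p ∞ volume).toReal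
  refine ⟨B, ENNReal.toReal_nonneg, ?_⟩
  have hopen : IsOpen {x | B < p x} := isOpen_lt continuous_const hc
  have hnull : volume {x | B < p x} = 0 := by
    refine measure_mono_null (fun x hx => ?_) (ae_iff.1 hae)
    simp only [Set.mem_ofPred_eq] at *
    intro hle
    have h2 := ENNReal.toReal_mono hp.bounded.ne hle
    rw [toReal_enorm, Real.norm_eq_abs, abs_of_nonneg (hp.nonneg x)] at h2
    exact absurd h2 (not_le.2 hx)
  have hempty := (hopen.measure_eq_zero_iff volume).1 hnull
  intro x
  by_contra hx
  have : x ∈ {x | B < p x} := not_le.1 hx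
  rw [hempty] at this
  exact this

end ScaledLaw

/-! ### The mean kernel and the flattening of the bias density -/

section MeanKernel

variable {d : ℕ} {phi : ℝ → ℝ} {phihat : ℝ → ℂ} {psi : 𝓢(ℝ, ℝ)} {pw : Euc d → ℝ} {pb : ℝ → ℝ}

theorem paramLaw_eq (pw : Euc d → ℝ) (pb : ℝ → ℝ) (σw σb : ℝ) :
    paramLaw pw pb σw σb = (scaledLaw σw pw).prod (scaledLaw σb pb) := rfl

theorem isProbabilityMeasure_paramLaw (hp : IsBandwidthPair pw pb) {σw σb : ℝ} (hw : 0 < σw)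
    (hb : 0 < σb) : IsProbabilityMeasure (paramLaw pw pb σw σb) := by
  have := hp.regular_w.isProbabilityMeasure_scaledLaw hw
  have := hp.regular_b.isProbabilityMeasure_scaledLaw hb
  rw [paramLaw_eq]
  infer_instance

theorem integrable_paramLaw_fst (hp : IsBandwidthPair pw pb) {σw σb : ℝ} (hw : 0 < σw)
    (hb : 0 < σb) {E : Type*} [NormedAddCommGroup E] [NormedSpace ℝ E] {g : Euc d → E}
    (h : Integrable fun v => pw v • g (σw • v)) :
    Integrable (fun t : Euc d × ℝ => g t.1) (paramLaw pw pb σw σb) := by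
  have := hp.regular_b.isProbabilityMeasure_scaledLaw hb
  rw [paramLaw_eq]
  exact (hp.regular_w.integrable_scaledLaw hw h).comp_fst _

theorem integral_paramLaw_fst (hp : IsBandwidthPair pw pb) {σw σb : ℝ} (hw : 0 < σw)
    (hb : 0 < σb) {E : Type*} [NormedAddCommGroup E] [NormedSpace ℝ E] [CompleteSpace E]
    (g : Euc d → E) :
    ∫ t : Euc d × ℝ, g t.1 ∂(paramLaw pw pb σw σb) = ∫ v, pw v • g (σw • v) := by
  have := hp.regular_w.isProbabilityMeasure_scaledLaw hw
  have := hp.regular_b.isProbabilityMeasure_scaledLaw hb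
  rw [paramLaw_eq, integral_fun_fst, hp.regular_w.integral_scaledLaw hw]
  simp

/-- Only the weights are rescaled to unit bandwidth. The biases keep their scale because ψ lives on
unit scale in b, where a large σ_b just flattens the density. -/
theorem integral_paramLaw (hp : IsBandwidthPair pw pb) {σw σb : ℝ} (hw : 0 < σw)
    (hb : 0 < σb) {g : Euc d × ℝ → ℝ} (hg : Integrable g (paramLaw pw pb σw σb)) :
    ∫ t, g t ∂(paramLaw pw pb σw σb) =
      ∫ v, pw v * ∫ b, σb⁻¹ * pb (σb⁻¹ * b) * g (σw • v, b) := by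
  have := hp.regular_w.isProbabilityMeasure_scaledLaw hw
  have := hp.regular_b.isProbabilityMeasure_scaledLaw hb
  rw [paramLaw_eq] at hg ⊢
  rw [integral_prod _ hg, hp.regular_w.integral_scaledLaw hw]
  simp only [smul_eq_mul]
  congr 1
  funext v
  congr 1
  rw [hp.regular_b.integral_scaledLaw hb,
    ← scaledDensity_integral_smul hb pb fun b => g (σw • v, b)]
  simp [scaledDensity]

theorem exists_bound_schwartz (psi : 𝓢(ℝ, ℝ)) :
    ∃ B, 0 < B ∧ (∀ s, |psi s| ≤ B) ∧ ∃ L : ℝ≥0, LipschitzWith L psi := by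
  obtain ⟨B, hB⟩ := psi.decay 0 0
  obtain ⟨L, hL⟩ := psi.decay 0 1
  refine ⟨B, hB.1, fun s => by simpa using hB.2 s, ⟨L, hL.1.le⟩, ?_⟩
  refine lipschitzWith_of_nnnorm_fderiv_le psi.differentiable fun s => ?_
  have := hL.2 s
  rw [pow_zero, one_mul, norm_iteratedFDeriv_one] at this
  exact this

/-- The error of replacing the density of the biases by a constant. -/
theorem exists_abs_integral_sub_dualKernel_le (hact : IsActivationPair d phi phihat psi)
    (hp : IsBandwidthPair pw pb) :
    ∃ C : ℝ, 0 ≤ C ∧ ∀ (σw σb : ℝ), 0 < σw → 0 < σb → ∀ x y : Euc d,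
      |totalMass pw pb σw σb * (∫ t : Euc d × ℝ, phi (inner ℝ t.1 x + t.2) *
          psi (inner ℝ t.1 (x + y) + t.2) ∂(paramLaw pw pb σw σb)) -
        σw ^ d * (2 * Real.pi) ^ ((d : ℝ) / 2) / (∫ x, ‖fourierR pw x‖) *
          dualKernel phihat psi pw σw y| ≤ C * (σw ^ d * (1 + σw * ‖x + y‖) / σb) := by
  obtain ⟨Bphi, hBphi⟩ := hact.bounded
  obtain ⟨Bpsi, hBpsi0, hBpsi, -⟩ := exists_bound_schwartz psi
  obtain ⟨Lb, hLb⟩ := hp.deriv_bounded_b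
  have hBphi0 : 0 ≤ Bphi := (abs_nonneg _).trans (hBphi 0)
  have hLb0 : 0 ≤ Lb := (abs_nonneg _).trans (hLb 0)
  have hpbc : Continuous pb := hp.differentiable_b.continuous
  have hpbL : ∀ b, |pb b - pb 0| ≤ Lb * |b| := fun b => by
    have := Convex.norm_image_sub_le_of_norm_deriv_le (𝕜 := ℝ) (f := pb) (s := Set.univ) (C := Lb)
      (fun x _ => hp.differentiable_b x) (fun x _ => hLb x) convex_univ (Set.mem_univ 0)
      (Set.mem_univ b)
    simpa using this
  set Iw := ∫ x, ‖fourierR pw x‖ with hIw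
  have hIw0 : 0 < Iw := hp.regular_w.integral_norm_fourierR_pos
  set Ib := ∫ x, ‖fourierR pb x‖ with hIb
  have hIb0 : 0 < Ib := hp.regular_b.integral_norm_fourierR_pos
  have hIb' : Ib = (2 * Real.pi) ^ ((1 : ℝ) / 2) * pb 0 :=
    integral_norm_fourierR_real hp.regular_b hpbc
  set s2 : ℝ := (2 * Real.pi) ^ ((1 : ℝ) / 2) with hs2
  have hs20 : 0 < s2 := by positivity
  have hψ0 : Integrable fun s => |psi s| := psi.integrable.norm
  have hψ1 : Integrable fun s => |s| * |psi s| := by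
    simpa using psi.integrable_pow_mul volume 1
  set Ψ0 := ∫ s, |psi s| with hΨ0
  set Ψ1 := ∫ s, |s| * |psi s| with hΨ1
  have hΨ00 : 0 ≤ Ψ0 := integral_nonneg fun _ => abs_nonneg _
  have hΨ10 : 0 ≤ Ψ1 := integral_nonneg fun _ => by positivity
  set m1 := ∫ v, ‖v‖ * pw v with hm1
  have hm10 : 0 ≤ m1 := integral_nonneg fun v => mul_nonneg (norm_nonneg _) (hp.regular_w.nonneg v)
  set κ := s2 / (Iw * Ib) with hκ
  have hκ0 : 0 < κ := by positivity
  refine ⟨κ * (Lb * Bphi * (Ψ1 + m1 * Ψ0)), by positivity, ?_⟩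
  intro σw σb hw hb x y
  have := isProbabilityMeasure_paramLaw hp hw hb
  set g : Euc d × ℝ → ℝ := fun t => phi (inner ℝ t.1 x + t.2) * psi (inner ℝ t.1 (x + y) + t.2)
  have hgc : Continuous g :=
    (hact.continuous.comp (by fun_prop)).mul (psi.continuous.comp (by fun_prop))
  have hgi : Integrable g (paramLaw pw pb σw σb) := by
    refine Integrable.of_bound hgc.aestronglyMeasurable (Bphi * Bpsi)
      (Eventually.of_forall fun t => ?_)
    rw [norm_mul]
    exact mul_le_mul (hBphi _) (hBpsi _) (norm_nonneg _) hBphi0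
  -- the two kernels as integrals over the weights
  have hshift : ∀ v : Euc d, ∫ b, g (σw • v, b) = ∫ s, psi s * phi (s + inner ℝ v (-(σw • y))) := by
    intro v
    refine Eq.trans ?_ (integral_add_left_eq_self _ (inner ℝ (σw • v) (x + y)))
    refine integral_congr_ae (Eventually.of_forall fun b => ?_)
    simp only [g]
    rw [mul_comm]
    congr 2
    rw [inner_add_right, inner_neg_right, real_inner_smul_right, real_inner_smul_left,
      real_inner_smul_left]
    ring
  have hdual : (2 * Real.pi) ^ ((d : ℝ) / 2) * dualKernel phihat psi pw σw y =
      ∫ v, pw v * ∫ b, g (σw • v, b) := by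
    simp_rw [hshift]
    rw [integral_density_mul_translate hact hp.regular_w]
    simp only [dualKernel, neg_neg, smul_smul]
  have hgb : ∀ v b, |g (σw • v, b)| ≤ Bphi * |psi (inner ℝ (σw • v) (x + y) + b)| := fun v b => by
    rw [abs_mul]
    exact mul_le_mul_of_nonneg_right (hBphi _) (abs_nonneg _)
  have hgvi : ∀ v, Integrable fun b => g (σw • v, b) := fun v => by
    refine ((hψ0.comp_add_left (inner ℝ (σw • v) (x + y))).const_mul Bphi).mono'
      (hgc.comp (by fun_prop)).aestronglyMeasurable (Eventually.of_forall fun b => hgb v b)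
  have hpbgi : ∀ v, Integrable fun b => pb (σb⁻¹ * b) * g (σw • v, b) := fun v => by
    obtain ⟨B, hB0, hB⟩ := hp.regular_b.exists_bound hpbc
    refine (hgvi v).bdd_mul (c := B) (hpbc.comp (by fun_prop)).aestronglyMeasurable
      (Eventually.of_forall fun b => ?_)
    rw [Real.norm_eq_abs, abs_of_nonneg (hp.regular_b.nonneg _)]
    exact hB _
  -- The effect of replacing p_b(b/σ_b) by p_b(0). The derivative bound gives |b|/σ_b, and ψ(a + b)
  -- localises b near -a, so |a| ≤ σ_w ‖v‖ ‖x + y‖ is the price of the moment.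
  set D : Euc d → ℝ := fun v => ∫ b, (pb (σb⁻¹ * b) - pb 0) * g (σw • v, b) with hD
  have hDb : ∀ v, |D v| ≤ Lb * Bphi / σb * (Ψ1 + σw * ‖v‖ * ‖x + y‖ * Ψ0) := by
    intro v
    set a := inner ℝ (σw • v) (x + y)
    have ha : |a| ≤ σw * ‖v‖ * ‖x + y‖ := by
      refine (abs_real_inner_le_norm _ _).trans ?_
      rw [norm_smul, Real.norm_eq_abs, abs_of_pos hw]
    have hbi : Integrable fun b => Lb * Bphi / σb * (|a + b| * |psi (a + b)| + |a| * |psi (a + b)|) :=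
      ((hψ1.comp_add_left a).add ((hψ0.comp_add_left a).const_mul _)).const_mul _
    have h1 : |D v| ≤ ∫ b, Lb * Bphi / σb * (|a + b| * |psi (a + b)| + |a| * |psi (a + b)|) := by
      rw [← Real.norm_eq_abs]
      refine norm_integral_le_of_norm_le hbi (Eventually.of_forall fun b => ?_)
      rw [norm_mul, Real.norm_eq_abs, Real.norm_eq_abs]
      have h2 := hpbL (σb⁻¹ * b)
      rw [abs_mul, abs_of_pos (inv_pos.2 hb)] at h2
      have h3 : |b| ≤ |a + b| + |a| := by
        have := abs_sub (a + b) a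
        rwa [add_sub_cancel_left] at this
      calc _ ≤ Lb * (σb⁻¹ * |b|) * (Bphi * |psi (a + b)|) :=
            mul_le_mul h2 (hgb v b) (abs_nonneg _) (by positivity)
        _ = Lb * Bphi / σb * (|b| * |psi (a + b)|) := by rw [div_eq_mul_inv]; ring
        _ ≤ Lb * Bphi / σb * ((|a + b| + |a|) * |psi (a + b)|) := by gcongr
        _ = _ := by ring
    refine h1.trans ?_
    rw [integral_const_mul, integral_add (hψ1.comp_add_left a) ((hψ0.comp_add_left a).const_mul _),
      integral_const_mul, integral_add_left_eq_self (fun s => |s| * |psi s|) a,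
      integral_add_left_eq_self (fun s => |psi s|) a]
    gcongr
  have hDe : ∀ v, D v = (∫ b, pb (σb⁻¹ * b) * g (σw • v, b)) - pb 0 * ∫ b, g (σw • v, b) := by
    intro v
    rw [← integral_const_mul, ← integral_sub (hpbgi v) ((hgvi v).const_mul _)]
    simp only [hD, sub_mul]
  have hQm : AEStronglyMeasurable fun v : Euc d => ∫ b, g (σw • v, b) := by
    refine AEStronglyMeasurable.integral_prod_right' (μ := (volume : Measure (Euc d)))
      (ν := (volume : Measure ℝ)) (f := fun z : Euc d × ℝ => g (σw • z.1, z.2)) ?_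
    exact (hgc.comp (by fun_prop)).aestronglyMeasurable
  have hDm : AEStronglyMeasurable D := by
    refine AEStronglyMeasurable.integral_prod_right' (μ := (volume : Measure (Euc d)))
      (ν := (volume : Measure ℝ))
      (f := fun z : Euc d × ℝ => (pb (σb⁻¹ * z.2) - pb 0) * g (σw • z.1, z.2)) ?_
    exact (((hpbc.comp (by fun_prop)).sub continuous_const).mul
      (hgc.comp (by fun_prop))).aestronglyMeasurable
  have hQi : Integrable fun v => pw v * ∫ b, g (σw • v, b) := by
    refine (hp.regular_w.integrable.norm.mul_const (Bphi * Ψ0)).mono'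
      (hp.regular_w.integrable.aestronglyMeasurable.mul hQm) (Eventually.of_forall fun v => ?_)
    rw [norm_mul]
    gcongr
    refine (norm_integral_le_of_norm_le ((hψ0.comp_add_left
      (inner ℝ (σw • v) (x + y))).const_mul Bphi) (Eventually.of_forall fun b => hgb v b)).trans ?_
    rw [integral_const_mul, integral_add_left_eq_self (fun s => |psi s|)]
  have hbi : Integrable fun v =>
      Lb * Bphi / σb * (Ψ1 * pw v + σw * ‖x + y‖ * Ψ0 * (‖v‖ * pw v)) :=
    ((hp.regular_w.integrable.const_mul _).add
      (hp.regular_w.integrable_norm_mul.const_mul _)).const_mul _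
  have hDv : ∀ v, |pw v * D v| ≤
      Lb * Bphi / σb * (Ψ1 * pw v + σw * ‖x + y‖ * Ψ0 * (‖v‖ * pw v)) := fun v => by
    rw [abs_mul, abs_of_nonneg (hp.regular_w.nonneg v)]
    calc _ ≤ pw v * (Lb * Bphi / σb * (Ψ1 + σw * ‖v‖ * ‖x + y‖ * Ψ0)) :=
          mul_le_mul_of_nonneg_left (hDb v) (hp.regular_w.nonneg v)
      _ = _ := by ring
  have hDi : Integrable fun v => pw v * D v :=
    hbi.mono' (hp.regular_w.integrable.aestronglyMeasurable.mul hDm)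
      (Eventually.of_forall hDv)
  have hDint : |∫ v, pw v * D v| ≤ Lb * Bphi / σb * (Ψ1 + σw * ‖x + y‖ * Ψ0 * m1) := by
    rw [← Real.norm_eq_abs]
    refine (norm_integral_le_of_norm_le hbi (Eventually.of_forall hDv)).trans (le_of_eq ?_)
    rw [integral_const_mul, integral_add (hp.regular_w.integrable.const_mul _)
      (hp.regular_w.integrable_norm_mul.const_mul _), integral_const_mul, integral_const_mul,
      hp.regular_w.integral_eq_one, mul_one]
  have hmain : totalMass pw pb σw σb * (∫ t, g t ∂(paramLaw pw pb σw σb)) =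
      σw ^ d * κ * (∫ v, pw v * D v) +
        σw ^ d * (2 * Real.pi) ^ ((d : ℝ) / 2) / Iw * dualKernel phihat psi pw σw y := by
    have e1 : ∫ v, pw v * (∫ b, σb⁻¹ * pb (σb⁻¹ * b) * g (σw • v, b)) =
        σb⁻¹ * ((∫ v, pw v * D v) + pb 0 * ∫ v, pw v * ∫ b, g (σw • v, b)) := by
      rw [← integral_const_mul, ← integral_add hDi (hQi.const_mul _), ← integral_const_mul]
      refine integral_congr_ae (Eventually.of_forall fun v => ?_)
      simp only [hDe, mul_assoc, integral_const_mul]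
      ring
    have e2 : σw ^ d * (2 * Real.pi) ^ ((d : ℝ) / 2) / Iw * dualKernel phihat psi pw σw y =
        σw ^ d / Iw * ((2 * Real.pi) ^ ((d : ℝ) / 2) * dualKernel phihat psi pw σw y) := by ring
    -- This identity matches the constants of the two kernels exactly, so that only the flattening
    -- error D survives.
    have e3 : κ * pb 0 = Iw⁻¹ := by
      rw [hκ, div_mul_eq_mul_div, ← hIb']
      field_simp
    rw [integral_paramLaw hp hw hb hgi, e1, e2, hdual]
    set q := ∫ v, pw v * ∫ b, g (σw • v, b)
    set r := ∫ v, pw v * D v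
    have e4 : totalMass pw pb σw σb = σw ^ d * σb * κ := by
      simp only [totalMass, hκ]
      ring
    rw [e4, div_eq_mul_inv, ← e3]
    field_simp
  rw [hmain, add_sub_cancel_right, abs_mul, abs_of_pos (by positivity)]
  calc _ ≤ σw ^ d * κ * (Lb * Bphi / σb * (Ψ1 + σw * ‖x + y‖ * Ψ0 * m1)) := by gcongr
    _ ≤ σw ^ d * κ * (Lb * Bphi / σb * ((Ψ1 + m1 * Ψ0) * (1 + σw * ‖x + y‖))) := by
        gcongr
        have h1 : 0 ≤ σw * ‖x + y‖ := by positivity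
        nlinarith [mul_nonneg hm10 hΨ00, mul_nonneg hΨ10 h1]
    _ = _ := by field_simp

end MeanKernel

/-! ### Cubature on the grid -/

section Cubature

variable {d : ℕ} {S : ℝ}

theorem gridNode_apply (S : ℝ) (n : ℕ) (j : Fin d → Fin n) (i : Fin d) :
    gridNode S n j i = -S + 2 * S / n * ((j i : ℕ) : ℝ) := rfl

/-- The cell of the grid with lower corner at the node `j`. -/
def gridCell (S : ℝ) (n : ℕ) (j : Fin d → Fin n) : Set (Euc d) :=
  WithLp.ofLp ⁻¹' Set.univ.pi fun i =>
    Set.Ico (gridNode S n j i) (gridNode S n j i + 2 * S / n)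

theorem mem_gridCell {n : ℕ} {j : Fin d → Fin n} {x : Euc d} : x ∈ gridCell S n j ↔
    ∀ i, x i ∈ Set.Ico (gridNode S n j i) (gridNode S n j i + 2 * S / n) := by
  simp [gridCell, Set.mem_pi]

theorem measurableSet_gridCell (S : ℝ) (n : ℕ) (j : Fin d → Fin n) :
    MeasurableSet (gridCell S n j) :=
  (PiLp.volume_preserving_ofLp (Fin d)).measurable
    (MeasurableSet.univ_pi fun _ => measurableSet_Ico)

theorem volume_gridCell (hS : 0 < S) {n : ℕ} (j : Fin d → Fin n) :
    volume.real (gridCell S n j) = (2 * S) ^ d / ((n ^ d : ℕ) : ℝ) := by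
  rw [Measure.real, gridCell, (PiLp.volume_preserving_ofLp (Fin d)).measure_preimage
    (MeasurableSet.univ_pi fun _ => measurableSet_Ico).nullMeasurableSet, Real.volume_pi_Ico]
  simp only [add_sub_cancel_left, Finset.prod_const, Finset.card_univ, Fintype.card_fin]
  rw [ENNReal.toReal_pow, ENNReal.toReal_ofReal (by positivity), div_pow]
  push_cast
  rfl

theorem volume_gridCell_lt_top (S : ℝ) (n : ℕ) (j : Fin d → Fin n) :
    volume (gridCell S n j) < ∞ := by
  rw [gridCell, (PiLp.volume_preserving_ofLp (Fin d)).measure_preimage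
    (MeasurableSet.univ_pi fun _ => measurableSet_Ico).nullMeasurableSet, Real.volume_pi_Ico]
  exact ENNReal.prod_lt_top fun _ _ => ENNReal.ofReal_lt_top

theorem pairwise_disjoint_gridCell (hS : 0 < S) {n : ℕ} (hn : 0 < n) :
    Pairwise (Function.onFun Disjoint (gridCell (d := d) S n)) := by
  intro j j' hjj
  rw [Function.onFun, Set.disjoint_left]
  intro x hx hx'
  apply hjj
  funext i
  have h := mem_gridCell.1 hx i
  have h' := mem_gridCell.1 hx' i
  rw [gridNode_apply] at h h'
  have ha : 0 < 2 * S / n := by positivity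
  have h1 : ((j i : ℕ) : ℝ) < (j' i : ℕ) + 1 := by
    have : 2 * S / n * ((j i : ℕ) : ℝ) < 2 * S / n * ((j' i : ℕ) + 1) := by linarith [h.1, h'.2]
    exact lt_of_mul_lt_mul_left this ha.le
  have h2 : ((j' i : ℕ) : ℝ) < (j i : ℕ) + 1 := by
    have : 2 * S / n * ((j' i : ℕ) : ℝ) < 2 * S / n * ((j i : ℕ) + 1) := by linarith [h'.1, h.2]
    exact lt_of_mul_lt_mul_left this ha.le
  have h1' : (j i : ℕ) < (j' i : ℕ) + 1 := by exact_mod_cast h1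
  have h2' : (j' i : ℕ) < (j i : ℕ) + 1 := by exact_mod_cast h2
  exact Fin.ext (by omega)

theorem mem_iUnion_gridCell (hS : 0 < S) {n : ℕ} (hn : 0 < n) {x : Euc d}
    (hx : ∀ i, x i ∈ Set.Ico (-S) S) : x ∈ ⋃ j, gridCell S n j := by
  have ha : 0 < 2 * S / n := by positivity
  have hn' : (0 : ℝ) < n := Nat.cast_pos.2 hn
  have hq : ∀ i, 0 ≤ (x i + S) / (2 * S / n) := fun i =>
    div_nonneg (by linarith [(hx i).1]) ha.le
  -- The cell index is the integer part of the rescaled coordinate; strictness of x i < S keeps it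
  -- below n.
  have hlt : ∀ i, ⌊(x i + S) / (2 * S / n)⌋₊ < n := fun i => by
    rw [Nat.floor_lt (hq i), div_lt_iff₀ ha]
    have : (n : ℝ) * (2 * S / n) = 2 * S := by field_simp
    rw [this]
    linarith [(hx i).2]
  refine Set.mem_iUnion.2 ⟨fun i => ⟨_, hlt i⟩, mem_gridCell.2 fun i => ?_⟩
  rw [gridNode_apply]
  have h1 := Nat.floor_le (hq i)
  have h2 := Nat.lt_floor_add_one ((x i + S) / (2 * S / n))
  rw [le_div_iff₀ ha] at h1
  rw [div_lt_iff₀ ha] at h2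
  constructor <;> simp only <;> linarith

/-- A Euclidean cell has diameter √d times its side; the cruder factor d suffices. -/
theorem norm_sub_gridNode_le (hS : 0 < S) {n : ℕ} {j : Fin d → Fin n} {x : Euc d}
    (hx : x ∈ gridCell S n j) : ‖x - gridNode S n j‖ ≤ d * (2 * S / n) := by
  have h := mem_gridCell.1 hx
  rw [EuclideanSpace.norm_eq]
  refine Real.sqrt_le_iff.2 ⟨by positivity, ?_⟩
  have h1 : ∀ i, ‖(x - gridNode S n j) i‖ ^ 2 ≤ (2 * S / n) ^ 2 := fun i => by
    have := h i
    rw [PiLp.sub_apply, Real.norm_eq_abs]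
    gcongr
    rw [abs_le]
    constructor <;> linarith [this.1, this.2, (by positivity : 0 ≤ 2 * S / n)]
  refine (Finset.sum_le_sum fun i _ => h1 i).trans ?_
  simp only [Finset.sum_const, Finset.card_univ, Fintype.card_fin, nsmul_eq_mul]
  rw [mul_pow]
  gcongr
  have : (d : ℝ) ≤ (d : ℝ) ^ 2 := by exact_mod_cast Nat.le_self_pow two_ne_zero d
  exact this

variable {H : Type*} [NormedAddCommGroup H]

theorem continuous_of_norm_sub_le {h : Euc d → H} {K : ℝ}
    (hK : ∀ x y, ‖h y - h x‖ ≤ K * ‖y - x‖) : Continuous h := by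
  refine (LipschitzWith.of_dist_le_mul (K := K.toNNReal) fun x y => ?_).continuous
  rw [dist_eq_norm, dist_eq_norm]
  refine (hK y x).trans ?_
  gcongr
  exact Real.le_coe_toNNReal K

theorem hasCompactSupport_of_cube {h : Euc d → H} (h0 : ∀ x, x ∉ cube d S → h x = 0) :
    HasCompactSupport h :=
  HasCompactSupport.intro (isCompact_cube d S) h0

/-- The error of the product of left endpoint rules, for Lipschitz functions supported in the
cube. -/
theorem norm_integral_sub_grid_le [NormedSpace ℝ H] [CompleteSpace H] (hS : 0 < S) {n : ℕ} (hn : 0 < n)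
    {h : Euc d → H} {K : ℝ} (hK : ∀ x y, ‖h y - h x‖ ≤ K * ‖y - x‖)
    (h0 : ∀ x, x ∉ cube d S → h x = 0) :
    ‖∑ j : Fin d → Fin n, ((2 * S) ^ d / ((n ^ d : ℕ) : ℝ)) • h (gridNode S n j) - ∫ x, h x‖ ≤
      (2 * S) ^ d * (|K| * (d * (2 * S / n))) := by
  have hc := continuous_of_norm_sub_le hK
  have hi : Integrable h := hc.integrable_of_hasCompactSupport (hasCompactSupport_of_cube h0)
  -- Half-open cells miss the faces x i = S. There h vanishes all the same, because arbitrarily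
  -- close points lie off the cube and h is Lipschitz.
  have hout : ∀ x, x ∉ ⋃ j : Fin d → Fin n, gridCell S n j → h x = 0 := by
    intro x hx
    by_cases hxc : x ∈ cube d S
    · have hex : ∃ i, x i = S := by
        by_contra hne
        push Not at hne
        exact hx (mem_iUnion_gridCell hS hn fun i => ⟨(hxc i).1, lt_of_le_of_ne (hxc i).2 (hne i)⟩)
      obtain ⟨i, hi⟩ := hex
      have hε : ∀ ε > 0, ‖h x‖ ≤ |K| * ε := by
        intro ε hε
        have hnot : x + EuclideanSpace.single i ε ∉ cube d S := fun hmem => by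
          have := (hmem i).2
          simp [hi] at this
          linarith
        have h2 := hK (x + EuclideanSpace.single i ε) x
        rw [h0 _ hnot, sub_zero, sub_add_cancel_left, norm_neg, PiLp.norm_single,
          Real.norm_eq_abs, abs_of_pos hε] at h2
        exact h2.trans (mul_le_mul_of_nonneg_right (le_abs_self K) hε.le)
      rw [← norm_le_zero_iff]
      refine le_of_forall_pos_le_add fun ε hε' => ?_
      have h3 := hε (ε / (|K| + 1)) (by positivity)
      have h4 : |K| * (ε / (|K| + 1)) ≤ ε := by
        rw [mul_div_assoc', div_le_iff₀ (by positivity)]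
        nlinarith [abs_nonneg K]
      linarith
    · exact h0 x hxc
  rw [← setIntegral_eq_integral_of_forall_compl_eq_zero hout,
    integral_iUnion_fintype (fun j => measurableSet_gridCell S n j)
      (pairwise_disjoint_gridCell hS hn) (fun j => hi.integrableOn), ← Finset.sum_sub_distrib]
  have hcell : ∀ j : Fin d → Fin n, ‖((2 * S) ^ d / ((n ^ d : ℕ) : ℝ)) • h (gridNode S n j) -
      ∫ x in gridCell S n j, h x‖ ≤
      (|K| * (d * (2 * S / n))) * ((2 * S) ^ d / ((n ^ d : ℕ) : ℝ)) := by
    intro j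
    have e : ((2 * S) ^ d / ((n ^ d : ℕ) : ℝ)) • h (gridNode S n j) =
        ∫ _x in gridCell S n j, h (gridNode S n j) := by
      rw [setIntegral_const, volume_gridCell hS]
    have hconst : Integrable (fun _ : Euc d => h (gridNode S n j))
        (volume.restrict (gridCell S n j)) :=
      integrableOn_const (volume_gridCell_lt_top S n j).ne
    rw [e, ← integral_sub hconst hi.integrableOn,
      ← volume_gridCell hS j]
    refine norm_setIntegral_le_of_norm_le_const (volume_gridCell_lt_top S n j) fun x hx => ?_
    rw [norm_sub_rev]
    refine (hK _ _).trans ?_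
    exact mul_le_mul (le_abs_self K) (norm_sub_gridNode_le hS hx) (norm_nonneg _) (abs_nonneg _)
  refine (norm_sum_le_of_le _ fun j _ => hcell j).trans (le_of_eq ?_)
  simp only [Finset.sum_const, Finset.card_univ, Fintype.card_fun, Fintype.card_fin, nsmul_eq_mul]
  have : ((n ^ d : ℕ) : ℝ) ≠ 0 := by positivity
  field_simp

end Cubature

/-! ### The bias of the finite-bandwidth transform -/

section Bias

variable {d : ℕ} {phi : ℝ → ℝ} {phihat : ℝ → ℂ} {psi : 𝓢(ℝ, ℝ)} {pw : Euc d → ℝ} {pb : ℝ → ℝ}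
  {S : ℝ}

theorem integrable_dualKernel (hact : IsActivationPair d phi phihat psi)
    (hp : IsRegularDensity pw) {σ : ℝ} (hσ : 0 < σ) :
    Integrable (dualKernel phihat psi pw σ) := by
  have hm := (integrable_spectral hact).re.aestronglyMeasurable
  have h := (integral_dilation (d := d) (r := fun ξ => (spectral phihat psi ξ).re) hm
    (by
      have hpow : Measurable fun ξ : ℝ => (|ξ| ^ d)⁻¹ := by fun_prop
      refine (integrable_spectral_div hact (j := d) (by omega)).mono'
        (hpow.aestronglyMeasurable.mul hm.norm) (Eventually.of_forall fun ξ => ?_)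
      rw [Real.norm_eq_abs, abs_of_nonneg (by positivity)]
      gcongr
      exact Complex.abs_re_le_norm _)
    (Complex.continuous_re.comp (continuous_fourierR hp.integrable))
    hp.fourier_integrable.re hσ).1
  exact h.integral_prod_left

theorem exists_bound_cube (d : ℕ) (S : ℝ) : ∃ ρ, 0 ≤ ρ ∧ ∀ x ∈ cube d S, ‖x‖ ≤ ρ := by
  obtain ⟨ρ, hρ⟩ := (isCompact_cube d S).isBounded.exists_norm_le
  exact ⟨|ρ|, abs_nonneg _, fun x hx => (hρ x hx).trans (le_abs_self _)⟩

/-- The finite-bandwidth ridgelet transform, followed by its dual, is close to the identity. -/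
theorem exists_bias_le (hact : IsActivationPair d phi phihat psi) (hp : IsBandwidthPair pw pb)
    (S : ℝ) :
    ∃ C : ℝ, 0 ≤ C ∧ ∀ {H : Type*} [NormedAddCommGroup H] [InnerProductSpace ℝ H]
      [CompleteSpace H] (G : Euc d → H) (M K σw σb : ℝ), 0 ≤ M → 0 ≤ K → (∀ x, ‖G x‖ ≤ M) →
      (∀ x y, ‖G y - G x‖ ≤ K * ‖y - x‖) → (∀ x, x ∉ cube d S → G x = 0) → 0 < σw → 0 < σb →
      ∀ x, ‖G x - ∫ t : Euc d × ℝ, phi (inner ℝ t.1 x + t.2) • totalMass pw pb σw σb •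
          (∫ x', psi (inner ℝ t.1 x' + t.2) • G x') ∂(paramLaw pw pb σw σb)‖ ≤
        C * (M + K) * (1 / σw + σw ^ d * (σw + 1) / σb) := by
  obtain ⟨C₁, hC₁, h₁⟩ := exists_norm_sub_dualKernel_le hact hp.regular_w hp.fourier_secondMoment
  obtain ⟨C₂, hC₂, h₂⟩ := exists_abs_integral_sub_dualKernel_le hact hp
  obtain ⟨ρ, hρ0, hρ⟩ := exists_bound_cube d S
  obtain ⟨Bphi, hBphi⟩ := hact.bounded
  obtain ⟨Bpsi, hBpsi0, hBpsi, -⟩ := exists_bound_schwartz psi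
  have hBphi0 : 0 ≤ Bphi := (abs_nonneg _).trans (hBphi 0)
  set vol := volume.real (cube d S) with hvol
  have hvolfin : volume (cube d S) < ∞ := (isCompact_cube d S).measure_lt_top
  refine ⟨C₁ + C₂ * (1 + ρ) * vol, by positivity, ?_⟩
  intro H _ _ _ G M K σw σb hM0 hK0 hM hK h0 hw hb x
  have hprob := isProbabilityMeasure_paramLaw hp hw hb
  set μ := paramLaw pw pb σw σb
  set Z := totalMass pw pb σw σb
  set q := σw ^ d * (2 * Real.pi) ^ ((d : ℝ) / 2) / ∫ x, ‖fourierR pw x‖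
  have hGc : Continuous G := continuous_of_norm_sub_le hK
  have hGi : Integrable G := hGc.integrable_of_hasCompactSupport (hasCompactSupport_of_cube h0)
  set k : Euc d → Euc d × ℝ → ℝ := fun x' t =>
    phi (inner ℝ t.1 x + t.2) * psi (inner ℝ t.1 x' + t.2)
  have hFub : Integrable (fun z : (Euc d × ℝ) × Euc d => k z.2 z.1 • G z.2) (μ.prod volume) := by
    have hGs : Integrable (fun z : (Euc d × ℝ) × Euc d => G z.2) (μ.prod volume) := hGi.comp_snd μ
    have hkc : Continuous fun z : (Euc d × ℝ) × Euc d => k z.2 z.1 :=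
      (hact.continuous.comp (by fun_prop)).mul (psi.continuous.comp (by fun_prop))
    refine (hGs.norm.const_mul (Bphi * Bpsi)).mono'
      (hkc.aestronglyMeasurable.smul hGs.aestronglyMeasurable) (Eventually.of_forall fun z => ?_)
    rw [norm_smul, norm_mul]
    gcongr
    · exact hBphi _
    · exact hBpsi _
  -- Fubini turns the composed transforms into one kernel acting on G; the shift x' = x + y aligns
  -- it with `dualKernel`.
  have hswap : ∫ t : Euc d × ℝ, phi (inner ℝ t.1 x + t.2) • Z •
      (∫ x', psi (inner ℝ t.1 x' + t.2) • G x') ∂μ =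
      ∫ y, (Z * ∫ t, k (x + y) t ∂μ) • G (x + y) := by
    rw [integral_add_left_eq_self (fun x' => (Z * ∫ t, k x' t ∂μ) • G x') x]
    simp_rw [mul_smul, ← integral_smul_const]
    rw [integral_smul, ← integral_integral_swap hFub, ← integral_smul]
    refine integral_congr_ae (Eventually.of_forall fun t => ?_)
    simp only [k, mul_smul, integral_smul]
    rw [smul_comm]
  have hi1 : Integrable fun y => (Z * ∫ t, k (x + y) t ∂μ) • G (x + y) := by
    have h3 := (hFub.integral_prod_right.smul Z).comp_add_left x
    refine h3.congr (Eventually.of_forall fun y => ?_)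
    simp only [Pi.smul_apply, integral_smul_const, mul_smul]
  have hi2 : Integrable fun y => q • dualKernel phihat psi pw σw y • G (x + y) := by
    refine Integrable.smul q ?_
    have hdk := integrable_dualKernel hact hp.regular_w hw
    refine (hdk.norm.mul_const M).mono' (hdk.aestronglyMeasurable.smul
      (hGc.comp (by fun_prop)).aestronglyMeasurable) (Eventually.of_forall fun y => ?_)
    rw [norm_smul]
    exact mul_le_mul_of_nonneg_left (hM _) (norm_nonneg _)
  set B := C₂ * (σw ^ d * (1 + σw * ρ) / σb) * M with hB
  have hdiff : ‖(∫ y, (Z * ∫ t, k (x + y) t ∂μ) • G (x + y)) -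
      ∫ y, q • dualKernel phihat psi pw σw y • G (x + y)‖ ≤ vol * B := by
    rw [← integral_sub hi1 hi2]
    -- The comparison of kernels degrades as ‖x + y‖ grows, but G restricts the integral to the
    -- cube.
    have hbd : ∀ y, ‖(Z * ∫ t, k (x + y) t ∂μ) • G (x + y) -
        q • dualKernel phihat psi pw σw y • G (x + y)‖ ≤
        (cube d S).indicator (fun _ => B) (x + y) := by
      intro y
      by_cases hy : x + y ∈ cube d S
      · rw [Set.indicator_of_mem hy, smul_smul, ← sub_smul, norm_smul, Real.norm_eq_abs]
        refine mul_le_mul ((h₂ σw σb hw hb x y).trans ?_) (hM _) (norm_nonneg _) (by positivity)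
        gcongr
        exact hρ _ hy
      · rw [Set.indicator_of_notMem hy, h0 _ hy]
        simp
    have hind : Integrable fun y : Euc d => (cube d S).indicator (fun _ => B) (x + y) := by
      refine Integrable.comp_add_left (f := (cube d S).indicator fun _ => B) ?_ x
      exact (integrable_indicator_iff (isCompact_cube d S).measurableSet).2
        (integrableOn_const hvolfin.ne)
    refine (norm_integral_le_of_norm_le hind (Eventually.of_forall hbd)).trans (le_of_eq ?_)
    rw [integral_add_left_eq_self (fun y => (cube d S).indicator (fun _ => B) y) x,
      integral_indicator (isCompact_cube d S).measurableSet, setIntegral_const, smul_eq_mul]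
  have hid := h₁ G M K σw hGc hM hK hw x
  rw [← integral_smul] at hid
  rw [hswap]
  have htri : ‖G x - ∫ y, (Z * ∫ t, k (x + y) t ∂μ) • G (x + y)‖ ≤ C₁ * K / σw + vol * B := by
    refine (norm_sub_le_norm_sub_add_norm_sub _
      (∫ y, q • dualKernel phihat psi pw σw y • G (x + y)) _).trans (add_le_add hid ?_)
    rw [norm_sub_rev]
    exact hdiff
  refine htri.trans ?_
  set e := σw ^ d * (σw + 1) / σb with he
  have he0 : 0 ≤ e := by positivity
  have hBe : B ≤ C₂ * ((1 + ρ) * e) * M := by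
    have h5 : σw ^ d * (1 + σw * ρ) / σb ≤ (1 + ρ) * e := by
      rw [he, mul_div_assoc', div_le_div_iff_of_pos_right hb]
      have : 1 + σw * ρ ≤ (1 + ρ) * (σw + 1) := by nlinarith [hw.le]
      calc σw ^ d * (1 + σw * ρ) ≤ σw ^ d * ((1 + ρ) * (σw + 1)) := by gcongr
        _ = _ := by ring
    rw [hB]
    gcongr
  have hvol0 : 0 ≤ vol := measureReal_nonneg
  have a1 : C₁ * K / σw ≤ C₁ * (M + K) * (1 / σw) := by
    rw [mul_one_div]; gcongr; linarith
  have a2 : vol * B ≤ C₂ * (1 + ρ) * vol * (M + K) * e := by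
    calc vol * B ≤ vol * (C₂ * ((1 + ρ) * e) * M) := by gcongr
      _ ≤ vol * (C₂ * ((1 + ρ) * e) * (M + K)) := by gcongr; linarith
      _ = _ := by ring
  have a3 : 0 ≤ C₁ * (M + K) * e := by positivity
  have a4 : 0 ≤ C₂ * (1 + ρ) * vol * (M + K) * (1 / σw) := by positivity
  linarith

end Bias

/-! ### The discretised ridgelet transform -/

section Discretised

variable {d : ℕ} {S : ℝ} {H : Type*} [NormedAddCommGroup H] [InnerProductSpace ℝ H]

/-- The discretised ridgelet transform of `G` at the weight and the bias `t`. -/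
noncomputable def gridTransform (psi : ℝ → ℝ) (S : ℝ) (n : ℕ) (G : Euc d → H) (t : Euc d × ℝ) : H :=
  ∑ j : Fin d → Fin n, ((2 * S) ^ d / ((n ^ d : ℕ) : ℝ)) •
    psi (inner ℝ t.1 (gridNode S n j) + t.2) • G (gridNode S n j)

theorem continuous_gridTransform {psi : ℝ → ℝ} (hpsi : Continuous psi) (S : ℝ) (n : ℕ)
    (G : Euc d → H) : Continuous (gridTransform psi S n G) := by
  unfold gridTransform
  refine continuous_finsetSum _ fun j _ => Continuous.const_smul (Continuous.smul ?_
    continuous_const) _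
  exact hpsi.comp (by fun_prop)

/-- The values of ψ are kept inside the sum, since their mean under the law of b is small for large
σ_b; a supremum bound would lose this. -/
theorem norm_gridTransform_le (hS : 0 < S) {n : ℕ} (psi : ℝ → ℝ) {G : Euc d → H} {M : ℝ}
    (hM : ∀ x, ‖G x‖ ≤ M) (t : Euc d × ℝ) :
    ‖gridTransform psi S n G t‖ ≤ (2 * S) ^ d / ((n ^ d : ℕ) : ℝ) * M *
      ∑ j : Fin d → Fin n, |psi (inner ℝ t.1 (gridNode S n j) + t.2)| := by
  rw [gridTransform, Finset.mul_sum]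
  refine norm_sum_le_of_le _ fun j _ => ?_
  rw [norm_smul, norm_smul, Real.norm_eq_abs, Real.norm_eq_abs, abs_of_nonneg (by positivity)]
  calc _ ≤ (2 * S) ^ d / ((n ^ d : ℕ) : ℝ) *
        (|psi (inner ℝ t.1 (gridNode S n j) + t.2)| * M) := by gcongr; exact hM _
    _ = _ := by ring

theorem norm_gridTransform_le_const (hS : 0 < S) {n : ℕ} (hn : 0 < n) {psi : ℝ → ℝ} {Bpsi : ℝ}
    (hB : ∀ s, |psi s| ≤ Bpsi) {G : Euc d → H} {M : ℝ} (hM0 : 0 ≤ M) (hM : ∀ x, ‖G x‖ ≤ M)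
    (t : Euc d × ℝ) : ‖gridTransform psi S n G t‖ ≤ (2 * S) ^ d * M * Bpsi := by
  have hn' : ((n ^ d : ℕ) : ℝ) ≠ 0 := by positivity
  refine (norm_gridTransform_le hS psi hM t).trans ?_
  calc _ ≤ (2 * S) ^ d / ((n ^ d : ℕ) : ℝ) * M * ∑ _j : Fin d → Fin n, Bpsi := by
        gcongr; exact hB _
    _ = _ := by
        simp only [Finset.sum_const, Finset.card_univ, Fintype.card_fun, Fintype.card_fin,
          nsmul_eq_mul]
        field_simp

/-- The cubature error of the discretised ridgelet transform. -/
theorem norm_gridTransform_sub_le [CompleteSpace H] (hS : 0 < S) {n : ℕ} (hn : 0 < n)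
    {psi : ℝ → ℝ} {Bpsi : ℝ} (hB : ∀ s, |psi s| ≤ Bpsi) {L : ℝ≥0} (hL : LipschitzWith L psi)
    {G : Euc d → H} {M K : ℝ} (hM0 : 0 ≤ M) (hK0 : 0 ≤ K) (hM : ∀ x, ‖G x‖ ≤ M)
    (hK : ∀ x y, ‖G y - G x‖ ≤ K * ‖y - x‖) (h0 : ∀ x, x ∉ cube d S → G x = 0)
    (t : Euc d × ℝ) :
    ‖gridTransform psi S n G t - ∫ x, psi (inner ℝ t.1 x + t.2) • G x‖ ≤
      (2 * S) ^ d * ((L * ‖t.1‖ * M + Bpsi * K) * (d * (2 * S / n))) := by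
  have hB0 : 0 ≤ Bpsi := (abs_nonneg _).trans (hB 0)
  have hLip : ∀ x y : Euc d, ‖psi (inner ℝ t.1 y + t.2) • G y - psi (inner ℝ t.1 x + t.2) • G x‖ ≤
      (L * ‖t.1‖ * M + Bpsi * K) * ‖y - x‖ := by
    intro x y
    have e : psi (inner ℝ t.1 y + t.2) • G y - psi (inner ℝ t.1 x + t.2) • G x =
        (psi (inner ℝ t.1 y + t.2) - psi (inner ℝ t.1 x + t.2)) • G y +
          psi (inner ℝ t.1 x + t.2) • (G y - G x) := by module
    have h1 : |psi (inner ℝ t.1 y + t.2) - psi (inner ℝ t.1 x + t.2)| ≤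
        L * (‖t.1‖ * ‖y - x‖) := by
      have := hL.dist_le_mul (inner ℝ t.1 y + t.2) (inner ℝ t.1 x + t.2)
      rw [dist_add_right, Real.dist_eq, Real.dist_eq, ← inner_sub_right] at this
      exact this.trans (mul_le_mul_of_nonneg_left (abs_real_inner_le_norm _ _) L.2)
    rw [e]
    refine (norm_add_le _ _).trans ?_
    rw [norm_smul, norm_smul, Real.norm_eq_abs, Real.norm_eq_abs]
    have a1 := mul_le_mul h1 (hM y) (norm_nonneg _) (by positivity)
    have a2 := mul_le_mul (hB (inner ℝ t.1 x + t.2)) (hK x y) (norm_nonneg _) hB0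
    linarith
  have h := norm_integral_sub_grid_le (n := n) hS hn hLip fun x hx => by rw [h0 x hx, smul_zero]
  rwa [abs_of_nonneg (by positivity)] at h

variable {psi : 𝓢(ℝ, ℝ)} {pw : Euc d → ℝ} {pb : ℝ → ℝ}

/-- The second moment of the discretised ridgelet transform decreases with the bandwidth of the
biases. -/
theorem exists_integral_norm_gridTransform_sq_le (psi : 𝓢(ℝ, ℝ)) (hp : IsBandwidthPair pw pb)
    (hS : 0 < S) :
    ∃ C : ℝ, 0 ≤ C ∧ ∀ {H : Type*} [NormedAddCommGroup H] [InnerProductSpace ℝ H]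
      (G : Euc d → H) (M σw σb : ℝ) (n : ℕ), 0 ≤ M → (∀ x, ‖G x‖ ≤ M) → 0 < σw → 0 < σb →
      0 < n → ∫ t, ‖gridTransform psi S n G t‖ ^ 2 ∂(paramLaw pw pb σw σb) ≤ C * M ^ 2 / σb := by
  obtain ⟨Bpsi, hBpsi0, hBpsi, -⟩ := exists_bound_schwartz psi
  obtain ⟨Bpb, hBpb0, hBpb⟩ := hp.regular_b.exists_bound hp.differentiable_b.continuous
  set Ψ0 := ∫ s, |psi s| with hΨ0
  have hΨ00 : 0 ≤ Ψ0 := integral_nonneg fun _ => abs_nonneg _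
  have hψ0 : Integrable fun s => |psi s| := psi.integrable.norm
  refine ⟨((2 * S) ^ d) ^ 2 * Bpsi * (Bpb * Ψ0), by positivity, ?_⟩
  intro H _ _ G M σw σb n hM0 hM hw hb hn
  have hprob := isProbabilityMeasure_paramLaw hp hw hb
  set μ := paramLaw pw pb σw σb
  have hn' : ((n ^ d : ℕ) : ℝ) ≠ 0 := by positivity
  have hci : ∀ a : Euc d, Integrable (fun t : Euc d × ℝ => |psi (inner ℝ t.1 a + t.2)|) μ :=
    fun a => Integrable.of_bound
      ((psi.continuous.comp (by fun_prop)).abs).aestronglyMeasurable Bpsi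
      (Eventually.of_forall fun t => by rw [Real.norm_eq_abs, abs_abs]; exact hBpsi _)
  -- The density of b is at most Bpb/σ_b and ψ is integrable.
  have hE : ∀ a : Euc d, ∫ t : Euc d × ℝ, |psi (inner ℝ t.1 a + t.2)| ∂μ ≤ Bpb * Ψ0 / σb := by
    intro a
    rw [integral_paramLaw hp hw hb (hci a)]
    have hin : ∀ v : Euc d, ∫ b, σb⁻¹ * pb (σb⁻¹ * b) * |psi (inner ℝ (σw • v) a + b)| ≤
        Bpb * Ψ0 / σb := by
      intro v
      have hbi : Integrable fun b => σb⁻¹ * Bpb * |psi (inner ℝ (σw • v) a + b)| :=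
        (hψ0.comp_add_left _).const_mul _
      refine (integral_mono_of_nonneg (Eventually.of_forall fun b => ?_) hbi
        (Eventually.of_forall fun b => ?_)).trans (le_of_eq ?_)
      · exact mul_nonneg (mul_nonneg (by positivity) (hp.regular_b.nonneg _)) (abs_nonneg _)
      · exact mul_le_mul_of_nonneg_right (mul_le_mul_of_nonneg_left (hBpb _) (by positivity))
          (abs_nonneg _)
      · rw [integral_const_mul, integral_add_left_eq_self (fun s => |psi s|), ← hΨ0]
        field_simp
    refine (integral_mono_of_nonneg (Eventually.of_forall fun v => ?_)
      (hp.regular_w.integrable.mul_const (Bpb * Ψ0 / σb)) (Eventually.of_forall fun v => ?_)).trans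
      (le_of_eq ?_)
    · exact mul_nonneg (hp.regular_w.nonneg v) (integral_nonneg fun b =>
        mul_nonneg (mul_nonneg (by positivity) (hp.regular_b.nonneg _)) (abs_nonneg _))
    · exact mul_le_mul_of_nonneg_left (hin v) (hp.regular_w.nonneg v)
    · rw [integral_mul_const, hp.regular_w.integral_eq_one, one_mul]
  set c := (2 * S) ^ d / ((n ^ d : ℕ) : ℝ) * M with hc
  have hc0 : 0 ≤ c := by positivity
  -- One factor of the square is bounded uniformly and the other kept, so the second moment inherits
  -- a single factor 1/σ_b from the first.
  have hpt : ∀ t : Euc d × ℝ, ‖gridTransform psi S n G t‖ ^ 2 ≤ ((2 * S) ^ d * M * Bpsi * c) *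
      ∑ j : Fin d → Fin n, |psi (inner ℝ t.1 (gridNode S n j) + t.2)| := by
    intro t
    rw [sq, mul_assoc]
    exact mul_le_mul (norm_gridTransform_le_const hS hn hBpsi hM0 hM t)
      (norm_gridTransform_le hS psi hM t) (norm_nonneg _) (by positivity)
  refine (integral_mono_of_nonneg (Eventually.of_forall fun t => sq_nonneg _)
    ((integrable_finsetSum _ fun j _ => hci (gridNode S n j)).const_mul _)
    (Eventually.of_forall hpt)).trans ?_
  rw [integral_const_mul, integral_finsetSum _ fun j _ => hci (gridNode S n j)]
  calc _ ≤ ((2 * S) ^ d * M * Bpsi * c) * ∑ _j : Fin d → Fin n, Bpb * Ψ0 / σb := by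
        gcongr; exact hE _
    _ = _ := by
        simp only [Finset.sum_const, Finset.card_univ, Fintype.card_fun, Fintype.card_fin,
          nsmul_eq_mul, hc]
        field_simp

/-- Where χ = 1 the error concerns G = χF alone and is G(x) minus an empirical mean, the form
required by the Monte Carlo bound. -/
theorem ridgeletError_eq {N : ℕ} (phi psi : ℝ → ℝ) (S : ℝ) {χ : Euc d → ℝ} (Z : ℝ) (n : ℕ)
    (F : Euc d → H) {x : Euc d} (hx : χ x = 1) (t : Fin N → Euc d × ℝ) :
    ridgeletError F phi psi S χ Z n x t = χ x • F x - (N : ℝ)⁻¹ •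
      ∑ i, phi (inner ℝ (t i).1 x + (t i).2) • Z •
        gridTransform psi S n (fun y => χ y • F y) (t i) := by
  rw [ridgeletError, hx, one_smul]
  congr 1
  simp only [ridgeletCoeff, gridTransform, Finset.sum_smul, Finset.smul_sum, smul_smul]
  rw [Finset.sum_comm]
  refine Finset.sum_congr rfl fun i _ => Finset.sum_congr rfl fun j _ => ?_
  congr 1
  ring

end Discretised

/-! ### The uniform error of the discretised operator -/

section UniformError

variable {d : ℕ} {phi : ℝ → ℝ} {phihat : ℝ → ℂ} {psi : 𝓢(ℝ, ℝ)} {pw : Euc d → ℝ} {pb : ℝ → ℝ}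

theorem exists_totalMass_eq (hp : IsBandwidthPair pw pb) :
    ∃ κ : ℝ, 0 < κ ∧ ∀ σw σb : ℝ, totalMass pw pb σw σb = κ * (σb * σw ^ d) := by
  have h1 := hp.regular_w.integral_norm_fourierR_pos
  have h2 := hp.regular_b.integral_norm_fourierR_pos
  refine ⟨(2 * Real.pi) ^ ((1 : ℝ) / 2) /
    ((∫ x, ‖fourierR pw x‖) * ∫ x, ‖fourierR pb x‖), by positivity, fun σw σb => ?_⟩
  rw [totalMass]
  ring

theorem IsBandwidthPair.integral_norm_fst (hp : IsBandwidthPair pw pb) {σw σb : ℝ} (hw : 0 < σw)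
    (hb : 0 < σb) : Integrable (fun t : Euc d × ℝ => ‖t.1‖) (paramLaw pw pb σw σb) ∧
      ∫ t : Euc d × ℝ, ‖t.1‖ ∂(paramLaw pw pb σw σb) = σw * ∫ v, ‖v‖ * pw v := by
  have e : (fun v : Euc d => pw v • ‖σw • v‖) = fun v => σw * (‖v‖ * pw v) := by
    funext v
    rw [norm_smul, Real.norm_of_nonneg hw.le, smul_eq_mul]
    ring
  constructor
  · refine integrable_paramLaw_fst hp hw hb (g := fun v => ‖v‖) ?_
    rw [e]
    exact hp.regular_w.integrable_norm_mul.const_mul _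
  · rw [integral_paramLaw_fst hp hw hb (fun v => ‖v‖), e, integral_const_mul]

theorem IsBandwidthPair.integral_norm_fst_sq (hp : IsBandwidthPair pw pb) {σw σb : ℝ}
    (hw : 0 < σw) (hb : 0 < σb) :
    Integrable (fun t : Euc d × ℝ => ‖t.1‖ ^ 2) (paramLaw pw pb σw σb) ∧
      ∫ t : Euc d × ℝ, ‖t.1‖ ^ 2 ∂(paramLaw pw pb σw σb) = σw ^ 2 * ∫ v, ‖v‖ ^ 2 * pw v := by
  have e : (fun v : Euc d => pw v • ‖σw • v‖ ^ 2) = fun v => σw ^ 2 * (‖v‖ ^ 2 * pw v) := by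
    funext v
    rw [norm_smul, Real.norm_of_nonneg hw.le, smul_eq_mul]
    ring
  constructor
  · refine integrable_paramLaw_fst hp hw hb (g := fun v => ‖v‖ ^ 2) ?_
    rw [e]
    exact hp.regular_w.secondMoment.const_mul _
  · rw [integral_paramLaw_fst hp hw hb (fun v => ‖v‖ ^ 2), e, integral_const_mul]

theorem memLp_fst_paramLaw (hp : IsBandwidthPair pw pb) {σw σb : ℝ} (hw : 0 < σw) (hb : 0 < σb) :
    MemLp (fun t : Euc d × ℝ => t.1) 2 (paramLaw pw pb σw σb) :=
  (memLp_two_iff_integrable_sq_norm continuous_fst.aestronglyMeasurable).2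
    (hp.integral_norm_fst_sq hw hb).1

/-- The error caused by replacing the ridgelet transform by its discretisation. -/
theorem exists_cubature_le (hact : IsActivationPair d phi phihat psi) (hp : IsBandwidthPair pw pb)
    {S : ℝ} (hS : 0 < S) :
    ∃ C : ℝ, 0 ≤ C ∧ ∀ {H : Type*} [NormedAddCommGroup H] [InnerProductSpace ℝ H]
      [CompleteSpace H] (G : Euc d → H) (M K σw σb : ℝ) (n : ℕ), 0 ≤ M → 0 ≤ K →
      (∀ x, ‖G x‖ ≤ M) → (∀ x y, ‖G y - G x‖ ≤ K * ‖y - x‖) → (∀ x, x ∉ cube d S → G x = 0) →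
      0 < σw → 0 < σb → 0 < n →
      ∀ x, ‖∫ t : Euc d × ℝ, phi (inner ℝ t.1 x + t.2) • totalMass pw pb σw σb •
          (∫ x', psi (inner ℝ t.1 x' + t.2) • G x') ∂(paramLaw pw pb σw σb) -
          ∫ t : Euc d × ℝ, phi (inner ℝ t.1 x + t.2) • totalMass pw pb σw σb •
            gridTransform psi S n G t ∂(paramLaw pw pb σw σb)‖ ≤
        C * (M + K) * (σb * σw ^ d * (σw + 1) / n) := by
  obtain ⟨κ, hκ, hZ⟩ := exists_totalMass_eq hp
  obtain ⟨Bphi, hBphi⟩ := hact.bounded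
  obtain ⟨Bpsi, hBpsi0, hBpsi, Lpsi, hLpsi⟩ := exists_bound_schwartz psi
  have hBphi0 : 0 ≤ Bphi := (abs_nonneg _).trans (hBphi 0)
  set m₁ := ∫ v, ‖v‖ * pw v with hm₁
  have hm₁0 : 0 ≤ m₁ := integral_nonneg fun v => mul_nonneg (norm_nonneg _) (hp.regular_w.nonneg v)
  refine ⟨Bphi * κ * (2 * S) ^ d * (d * (2 * S)) * (Lpsi * m₁ + Bpsi), by positivity, ?_⟩
  intro H _ _ _ G M K σw σb n hM0 hK0 hM hK h0 hw hb hn x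
  have hprob := isProbabilityMeasure_paramLaw hp hw hb
  obtain ⟨hi1, he1⟩ := hp.integral_norm_fst hw hb
  rw [hZ]
  set μ := paramLaw pw pb σw σb
  set Z := κ * (σb * σw ^ d) with hZ'
  have hZ0 : 0 ≤ Z := by positivity
  have hn0 : (0 : ℝ) < n := by exact_mod_cast hn
  have hGc : Continuous G := continuous_of_norm_sub_le hK
  have hGi : Integrable G := hGc.integrable_of_hasCompactSupport (hasCompactSupport_of_cube h0)
  have hphim : Continuous fun t : Euc d × ℝ => phi (inner ℝ t.1 x + t.2) :=
    hact.continuous.comp (by fun_prop)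
  have hT : AEStronglyMeasurable
      (fun t : Euc d × ℝ => ∫ x', psi (inner ℝ t.1 x' + t.2) • G x') μ := by
    have hc : Continuous fun z : (Euc d × ℝ) × Euc d => psi (inner ℝ z.1.1 z.2 + z.1.2) • G z.2 :=
      (psi.continuous.comp (by fun_prop)).smul (hGc.comp continuous_snd)
    exact hc.stronglyMeasurable.integral_prod_right'.aestronglyMeasurable
  have hTb : ∀ t : Euc d × ℝ, ‖∫ x', psi (inner ℝ t.1 x' + t.2) • G x'‖ ≤
      ∫ x', Bpsi * ‖G x'‖ := fun t =>
    norm_integral_le_of_norm_le (hGi.norm.const_mul _) (Eventually.of_forall fun x' => by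
      rw [norm_smul]
      exact mul_le_mul_of_nonneg_right (hBpsi _) (norm_nonneg _))
  have hint : ∀ {g : Euc d × ℝ → H} {B : ℝ}, AEStronglyMeasurable g μ → (∀ t, ‖g t‖ ≤ B) →
      Integrable (fun t => phi (inner ℝ t.1 x + t.2) • Z • g t) μ := fun {g B} hg hB =>
    Integrable.of_bound (hphim.aestronglyMeasurable.smul (hg.const_smul Z)) (Bphi * (Z * B))
      (Eventually.of_forall fun t => by
        rw [norm_smul, norm_smul, Real.norm_of_nonneg hZ0]
        exact mul_le_mul (hBphi _) (mul_le_mul_of_nonneg_left (hB t) hZ0) (by positivity) hBphi0)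
  rw [← integral_sub (hint hT hTb)
    (hint (continuous_gridTransform psi.continuous S n G).aestronglyMeasurable
      (norm_gridTransform_le_const hS hn hBpsi hM0 hM))]
  set c := Bphi * Z * (2 * S) ^ d * (d * (2 * S / n)) with hc
  -- The cubature error at one parameter is affine in ‖w‖, so its mean needs only the first moment
  -- of p_w.
  have hbd : ∀ t : Euc d × ℝ, ‖phi (inner ℝ t.1 x + t.2) • Z •
      (∫ x', psi (inner ℝ t.1 x' + t.2) • G x') -
      phi (inner ℝ t.1 x + t.2) • Z • gridTransform psi S n G t‖ ≤
      c * (Lpsi * M * ‖t.1‖ + Bpsi * K) := by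
    intro t
    rw [← smul_sub, ← smul_sub, norm_smul, norm_smul, Real.norm_of_nonneg hZ0, norm_sub_rev]
    calc _ ≤ Bphi * (Z * ((2 * S) ^ d * ((Lpsi * ‖t.1‖ * M + Bpsi * K) * (d * (2 * S / n))))) := by
          gcongr
          · exact hBphi _
          · exact norm_gridTransform_sub_le hS hn hBpsi hLpsi hM0 hK0 hM hK h0 t
      _ = _ := by rw [hc]; ring
  refine (norm_integral_le_of_norm_le (g := fun t => c * (Lpsi * M * ‖t.1‖ + Bpsi * K))
    (((hi1.const_mul _).add (integrable_const _)).const_mul _) (Eventually.of_forall hbd)).trans ?_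
  rw [integral_const_mul, integral_add (hi1.const_mul _) (integrable_const _), integral_const_mul,
    he1, integral_const, probReal_univ, one_smul]
  have h5 : Lpsi * M * (σw * m₁) + Bpsi * K ≤ (Lpsi * m₁ + Bpsi) * (M + K) * (σw + 1) := by
    have e : (Lpsi * m₁ + Bpsi) * (M + K) * (σw + 1) = Lpsi * M * (σw * m₁) + Bpsi * K +
      (Lpsi * m₁ * M + Lpsi * m₁ * K * (σw + 1) + Bpsi * M * (σw + 1) + Bpsi * K * σw) := by ring
    rw [e]
    have : 0 ≤ Lpsi * m₁ * M + Lpsi * m₁ * K * (σw + 1) + Bpsi * M * (σw + 1) + Bpsi * K * σw := by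
      positivity
    linarith
  calc _ ≤ c * ((Lpsi * m₁ + Bpsi) * (M + K) * (σw + 1)) :=
        mul_le_mul_of_nonneg_left h5 (by positivity)
    _ = _ := by rw [hc, hZ']; ring

/-- Comparison of the variance term of the Monte Carlo error with the terms of the rate. -/
theorem div_sqrt_le_of_le_min {e a₁ a₂ σw σb : ℝ} (ha₁ : 0 ≤ a₁) (ha₂ : 0 ≤ a₂) (hw : 0 < σw)
    (hb : 0 < σb) {N : ℕ} (hN : 0 < N) (h₁ : e ≤ a₁ * (σb * σw ^ d))
    (h₂ : e ≤ a₂ * (√σb * σw ^ d)) :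
    e / √N ≤ (a₁ + a₂) * (1 / σw + σb * σw ^ d * σw / √N) := by
  have hN1 : 1 ≤ √(N : ℝ) := Real.one_le_sqrt.2 (by exact_mod_cast hN)
  have hN0 : 0 < √(N : ℝ) := by linarith
  set s := √σb with hs
  have hs0 : 0 < s := Real.sqrt_pos.2 hb
  have hss : s * s = σb := Real.mul_self_sqrt hb.le
  have hp0 : 0 < σw ^ d := by positivity
  have hx : 0 ≤ 1 / σw := by positivity
  have hy : 0 ≤ σb * σw ^ d * σw / √N := by positivity
  have case₁ : e ≤ a₁ * (σb * σw ^ d * σw) →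
      e / √N ≤ (a₁ + a₂) * (1 / σw + σb * σw ^ d * σw / √N) := fun h => by
    calc e / √N ≤ a₁ * (σb * σw ^ d * σw) / √N := by gcongr
      _ = a₁ * (σb * σw ^ d * σw / √N) := by ring
      _ ≤ (a₁ + a₂) * (1 / σw + σb * σw ^ d * σw / √N) := by gcongr <;> linarith
  -- For σ_w ≥ 1 an extra factor σ_w is free. Otherwise, if √σ_b σ_w ≤ 1, then √σ_b σ_w^d ≤ √σ_b ≤
  -- 1/σ_w; if √σ_b σ_w ≥ 1, multiplying √σ_b σ_w^d by it gives σ_b σ_w^(d+1).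
  rcases le_total 1 σw with h | h
  · refine case₁ (h₁.trans ?_)
    exact mul_le_mul_of_nonneg_left (le_mul_of_one_le_right (by positivity) h) ha₁
  · have hp1 : σw ^ d ≤ 1 := pow_le_one₀ hw.le h
    rcases le_total (s * σw) 1 with h' | h'
    · have : e ≤ a₂ * (1 / σw) := by
        refine h₂.trans ?_
        gcongr
        calc s * σw ^ d ≤ s * 1 := by gcongr
          _ ≤ 1 / σw := by rw [mul_one, le_div_iff₀ hw]; exact h'
      calc e / √N ≤ a₂ * (1 / σw) / √N := by gcongr
        _ ≤ a₂ * (1 / σw) := div_le_self (by positivity) hN1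
        _ ≤ _ := by gcongr <;> linarith
    · have : e ≤ a₂ * (σb * σw ^ d * σw) := by
        refine h₂.trans (mul_le_mul_of_nonneg_left ?_ ha₂)
        rw [← hss]
        calc s * σw ^ d = s * σw ^ d * 1 := by ring
          _ ≤ s * σw ^ d * (s * σw) := by gcongr
          _ = _ := by ring
      calc e / √N ≤ a₂ * (σb * σw ^ d * σw) / √N := by gcongr
        _ = a₂ * (σb * σw ^ d * σw / √N) := by ring
        _ ≤ (a₁ + a₂) * (1 / σw + σb * σw ^ d * σw / √N) := by gcongr <;> linarith

/-- The error caused by sampling the weights and biases, uniformly over a bounded set. -/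
theorem exists_monteCarlo_le (hact : IsActivationPair d phi phihat psi) {Lphi : ℝ≥0}
    (hLip : LipschitzWith Lphi phi) (hp : IsBandwidthPair pw pb) {S : ℝ} (hS : 0 < S)
    {X : Set (Euc d)} (hX : X ⊆ cube d S) :
    ∃ C : ℝ, 0 ≤ C ∧ ∀ {H : Type*} [NormedAddCommGroup H] [InnerProductSpace ℝ H]
      [CompleteSpace H] (G : Euc d → H) (M σw σb : ℝ) (n N : ℕ) (δ : ℝ), 0 < M →
      (∀ x, ‖G x‖ ≤ M) → 0 < σw → 0 < σb → 0 < n → 0 < N → 0 < δ → δ < 1 →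
      ENNReal.ofReal (1 - δ) ≤ (Measure.pi fun _ : Fin N => paramLaw pw pb σw σb)
        {θ | ∀ x ∈ X, ‖(N : ℝ)⁻¹ • ∑ i, phi (inner ℝ (θ i).1 x + (θ i).2) •
            totalMass pw pb σw σb • gridTransform psi S n G (θ i) -
          ∫ t : Euc d × ℝ, phi (inner ℝ t.1 x + t.2) • totalMass pw pb σw σb •
            gridTransform psi S n G t ∂(paramLaw pw pb σw σb)‖ ≤
          C * M * (1 / σw + σb * σw ^ d * (σw + √(Real.log δ⁻¹)) / √N)} := by
  obtain ⟨κ, hκ, hZ⟩ := exists_totalMass_eq hp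
  obtain ⟨Bphi', hBphi'⟩ := hact.bounded
  obtain ⟨Bphi, hBphi0, hBphi⟩ : ∃ B : ℝ, 0 < B ∧ ∀ s, |phi s| ≤ B :=
    ⟨max Bphi' 1, by positivity, fun s => (hBphi' s).trans (le_max_left _ _)⟩
  obtain ⟨Bpsi, hBpsi0, hBpsi, -⟩ := exists_bound_schwartz psi
  obtain ⟨C₂, hC₂, h₂⟩ := exists_integral_norm_gridTransform_sq_le psi hp hS
  obtain ⟨ρ, hρ0, hρ⟩ := exists_bound_cube d S
  set m₂ := ∫ v, ‖v‖ ^ 2 * pw v with hm₂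
  set α := κ * ((2 * S) ^ d * Bpsi) with hα
  have hα0 : 0 < α := by positivity
  refine ⟨4 * Bphi * (α + κ * √C₂) + 4 * α * Lphi * ρ * √m₂ + 4 * α * Bphi, by positivity, ?_⟩
  intro H _ _ _ G M σw σb n N δ hM0 hM hw hb hn hN hδ0 hδ1
  have hprob := isProbabilityMeasure_paramLaw hp hw hb
  rw [hZ]
  set Z := κ * (σb * σw ^ d) with hZ'
  have hZ0 : 0 < Z := by positivity
  have hbound : ∀ t, ‖Z • gridTransform psi S n G t‖ ≤ α * M * (σb * σw ^ d) := fun t => by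
    rw [norm_smul, Real.norm_of_nonneg hZ0.le]
    calc _ ≤ Z * ((2 * S) ^ d * M * Bpsi) :=
          mul_le_mul_of_nonneg_left (norm_gridTransform_le_const hS hn hBpsi hM0.le hM t) hZ0.le
      _ = _ := by rw [hZ', hα]; ring
  have hcont : Continuous fun t => Z • gridTransform psi S n G t :=
    (continuous_gridTransform psi.continuous S n G).const_smul Z
  have hmc := monteCarlo_uniform (μ := paramLaw pw pb σw σb) hcont (A := α * M * (σb * σw ^ d))
    (by positivity) hbound hLip hBphi0 hBphi (memLp_fst_paramLaw hp hw hb) hρ0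
    (fun x hx => hρ x (hX hx)) hN hδ0 hδ1
  refine hmc.trans (measure_mono fun θ hθ x hx => (hθ x hx).trans ?_)
  set e := √(∫ t, ‖Z • gridTransform psi S n G t‖ ^ 2 ∂(paramLaw pw pb σw σb)) with he
  have he₁ : e ≤ α * M * (σb * σw ^ d) := by
    rw [he, Real.sqrt_le_left (by positivity)]
    refine (integral_mono_of_nonneg (Eventually.of_forall fun t => sq_nonneg _)
      (integrable_const ((α * M * (σb * σw ^ d)) ^ 2)) (Eventually.of_forall fun t => ?_)).trans
      (le_of_eq (by simp))
    exact pow_le_pow_left₀ (norm_nonneg _) (hbound t) 2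
  -- The second moment decays like 1/σ_b while Z² grows like σ_b², which leaves √σ_b after the root.
  have he₂ : e ≤ κ * √C₂ * M * (√σb * σw ^ d) := by
    rw [he, Real.sqrt_le_left (by positivity)]
    simp_rw [norm_smul, mul_pow]
    rw [integral_const_mul]
    calc _ ≤ ‖Z‖ ^ 2 * (C₂ * M ^ 2 / σb) := by gcongr; exact h₂ G M σw σb n hM0.le hM hw hb hn
      _ = _ := by
        rw [Real.norm_of_nonneg hZ0.le, Real.sq_sqrt hC₂, Real.sq_sqrt hb.le, hZ']
        field_simp
  have hmain := div_sqrt_le_of_le_min (by positivity) (by positivity) hw hb hN he₁ he₂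
  have hw2 : √(∫ t : Euc d × ℝ, ‖t.1‖ ^ 2 ∂(paramLaw pw pb σw σb)) = σw * √m₂ := by
    rw [(hp.integral_norm_fst_sq hw hb).2, Real.sqrt_mul (by positivity), Real.sqrt_sq hw.le]
  rw [hw2]
  set ℓ := √(Real.log δ⁻¹)
  set r := σb * σw ^ d / √N with hr
  have hr0 : 0 ≤ r := by positivity
  have hℓ0 : 0 ≤ ℓ := Real.sqrt_nonneg _
  have hq : σb * σw ^ d * (σw + ℓ) / √N = r * σw + r * ℓ := by rw [hr]; ring
  have hmain' : e / √N ≤ (α + κ * √C₂) * M * (1 / σw + (r * σw + r * ℓ)) := by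
    calc e / √N ≤ _ := hmain
      _ = (α + κ * √C₂) * M * (1 / σw + r * σw) := by rw [hr]; ring
      _ ≤ _ := by
        gcongr
        exact le_add_of_nonneg_right (by positivity)
  have hx : 0 ≤ 1 / σw := by positivity
  have b2 : r * σw ≤ 1 / σw + (r * σw + r * ℓ) := by
    have : 0 ≤ r * ℓ := by positivity
    linarith
  have b3 : r * ℓ ≤ 1 / σw + (r * σw + r * ℓ) := by
    have : 0 ≤ r * σw := by positivity
    linarith
  rw [hq]
  calc _ = 4 * Bphi * (e / √N) + 4 * α * Lphi * ρ * √m₂ * M * (r * σw) +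
        4 * α * Bphi * M * (r * ℓ) := by rw [hr]; ring
    _ ≤ 4 * Bphi * ((α + κ * √C₂) * M * (1 / σw + (r * σw + r * ℓ))) +
        4 * α * Lphi * ρ * √m₂ * M * (1 / σw + (r * σw + r * ℓ)) +
        4 * α * Bphi * M * (1 / σw + (r * σw + r * ℓ)) := by gcongr
    _ = _ := by ring

/-- With high probability, the discretised operator reproduces a bounded Lipschitz function with
values in a Hilbert space, uniformly on `X`. -/
theorem exists_uniform_error (hd : 0 < d) (hact : IsActivationPair d phi phihat psi) {Lphi : ℝ≥0}
    (hLip : LipschitzWith Lphi phi) (hp : IsBandwidthPair pw pb) {S : ℝ} (hS : 0 < S)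
    {X : Set (Euc d)} (hX : X ⊆ cube d S) {χ : Euc d → ℝ} (hχ : IsMollifier X S χ) :
    ∃ C : ℝ, 0 < C ∧ ∀ {H : Type*} [NormedAddCommGroup H] [InnerProductSpace ℝ H]
      [CompleteSpace H] (F : Euc d → H) (L σw σb : ℝ) (n N : ℕ) (δ : ℝ), 0 < L →
      (∀ x ∈ cube d S, ‖F x‖ ≤ L) →
      (∀ x ∈ cube d S, ∀ y ∈ cube d S, ‖F y - F x‖ ≤ d * L * ‖y - x‖) →
      0 < σw → 0 < σb → 0 < n → 0 < N → 0 < δ → δ < 1 →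
      ENNReal.ofReal (1 - δ) ≤ (Measure.pi fun _ : Fin N => paramLaw pw pb σw σb)
        {θ | ∀ x ∈ X, ‖ridgeletError F phi psi S χ (totalMass pw pb σw σb) n x θ‖ ≤
          C * L * rate d σw σb (n ^ d) N δ} := by
  obtain ⟨C₁, hC₁, h₁⟩ := exists_bias_le hact hp S
  obtain ⟨C₂, hC₂, h₂⟩ := exists_cubature_le hact hp hS
  obtain ⟨C₃, hC₃, h₃⟩ := exists_monteCarlo_le hact hLip hp hS hX
  obtain ⟨Kχ, hKχ⟩ := exists_lipschitzWith_mollifier hχ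
  -- The factor 1 + (Kχ + d) converts L + K into a multiple of L, and the last 1 makes the constant
  -- strictly positive.
  refine ⟨(C₁ + C₂) * (1 + (Kχ + d)) + C₃ + 1, by positivity, ?_⟩
  intro H _ _ _ F L σw σb n N δ hL0 hF hF' hw hb hn hN hδ0 hδ1
  set G : Euc d → H := fun y => χ y • F y with hG
  set K := Kχ * L + d * L with hK
  have hK0 : 0 ≤ K := by positivity
  have hG0 : ∀ x, x ∉ cube d S → G x = 0 := fun x hx => by
    simp only [hG, hχ.eq_zero x hx, zero_smul]
  have hGL : ∀ x, ‖G x‖ ≤ L := fun x => by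
    by_cases hx : x ∈ cube d S
    · rw [hG, norm_smul, Real.norm_of_nonneg (hχ.mem_Icc x).1]
      calc χ x * ‖F x‖ ≤ 1 * L := mul_le_mul (hχ.mem_Icc x).2 (hF x hx) (norm_nonneg _) zero_le_one
        _ = L := one_mul L
    · rw [hG0 x hx, norm_zero]; exact hL0.le
  have hGK : ∀ x y, ‖G y - G x‖ ≤ K * ‖y - x‖ :=
    lipschitzWith_cutoff_smul hKχ hχ.mem_Icc hχ.eq_zero hF hF' (by positivity) hL0.le
  refine (h₃ G L σw σb n N δ hL0 hGL hw hb hn hN hδ0 hδ1).trans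
    (measure_mono fun θ hθ x hx => ?_)
  have b₁ := h₁ G L K σw σb hL0.le hK0 hGL hGK hG0 hw hb x
  have b₂ := h₂ G L K σw σb n hL0.le hK0 hGL hGK hG0 hw hb hn x
  have b₃ := hθ x hx
  rw [norm_sub_rev] at b₃
  rw [ridgeletError_eq phi psi S _ n F (hχ.eq_one x hx)]
  refine ((norm_sub_le_norm_sub_add_norm_sub _ _ _).trans
    (add_le_add (norm_sub_le_norm_sub_add_norm_sub _ _ _) le_rfl)).trans ((add_le_add (add_le_add b₁ b₂) b₃).trans ?_)
  -- With D = n^d nodes, D^(1/d) is the number n of nodes per axis.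
  have hroot : (((n ^ d : ℕ) : ℝ)) ^ ((1 : ℝ) / d) = n := by
    rw [Nat.cast_pow, one_div, Real.pow_rpow_inv_natCast (Nat.cast_nonneg n) hd.ne']
  rw [rate, hroot]
  set u₁ := 1 / σw
  set u₂ := σw ^ d * (σw + 1) / σb
  set u₃ := σb * σw ^ d * (σw + 1) / n
  set u₄ := σb * σw ^ d * (σw + √(Real.log δ⁻¹)) / √N
  have p₁ : 0 ≤ u₁ := by positivity
  have p₂ : 0 ≤ u₂ := by positivity
  have p₃ : 0 ≤ u₃ := by positivity
  have p₄ : 0 ≤ u₄ := by positivity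
  have hLK : L + K = (1 + (Kχ + d)) * L := by rw [hK]; ring
  rw [hLK]
  set κ := 1 + ((Kχ : ℝ) + d)
  have hκ : 0 ≤ κ := by positivity
  calc _ ≤ C₁ * (κ * L) * (u₁ + u₂ + u₃ + u₄) + C₂ * (κ * L) * (u₁ + u₂ + u₃ + u₄) +
        C₃ * L * (u₁ + u₂ + u₃ + u₄) := by
        refine add_le_add (add_le_add ?_ ?_) ?_ <;>
          exact mul_le_mul_of_nonneg_left (by linarith) (by positivity)
    _ = ((C₁ + C₂) * κ + C₃) * L * (u₁ + u₂ + u₃ + u₄) := by ring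
    _ ≤ _ := by
        refine mul_le_mul_of_nonneg_right (mul_le_mul_of_nonneg_right ?_ hL0.le) (by positivity)
        linarith

end UniformError

/-! ### Continuity of the error and transfer to the sample space -/

section Transfer

variable {d N : ℕ} {H : Type*} [NormedAddCommGroup H] [InnerProductSpace ℝ H]

/-- Continuity in the parameters makes the good event closed, hence measurable although it is an
intersection over all of X. -/
theorem continuous_ridgeletError_param {phi psi : ℝ → ℝ} (hphi : Continuous phi)
    (hpsi : Continuous psi) (F : Euc d → H) (S : ℝ) (χ : Euc d → ℝ) (Z : ℝ) (n : ℕ) (x : Euc d) :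
    Continuous fun t : Fin N → Euc d × ℝ => ridgeletError F phi psi S χ Z n x t := by
  unfold ridgeletError ridgeletCoeff
  fun_prop

theorem continuousOn_ridgeletError {phi : ℝ → ℝ} (hphi : Continuous phi) (psi : ℝ → ℝ)
    {F : Euc d → H} {X : Set (Euc d)} (hF : ContinuousOn F X) (S : ℝ) (χ : Euc d → ℝ) (Z : ℝ)
    (n : ℕ) (t : Fin N → Euc d × ℝ) :
    ContinuousOn (fun x => ridgeletError F phi psi S χ Z n x t) X := by
  unfold ridgeletError ridgeletCoeff
  fun_prop

variable {Ω : Type*} [MeasurableSpace Ω] {P : Measure Ω}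
variable {w : Fin N → Ω → Euc d} {b : Fin N → Ω → ℝ} {pw : Euc d → ℝ} {pb : ℝ → ℝ} {σw σb : ℝ}

theorem IsParamSample.measurable_params (h : IsParamSample P w b pw pb σw σb) :
    Measurable (params w b) :=
  measurable_pi_lambda _ fun i => (h.measurable_w i).prodMk (h.measurable_b i)

theorem IsParamSample.map_params [IsProbabilityMeasure P] (h : IsParamSample P w b pw pb σw σb) :
    P.map (params w b) = Measure.pi fun _ : Fin N => paramLaw pw pb σw σb := by
  have h1 := (iIndepFun_iff_map_fun_eq_pi_map
    (fun i => ((h.measurable_w i).prodMk (h.measurable_b i)).aemeasurable)).1 h.indep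
  simp only [h.law] at h1
  exact h1

/-- Continuous random fields that are versions of each other are indistinguishable. -/
theorem ae_forall_eq_of_continuousOn {X : Set (Euc d)} {V W : Euc d → Ω → ℝ}
    (h : ∀ x ∈ X, V x =ᵐ[P] W x) (hV : ∀ᵐ ω ∂P, ContinuousOn (fun x => V x ω) X)
    (hW : ∀ᵐ ω ∂P, ContinuousOn (fun x => W x ω) X) :
    ∀ᵐ ω ∂P, ∀ x ∈ X, V x ω = W x ω := by
  obtain ⟨s, hs, hsd⟩ := TopologicalSpace.exists_countable_dense X
  have hall : ∀ᵐ ω ∂P, ∀ x ∈ s, V x ω = W x ω :=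
    (ae_ball_iff hs).2 fun x _ => h x x.2
  filter_upwards [hall, hV, hW] with ω h1 h2 h3 x hx
  exact congrFun (Continuous.ext_on hsd (continuousOn_iff_continuous_domRestrict.1 h2)
    (continuousOn_iff_continuous_domRestrict.1 h3) fun y hy => h1 y hy) ⟨x, hx⟩

/-- Strict positive definiteness at a single point gives k(0,0) > 0. The Monte Carlo bound needs a
strictly positive scale. -/
theorem M1starK_pos {S : ℝ} (hS : 0 < S) {k : Euc d → Euc d → ℝ} (hk : IsC11 k)
    (hpos : IsPosDefKernel k) : 0 < M1starK S k := by
  have h := hpos 1 (fun _ => 0) (fun _ => 1) (Function.injective_of_subsingleton _)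
    (fun h => one_ne_zero (congrFun h 0))
  simp only [Finset.univ_unique, Finset.sum_singleton, one_mul] at h
  exact h.trans_le ((le_abs_self _).trans (abs_mixedD_le_M1starK hk none none
    (zero_mem_cube d hS.le) (zero_mem_cube d hS.le)))

end Transfer

end RidgeletPrior

open RidgeletPrior

/-! ### The main theorem -/

theorem theorem2 {d : ℕ} (hd : 0 < d)
    (phi : ℝ → ℝ) (phihat : ℝ → ℂ) (psi : 𝓢(ℝ, ℝ)) (hact : IsActivationPair d phi phihat psi)
    (Lphi : ℝ≥0) (hLip : LipschitzWith Lphi phi)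
    (pw : Euc d → ℝ) (pb : ℝ → ℝ) (hp : IsBandwidthPair pw pb)
    (X : Set (Euc d)) (hX : IsCompact X) (S : ℝ) (hS : 0 < S) (hXS : X ⊆ interior (cube d S))
    (χ : Euc d → ℝ) (hχ : IsMollifier X S χ) :
    ∃ C : ℝ, 0 < C ∧
      ∀ (m : Euc d → ℝ) (k : Euc d → Euc d → ℝ), ContDiff ℝ 1 m → IsC11 k →
        (∀ x y, k x y = k y x) → IsPosDefKernel k →
      ∀ (σw σb : ℝ) (n N : ℕ) (δ : ℝ), 0 < σw → 0 < σb → 0 < n → 0 < N → 0 < δ → δ < 1 →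
      ∀ (Ω : Type*) [MeasurableSpace Ω] (P : Measure Ω) [IsProbabilityMeasure P]
        (f : Euc d → Ω → ℝ) (w : Fin N → Ω → Euc d) (b : Fin N → Ω → ℝ),
        IsGP P f m k → IsParamSample P w b pw pb σw σb →
        IndepFun (fun ω x => f x ω) (params w b) P →
        (∀ x ∈ X, Integrable (sqError phi psi S χ (totalMass pw pb σw σb) n w b f x) P) ∧
        (∃ V, IsContinuousCondExp P w b X
          (sqError phi psi S χ (totalMass pw pb σw σb) n w b f) V) ∧
        ∀ V, IsContinuousCondExp P w b X
            (sqError phi psi S χ (totalMass pw pb σw σb) n w b f) V →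
          ENNReal.ofReal (1 - δ) ≤ P {ω | ∀ x ∈ X, √(V x ω) ≤
            C * (M1star S m + √(M1starK S k)) * rate d σw σb (n ^ d) N δ} := by
  have hXc : X ⊆ cube d S := hXS.trans interior_subset
  -- The constant is fixed before any Hilbert space is chosen, so L²(P) may be inserted for every
  -- probability space.
  obtain ⟨C, hC, hmain⟩ := exists_uniform_error hd hact hLip hp hS hXc hχ
  obtain ⟨Bphi, hBphi⟩ := hact.bounded
  obtain ⟨Bpsi, -, hBpsi, -⟩ := exists_bound_schwartz psi
  refine ⟨C, hC, ?_⟩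
  intro m k hm hk _ hpos σw σb n N δ hw hb hn hN hδ0 hδ1 Ω _ P _ f w b hf hs hind
  set Z := totalMass pw pb σw σb with hZ
  set L := M1star S m + √(M1starK S k) with hL
  have hL0 : 0 < L :=
    add_pos_of_nonneg_of_pos (M1star_nonneg S m) (Real.sqrt_pos.2 (M1starK_pos hS hk hpos))
  have hF : ∀ x ∈ cube d S, ‖gpFeature hf x‖ ≤ L := fun x hx =>
    norm_feature_le hm hk (inner_gpFeature hf) hx
  have hF' : ∀ x ∈ cube d S, ∀ y ∈ cube d S,
      ‖gpFeature hf y - gpFeature hf x‖ ≤ d * L * ‖y - x‖ := fun x hx y hy =>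
    norm_feature_sub_le hm hk (inner_gpFeature hf) hx hy
  have hFc : ContinuousOn (gpFeature hf) X := by
    refine LipschitzOnWith.continuousOn (K := ⟨d * L, by positivity⟩)
      (LipschitzOnWith.of_dist_le_mul fun x hx y hy => ?_)
    rw [dist_eq_norm, dist_eq_norm]
    exact hF' y (hXc hy) x (hXc hx)
  have hcond := integrable_and_condExp_sqError hf hact.continuous psi.continuous hBphi hBpsi S
    hχ.mem_Icc Z n hs.measurable_w hs.measurable_b hind
  have hcont : ∀ ω, ContinuousOn (fun x =>
      ‖ridgeletError (gpFeature hf) phi psi S χ Z n x (params w b ω)‖ ^ 2) X := fun ω =>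
    (continuousOn_ridgeletError hact.continuous psi hFc S χ Z n _).norm.pow 2
  refine ⟨fun x _ => (hcond x).1, ⟨fun x ω =>
    ‖ridgeletError (gpFeature hf) phi psi S χ Z n x (params w b ω)‖ ^ 2,
    fun x _ => (hcond x).2.symm, Eventually.of_forall hcont⟩, fun V hV => ?_⟩
  -- The squared norm in L²(P) is one continuous version, and any other agrees with it on all of X
  -- off a single null set.
  have hVeq := ae_forall_eq_of_continuousOn (fun x hx => (hV.version x hx).trans (hcond x).2)
    hV.continuous (Eventually.of_forall hcont)
  have hbound := hmain (gpFeature hf) L σw σb n N δ hL0 hF hF' hw hb hn hN hδ0 hδ1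
  -- The good event of the product law is pulled back along the parameters to the sample space.
  rw [← hs.map_params, Measure.map_apply hs.measurable_params] at hbound
  · refine hbound.trans (measure_mono_ae ?_)
    filter_upwards [hVeq] with ω hω hgood x hx
    rw [hω x hx, Real.sqrt_sq (norm_nonneg _)]
    exact hgood x hx
  · simp only [Set.ofPred_forall]
    exact (isClosed_biInter fun x _ => isClosed_le (continuous_ridgeletError_param hact.continuous
      psi.continuous _ S χ _ n x).norm continuous_const).measurableSet
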